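/- Consider, for sample sizes $n=1,2,\dots$, the matrix exponential spatial model $$e^{\lambda_0 W}Y=X\beta_0+U,\qquad e^{\rho_0 M}U=V,$$ where $W=W_n$ and $M=M_n$ are nonrandom $n\times n$ matrices with zero diagonals, $X=X_n$ is a nonrandom $n\times k$ matrix ($k$ fixed), $\beta_0\in\mathbb R^k$ and $\zeta_0=(\lambda_0,\rho_0)\in\mathbb R^2$ are fixed, and $V=(v_1,\dots,v_n)'$ is the vector of errors. Write $\gamma=(\beta',\zeta')'$, $\zeta=(\lambda,\rho)'$, $V(\gamma)=e^{\rho M}(e^{\lambda W}Y-X\beta)$, $\mathbb W(\rho)=e^{\rho M}We^{-\rho M}$, $\mathbb W_D(\rho)=\mathbb W(\rho)-\mathrm{Diag}(\mathbb W(\rho))$, $A^s=A+A'$, and let $$S^*(\gamma)=\begin{pmatrix}X'e^{\rho M'}V(\gamma)\\ -Y'e^{\lambda W'}e^{\rho M'}\mathbb W_D(\rho)V(\gamma)\\ -V(\gamma)'MV(\gamma)\end{pmatrix}$$ be the adjusted score. Let $\hat\beta_M(\zeta)=(X'e^{\rho M'}e^{\rho M}X)^{-1}X'e^{\rho M'}e^{\rho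 M}e^{\lambda W}Y$, let $S^{*c}(\zeta)$ be the $(\lambda,\rho)$-part of $S^*(\hat\beta_M(\zeta),\zeta)$, let $\bar\beta_M(\zeta)$ be $\hat\beta_M(\zeta)$ with $Y$ replaced by $\mathrm E(Y)$, and let $\bar S^{*c}(\zeta)$ be the $(\lambda,\rho)$-part of $\mathrm E\,S^*(\beta,\zeta)$ at $\beta=\bar\beta_M(\zeta)$. Assume: 1. For each $n$ the errors $v_1,\dots,v_n$ are independent with $\mathrm E(v_i)=0$ and $\mathrm{Var}(v_i)=\sigma_i^2$ (possibly different for different $i$), and $\sup_{n,i}\mathrm E|v_i|^{4+\varrho}<\infty$ for some $\varrho>0$. 2. $W$ and $M$ are bounded in the row sum and the column sum matrix norms, uniformly in $n$. 3. $\zeta_0$ lies in the interior of $\Delta=[-c,c]\times[-c,c]$ for a constant $c>0$. 4. The elements of $X$ are bounded uniformly in $n$, $X$ has full column rank for all large $n$, and $\frac1nX'e^{\rho M'}e^{\rho M}X$ converges to a nonsingular limit, uniformly in $\rho\in[-c,c]$. 5. For every $\vartheta>0$, $\liminf_{n\to\infty}\ \inf\{\frac1n\|\bar S^{*c}(\zeta)\|:\zeta\in\Delta,\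 \|\zeta-\zeta_0\|\ge\vartheta\}>0$. Let $\hat\zeta_M$ be an M-estimator of $\zeta_0$, that is, with probability tending to one $\hat\zeta_M\in\Delta$ and $S^{*c}(\hat\zeta_M)=0$, and let $\hat\gamma_M=(\hat\beta_M(\hat\zeta_M)',\hat\zeta_M')'$. Let $\Omega(\gamma_0)=\mathrm{Var}\big(n^{-1/2}S^*(\gamma_0)\big)$, and let the plug-in estimator $\Omega(\hat\gamma_M)$ be the symmetric matrix $$\frac1n\begin{pmatrix}X'e^{\rho M'}\Sigma e^{\rho M}X & -X'e^{\rho M'}\Sigma\mathbb W_D'e^{\rho M}X\beta & 0\\ * & \beta'X'e^{\rho M'}\mathbb W_D\Sigma\mathbb W_D'e^{\rho M}X\beta+\mathrm{tr}(\Sigma\mathbb W_D\Sigma\mathbb W_D^s) & \mathrm{tr}(\Sigma\mathbb W_D\Sigma M^s)\\ * & * & \mathrm{tr}(\Sigma M\Sigma M^s)\end{pmatrix}$$ with $\mathbb W_D=\mathbb W_D(\rho)$, evaluated at $\gamma=\hat\gamma_M$ and with $\Sigma$ replaced by $\hat\Sigma=\mathrm{Diag}\big(v_1^2(\hat\gamma_M),\dots,v_n^2(\hat\gamma_M)\big)$,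 the squared residuals, where $v_i(\gamma)$ is the $i$-th element of $V(\gamma)$. (At $\gamma=\gamma_0$ and $\Sigma=\mathrm{Diag}(\sigma_1^2,\dots,\sigma_n^2)$ this matrix is $\Omega(\gamma_0)$.) Then the plug-in estimator is consistent: $\Omega(\hat\gamma_M)=\Omega(\gamma_0)+o_p(1)$ as $n\to\infty$, i.e. every element of the $(k+2)\times(k+2)$ matrix $\Omega(\hat\gamma_M)-\Omega(\gamma_0)$ converges to zero in probability. -/

import Mathlib

open MeasureTheory ProbabilityTheory Filter Topology Matrix

noncomputable section

namespace MESS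

variable {n k : ℕ}

/-! Sample of size `n` with `k` regressors. The spatial parameters are collected in
`ζ = (lam, ρ) : ℝ × ℝ`, the coefficients of the regressors in `β : Fin k → ℝ`. Below `W` and `M`
are the spatial weights matrices, `X` is the matrix of regressors, and `y` is the vector of
observations of the dependent variable. -/

/-- The residual vector `V(β, ζ) = e^{ρM} (e^{lam W} y - X β)`. -/
def resid (W M : Matrix (Fin n) (Fin n) ℝ) (X : Matrix (Fin n) (Fin k) ℝ) (y : Fin n → ℝ)
    (β : Fin k → ℝ) (ζ : ℝ × ℝ) : Fin n → ℝ :=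
  NormedSpace.exp (ζ.2 • M) *ᵥ (NormedSpace.exp (ζ.1 • W) *ᵥ y - X *ᵥ β)

/-- The matrix `𝕎(ρ) = e^{ρM} W e^{-ρM}`. -/
def twisted (W M : Matrix (Fin n) (Fin n) ℝ) (ρ : ℝ) : Matrix (Fin n) (Fin n) ℝ :=
  NormedSpace.exp (ρ • M) * W * NormedSpace.exp (-(ρ • M))

/-- The matrix `𝕎_D(ρ) = 𝕎(ρ) - Diag(𝕎(ρ))`. -/
def twistedD (W M : Matrix (Fin n) (Fin n) ℝ) (ρ : ℝ) : Matrix (Fin n) (Fin n) ℝ :=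
  twisted W M ρ - Matrix.diagonal (Matrix.diag (twisted W M ρ))

/-- The `β`-part of the adjusted score, `X' e^{ρM'} V(β, ζ)`. -/
def scoreBeta (W M : Matrix (Fin n) (Fin n) ℝ) (X : Matrix (Fin n) (Fin k) ℝ) (y : Fin n → ℝ)
    (β : Fin k → ℝ) (ζ : ℝ × ℝ) : Fin k → ℝ :=
  (Xᵀ * NormedSpace.exp (ζ.2 • Mᵀ)) *ᵥ resid W M X y β ζ

/-- The `lam`-part of the adjusted score, `- y' e^{lam W'} e^{ρM'} 𝕎_D(ρ) V(β, ζ)`. -/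
def scoreLam (W M : Matrix (Fin n) (Fin n) ℝ) (X : Matrix (Fin n) (Fin k) ℝ) (y : Fin n → ℝ)
    (β : Fin k → ℝ) (ζ : ℝ × ℝ) : ℝ :=
  -(y ⬝ᵥ ((NormedSpace.exp (ζ.1 • Wᵀ) * NormedSpace.exp (ζ.2 • Mᵀ) * twistedD W M ζ.2) *ᵥ
      resid W M X y β ζ))

/-- The `ρ`-part of the adjusted score, `- V(β, ζ)' M V(β, ζ)`. -/
def scoreRho (W M : Matrix (Fin n) (Fin n) ℝ) (X : Matrix (Fin n) (Fin k) ℝ) (y : Fin n → ℝ)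
    (β : Fin k → ℝ) (ζ : ℝ × ℝ) : ℝ :=
  -(resid W M X y β ζ ⬝ᵥ (M *ᵥ resid W M X y β ζ))

/-- The adjusted score `S*(γ)`, `γ = (β, lam, ρ)`. The index `Sum.inl a` stands for the `a`-th
component of `β`, `Sum.inr 0` for `lam`, and `Sum.inr 1` for `ρ`. -/
def score (W M : Matrix (Fin n) (Fin n) ℝ) (X : Matrix (Fin n) (Fin k) ℝ) (y : Fin n → ℝ)
    (β : Fin k → ℝ) (ζ : ℝ × ℝ) : Fin k ⊕ Fin 2 → ℝ :=
  Sum.elim (scoreBeta W M X y β ζ) ![scoreLam W M X y β ζ, scoreRho W M X y β ζ]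

/-- The estimator of `β` for a given value of `ζ`,
`(X' e^{ρM'} e^{ρM} X)⁻¹ X' e^{ρM'} e^{ρM} e^{lam W} y`. -/
def betaHat (W M : Matrix (Fin n) (Fin n) ℝ) (X : Matrix (Fin n) (Fin k) ℝ) (y : Fin n → ℝ)
    (ζ : ℝ × ℝ) : Fin k → ℝ :=
  ((Xᵀ * NormedSpace.exp (ζ.2 • Mᵀ) * NormedSpace.exp (ζ.2 • M) * X)⁻¹ *
    (Xᵀ * NormedSpace.exp (ζ.2 • Mᵀ) * NormedSpace.exp (ζ.2 • M) *
      NormedSpace.exp (ζ.1 • W))) *ᵥ y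

/-- The concentrated adjusted score `S*ᶜ(ζ)`: the `lam`- and `ρ`-parts of the adjusted score at
the estimator of `β` for the given `ζ`. -/
def concScore (W M : Matrix (Fin n) (Fin n) ℝ) (X : Matrix (Fin n) (Fin k) ℝ) (y : Fin n → ℝ)
    (ζ : ℝ × ℝ) : ℝ × ℝ :=
  (scoreLam W M X y (betaHat W M X y ζ) ζ, scoreRho W M X y (betaHat W M X y ζ) ζ)

/-- The population counterpart of the estimator of `β` for a given `ζ`, with the random vector `Y`
replaced by its expectation. -/
def betaBar {Ω : Type*} [MeasurableSpace Ω] (μ : Measure Ω)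
    (W M : Matrix (Fin n) (Fin n) ℝ) (X : Matrix (Fin n) (Fin k) ℝ) (Y : Ω → Fin n → ℝ)
    (ζ : ℝ × ℝ) : Fin k → ℝ :=
  betaHat W M X (fun i => ∫ ω, Y ω i ∂μ) ζ

/-- The population counterpart of the concentrated adjusted score: the expectation of the `lam`-
and `ρ`-parts of the adjusted score at `betaBar`. -/
def popConcScore {Ω : Type*} [MeasurableSpace Ω] (μ : Measure Ω)
    (W M : Matrix (Fin n) (Fin n) ℝ) (X : Matrix (Fin n) (Fin k) ℝ) (Y : Ω → Fin n → ℝ)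
    (ζ : ℝ × ℝ) : ℝ × ℝ :=
  (∫ ω, scoreLam W M X (Y ω) (betaBar μ W M X Y ζ) ζ ∂μ,
    ∫ ω, scoreRho W M X (Y ω) (betaBar μ W M X Y ζ) ζ ∂μ)

/-- `Ω(γ) = Var(n^{-1/2} S*(γ))`, the variance-covariance matrix of the normalized adjusted
score (evaluated below at the true parameter values). -/
def omegaTrue {Ω : Type*} [MeasurableSpace Ω] (μ : Measure Ω)
    (W M : Matrix (Fin n) (Fin n) ℝ) (X : Matrix (Fin n) (Fin k) ℝ) (Y : Ω → Fin n → ℝ)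
    (β : Fin k → ℝ) (ζ : ℝ × ℝ) : Matrix (Fin k ⊕ Fin 2) (Fin k ⊕ Fin 2) ℝ :=
  Matrix.of fun a b =>
    covariance (fun ω => (√(n : ℝ))⁻¹ * score W M X (Y ω) β ζ a)
      (fun ω => (√(n : ℝ))⁻¹ * score W M X (Y ω) β ζ b) μ

/-- The closed form of the variance matrix of the normalized adjusted score, as a function of the
parameters and of a (diagonal) matrix `S` in the place of the variance matrix of the errors:
`1/n` times the symmetric matrix with the blocks
`X' e^{ρM'} S e^{ρM} X`, `- X' e^{ρM'} S 𝕎_D' e^{ρM} X β`, `0`,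
`β' X' e^{ρM'} 𝕎_D S 𝕎_D' e^{ρM} X β + tr(S 𝕎_D S (𝕎_D + 𝕎_D'))`, `tr(S 𝕎_D S (M + M'))`,
`tr(S M S (M + M'))`. -/
def omegaForm (W M : Matrix (Fin n) (Fin n) ℝ) (X : Matrix (Fin n) (Fin k) ℝ)
    (β : Fin k → ℝ) (ρ : ℝ) (S : Matrix (Fin n) (Fin n) ℝ) :
    Matrix (Fin k ⊕ Fin 2) (Fin k ⊕ Fin 2) ℝ :=
  let D := twistedD W M ρ
  let E := NormedSpace.exp (ρ • M)
  let E' := NormedSpace.exp (ρ • Mᵀ)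
  let o11 : Matrix (Fin k) (Fin k) ℝ := Xᵀ * E' * S * E * X
  let o12 : Fin k → ℝ := -((Xᵀ * E' * S * Dᵀ * E * X) *ᵥ β)
  let o22 : ℝ := β ⬝ᵥ ((Xᵀ * E' * D * S * Dᵀ * E * X) *ᵥ β) + Matrix.trace (S * D * S * (D + Dᵀ))
  let o23 : ℝ := Matrix.trace (S * D * S * (M + Mᵀ))
  let o33 : ℝ := Matrix.trace (S * M * S * (M + Mᵀ))
  let B : Matrix (Fin k) (Fin 2) ℝ := Matrix.of fun a => ![o12 a, 0]
  (n : ℝ)⁻¹ • Matrix.fromBlocks o11 B Bᵀ !![o22, o23; o23, o33]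

/-- The plug-in estimator of the variance matrix of the normalized adjusted score: the closed form
with `β` and `ζ` in the place of the true parameter values and the diagonal matrix of the squared
residuals `v_i(β, ζ)²` in the place of the variance matrix of the errors. -/
def omegaPlugIn (W M : Matrix (Fin n) (Fin n) ℝ) (X : Matrix (Fin n) (Fin k) ℝ) (y : Fin n → ℝ)
    (β : Fin k → ℝ) (ζ : ℝ × ℝ) : Matrix (Fin k ⊕ Fin 2) (Fin k ⊕ Fin 2) ℝ :=
  omegaForm W M X β ζ.2 (Matrix.diagonal fun i => resid W M X y β ζ i ^ 2)

/-! The assumptions, for sequences indexed by the sample size. -/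

/-- The parameter space `[-c, c] × [-c, c]` of `ζ`. -/
def paramSpace (c : ℝ) : Set (ℝ × ℝ) := Set.Icc (-c) c ×ˢ Set.Icc (-c) c

/-- The errors are independent (for each sample size), have mean zero, and have moments of some
order `4 + δ`, `δ > 0`, that are bounded uniformly in the unit and in the sample size. The
variances may differ from unit to unit. -/
def HeteroskedasticErrors {Ω : Type*} [MeasurableSpace Ω] (μ : Measure Ω)
    (V : (n : ℕ) → Ω → Fin n → ℝ) : Prop :=
  (∀ n i, Measurable fun ω => V n ω i) ∧
  (∀ n, iIndepFun (fun i ω => V n ω i) μ) ∧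
  (∀ n i, ∫ ω, V n ω i ∂μ = 0) ∧
  ∃ δ : ℝ, 0 < δ ∧ ∃ C : ℝ, ∀ n i,
    Integrable (fun ω => |V n ω i| ^ (4 + δ)) μ ∧ ∫ ω, |V n ω i| ^ (4 + δ) ∂μ ≤ C

/-- The matrices are uniformly bounded in the row sum and the column sum matrix norms. -/
def UniformlyBoundedSums (A : (n : ℕ) → Matrix (Fin n) (Fin n) ℝ) : Prop :=
  ∃ C : ℝ, ∀ n, (∀ i, ∑ j, |A n i j| ≤ C) ∧ ∀ j, ∑ i, |A n i j| ≤ C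

/-- The (nonrandom) regressors are uniformly bounded and, for large sample sizes, of full column
rank, and `n⁻¹ X' e^{ρM'} e^{ρM} X` converges, uniformly in `ρ ∈ [-c, c]`, to a nonsingular
matrix. (The limit is continuous in `ρ` as soon as the row and column sums of `M` are uniformly
bounded, so that it is then automatically nonsingular uniformly in `ρ`.) -/
def RegularRegressors (c : ℝ) (M : (n : ℕ) → Matrix (Fin n) (Fin n) ℝ)
    (X : (n : ℕ) → Matrix (Fin n) (Fin k) ℝ) : Prop :=
  (∃ C : ℝ, ∀ n i a, |X n i a| ≤ C) ∧
  (∀ᶠ n in atTop, (X n).rank = k) ∧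
  ∃ H : ℝ → Matrix (Fin k) (Fin k) ℝ,
    (∀ a b, TendstoUniformlyOn
      (fun (n : ℕ) ρ => ((n : ℝ)⁻¹ • ((X n)ᵀ * NormedSpace.exp (ρ • (M n)ᵀ) *
        NormedSpace.exp (ρ • M n) * X n)) a b)
      (fun ρ => H ρ a b) atTop (Set.Icc (-c) c)) ∧
    ∀ ρ ∈ Set.Icc (-c) c, IsUnit (H ρ).det

/-- Identification of `ζ₀`: for every `ϑ > 0`, the norm of the population concentrated score,
divided by the sample size, is bounded away from zero on the part of the parameter space at
distance at least `ϑ` from `ζ₀`, for all large sample sizes. (The norm and the distance of `ℝ × ℝ`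
are the maximum ones; all others are equivalent.) -/
def Identified {Ω : Type*} [MeasurableSpace Ω] (μ : Measure Ω) (c : ℝ)
    (W M : (n : ℕ) → Matrix (Fin n) (Fin n) ℝ) (X : (n : ℕ) → Matrix (Fin n) (Fin k) ℝ)
    (Y : (n : ℕ) → Ω → Fin n → ℝ) (ζ₀ : ℝ × ℝ) : Prop :=
  ∀ ϑ : ℝ, 0 < ϑ → ∃ η : ℝ, 0 < η ∧ ∀ᶠ n : ℕ in atTop, ∀ ζ ∈ paramSpace c,
    ϑ ≤ dist ζ ζ₀ → η ≤ (n : ℝ)⁻¹ * ‖popConcScore μ (W n) (M n) (X n) (Y n) ζ‖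

/-- `ζhat` is an M-estimator of the spatial parameters: with probability tending to one, it is a
root in the parameter space of the concentrated adjusted score. -/
def IsMEstimator {Ω : Type*} [MeasurableSpace Ω] (μ : Measure Ω) (c : ℝ)
    (W M : (n : ℕ) → Matrix (Fin n) (Fin n) ℝ) (X : (n : ℕ) → Matrix (Fin n) (Fin k) ℝ)
    (Y : (n : ℕ) → Ω → Fin n → ℝ) (ζhat : ℕ → Ω → ℝ × ℝ) : Prop :=
  Tendsto (fun n => μ {ω | ¬ (ζhat n ω ∈ paramSpace c ∧
    concScore (W n) (M n) (X n) (Y n ω) (ζhat n ω) = 0)}) atTop (𝓝 0)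

end MESS

end

noncomputable section

set_option linter.unusedSectionVars false

namespace MESS

/-! ### The maximum of the row sum and the column sum norm -/

/-! Solving the model for the observations gives e^{ρM} e^{λW} Y = m(ζ) + N(ζ) V with nonrandom
`meanVec` m and `noiseMat` N. At ζ₀ the matrix N is the identity and m lies in the span of the
columns of e^{ρ₀M} X. Scores, estimators and residuals thus reduce to linear and quadratic
expressions in independent centered errors, whose coefficients are bounded and Lipschitz in ζ
uniformly in n (`UnifLip`). Size is measured by `sumNorm`, which is submultiplicative, invariant
under transposition, monotone in the absolute values of the entries, and bounds the ℓ² and ℓ⁴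
operator norms by Schur's test.

Consistency of the estimators: normalized linear forms and zero-diagonal quadratic forms have
variance O(1/n). The diagonal part of a quadratic form is linear in the squared errors, and these,
once centered, are again independent with bounded variances. The Lipschitz property makes the
convergence uniform on the compact parameter space, so n⁻¹ times `concScore` minus `popConcScore`
vanishes uniformly in probability (`tendsto_concScore_sub`). Identification then drives the root to
ζ₀ (`tendsto_estimator`), and the regression coefficients follow (`convReal_betaHat`).

The variance matrix: at the true parameters a score component is c'V + V'AV with A of zero diagonal.
Third and fourth moments of the errors therefore drop out of the covariances, and each entry of Ω is
n⁻¹ Σ c_i d_i σ_i² + n⁻¹ Σ A_ij (B_ij + B_ji) σ_i² σ_j² (`omegaTrue_eq`). The plug-in entry is the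
same function `omegaEntry` at estimated coefficients and squared residuals (`omegaForm_diagonal`).
No single σ_i² need be estimated well; only these averages matter. The squared residuals are close
to v_i² in mean square over i (`tendsto_sum_resid_sq`), and v_i² v_j² has mean σ_i² σ_j² for i ≠ j,
so both averages converge (`tendsto_weighted_average`, `tendsto_quadratic_sq`).

Convergence in probability is expressed as convergence along the filter `probFilter` on ℕ × Ω, so
that the ordinary calculus of limits applies; its product with the principal filter of a set
expresses uniformity on that set. -/

lemma norm_exp_le_of_norm_one_le {A : Type*} [NormedRing A] [NormedAlgebra ℝ A] [CompleteSpace A]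
    (h1 : ‖(1 : A)‖ ≤ 1) (x : A) : ‖NormedSpace.exp x‖ ≤ Real.exp ‖x‖ := by
  have hpow : ∀ m : ℕ, ‖x ^ m‖ ≤ ‖x‖ ^ m := by
    intro m
    rcases Nat.eq_zero_or_pos m with rfl | hm
    · simpa using h1
    · exact norm_pow_le' x hm
  have hs := NormedSpace.norm_expSeries_summable' (𝕂 := ℝ) x
  have hr := NormedSpace.norm_expSeries_summable' (𝕂 := ℝ) ‖x‖
  rw [Real.exp_eq_exp_ℝ, NormedSpace.exp_eq_tsum ℝ, NormedSpace.exp_eq_tsum ℝ]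
  refine (norm_tsum_le_tsum_norm hs).trans (hs.tsum_le_tsum (fun m => ?_) hr.of_norm)
  rw [norm_smul, smul_eq_mul, Real.norm_of_nonneg (by positivity)]
  exact mul_le_mul_of_nonneg_left (hpow m) (by positivity)

/-- Mean value inequality on [-c, c]: the derivative of u ↦ e^{ux} is e^{ux} x. -/
lemma norm_exp_smul_sub_le {A : Type*} [NormedRing A] [NormedAlgebra ℝ A] [CompleteSpace A]
    (h1 : ‖(1 : A)‖ ≤ 1) (x : A) {c s t : ℝ} (hs : |s| ≤ c) (ht : |t| ≤ c) :
    ‖NormedSpace.exp (t • x) - NormedSpace.exp (s • x)‖ ≤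
      Real.exp (c * ‖x‖) * ‖x‖ * |t - s| := by
  refine Convex.norm_image_sub_le_of_norm_hasDerivWithin_le (s := Set.Icc (-c) c)
    (f := fun u : ℝ => NormedSpace.exp (u • x)) (f' := fun u => NormedSpace.exp (u • x) * x)
    (fun u _ => (hasDerivAt_exp_smul_const x u).hasDerivWithinAt) (fun u hu => ?_)
    (convex_Icc _ _) (abs_le.1 hs) (abs_le.1 ht)
  refine (norm_mul_le _ _).trans (mul_le_mul_of_nonneg_right ?_ (norm_nonneg _))
  refine (norm_exp_le_of_norm_one_le h1 _).trans (Real.exp_le_exp.2 ?_)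
  rw [norm_smul]
  exact mul_le_mul_of_nonneg_right (abs_le.2 hu) (norm_nonneg _)

section SumNorm

variable {n : ℕ}

/-- The maximum of the row sum norm and the column sum norm of a square matrix. -/
def sumNorm (n : ℕ) : AddGroupSeminorm (Matrix (Fin n) (Fin n) ℝ) :=
  letI := Matrix.linftyOpNormedAddCommGroup (m := Fin n) (n := Fin n) (α := ℝ)
  normAddGroupSeminorm _ ⊔ (normAddGroupSeminorm (Matrix (Fin n) (Fin n) ℝ)).comp
    (Matrix.transposeAddEquiv (Fin n) (Fin n) ℝ).toAddMonoidHom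

section

attribute [local instance] Matrix.linftyOpNormedAddCommGroup Matrix.linftyOpNormedRing
  Matrix.linftyOpNormedAlgebra

lemma sumNorm_apply (A : Matrix (Fin n) (Fin n) ℝ) : sumNorm n A = max ‖A‖ ‖Aᵀ‖ := rfl

lemma linfty_norm_le_iff {A : Matrix (Fin n) (Fin n) ℝ} {C : ℝ} (hC : 0 ≤ C) :
    ‖A‖ ≤ C ↔ ∀ i, ∑ j, |A i j| ≤ C := by
  lift C to NNReal using hC
  rw [Matrix.linfty_opNorm_def, NNReal.coe_le_coe, Finset.sup_le_iff]
  simp only [Finset.mem_univ, true_imp_iff, ← NNReal.coe_le_coe, NNReal.coe_sum, coe_nnnorm,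
    Real.norm_eq_abs]

/-- An inequality only: for n = 0 the identity matrix is zero and has norm 0. -/
lemma linfty_norm_one_le : ‖(1 : Matrix (Fin n) (Fin n) ℝ)‖ ≤ 1 := by
  rw [linfty_norm_le_iff zero_le_one]
  intro i
  simp [Matrix.one_apply, apply_ite abs]

lemma sumNorm_le_iff {A : Matrix (Fin n) (Fin n) ℝ} {C : ℝ} (hC : 0 ≤ C) :
    sumNorm n A ≤ C ↔ (∀ i, ∑ j, |A i j| ≤ C) ∧ ∀ j, ∑ i, |A i j| ≤ C := by
  rw [sumNorm_apply, max_le_iff, linfty_norm_le_iff hC, linfty_norm_le_iff hC]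
  rfl

lemma sumNorm_transpose (A : Matrix (Fin n) (Fin n) ℝ) : sumNorm n Aᵀ = sumNorm n A := by
  rw [sumNorm_apply, sumNorm_apply, Matrix.transpose_transpose, max_comm]

lemma sumNorm_mul_le (A B : Matrix (Fin n) (Fin n) ℝ) :
    sumNorm n (A * B) ≤ sumNorm n A * sumNorm n B := by
  rw [sumNorm_apply, sumNorm_apply, sumNorm_apply, Matrix.transpose_mul, max_le_iff]
  constructor
  · refine (norm_mul_le _ _).trans ?_
    gcongr
    · exact le_max_left _ _
    · exact le_max_left _ _
  · refine (norm_mul_le _ _).trans ?_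
    rw [mul_comm]
    gcongr
    · exact le_max_right _ _
    · exact le_max_right _ _

lemma norm_mulVec_le (A : Matrix (Fin n) (Fin n) ℝ) (v : Fin n → ℝ) :
    ‖A *ᵥ v‖ ≤ sumNorm n A * ‖v‖ := by
  refine (Matrix.linfty_opNorm_mulVec A v).trans ?_
  rw [sumNorm_apply]
  gcongr
  exact le_max_left _ _

lemma sumNorm_exp_smul_le (A : Matrix (Fin n) (Fin n) ℝ) {c t : ℝ} (ht : |t| ≤ c) :
    sumNorm n (NormedSpace.exp (t • A)) ≤ Real.exp (c * sumNorm n A) := by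
  have key : ∀ B : Matrix (Fin n) (Fin n) ℝ, ‖B‖ ≤ sumNorm n A →
      ‖NormedSpace.exp (t • B)‖ ≤ Real.exp (c * sumNorm n A) := by
    intro B hB
    refine (norm_exp_le_of_norm_one_le linfty_norm_one_le _).trans (Real.exp_le_exp.2 ?_)
    rw [norm_smul]
    exact mul_le_mul ht hB (norm_nonneg _) ((abs_nonneg t).trans ht)
  rw [sumNorm_apply (NormedSpace.exp _), max_le_iff]
  refine ⟨key A (le_max_left _ _), ?_⟩
  have h := key Aᵀ (le_max_right _ _)
  rwa [← Matrix.transpose_smul, Matrix.exp_transpose] at h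

lemma sumNorm_exp_smul_sub_le (A : Matrix (Fin n) (Fin n) ℝ) {c s t : ℝ} (hs : |s| ≤ c)
    (ht : |t| ≤ c) :
    sumNorm n (NormedSpace.exp (t • A) - NormedSpace.exp (s • A)) ≤
      Real.exp (c * sumNorm n A) * sumNorm n A * |t - s| := by
  have hc : 0 ≤ c := (abs_nonneg t).trans ht
  have key : ∀ B : Matrix (Fin n) (Fin n) ℝ, ‖B‖ ≤ sumNorm n A →
      ‖NormedSpace.exp (t • B) - NormedSpace.exp (s • B)‖ ≤
        Real.exp (c * sumNorm n A) * sumNorm n A * |t - s| := by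
    intro B hB
    refine (norm_exp_smul_sub_le linfty_norm_one_le B hs ht).trans ?_
    gcongr
  rw [sumNorm_apply (_ - _), max_le_iff]
  refine ⟨key A (le_max_left _ _), ?_⟩
  have h := key Aᵀ (le_max_right _ _)
  rwa [← Matrix.transpose_smul, ← Matrix.transpose_smul, Matrix.exp_transpose,
    Matrix.exp_transpose, ← Matrix.transpose_sub] at h

end

lemma row_sum_le (A : Matrix (Fin n) (Fin n) ℝ) (i : Fin n) : ∑ j, |A i j| ≤ sumNorm n A :=
  ((sumNorm_le_iff (apply_nonneg _ _)).1 le_rfl).1 i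

lemma col_sum_le (A : Matrix (Fin n) (Fin n) ℝ) (j : Fin n) : ∑ i, |A i j| ≤ sumNorm n A :=
  ((sumNorm_le_iff (apply_nonneg _ _)).1 le_rfl).2 j

lemma abs_entry_le (A : Matrix (Fin n) (Fin n) ℝ) (i j : Fin n) : |A i j| ≤ sumNorm n A :=
  (Finset.single_le_sum (f := fun j => |A i j|) (fun _ _ => abs_nonneg _)
    (Finset.mem_univ j)).trans (row_sum_le A i)

lemma sumNorm_hadamard_le (A B : Matrix (Fin n) (Fin n) ℝ) :
    sumNorm n (A ⊙ B) ≤ sumNorm n A * sumNorm n B := by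
  rw [sumNorm_le_iff (mul_nonneg (apply_nonneg _ _) (apply_nonneg _ _))]
  constructor
  · intro i
    calc ∑ j, |(A ⊙ B) i j| ≤ ∑ j, |A i j| * sumNorm n B := by
          refine Finset.sum_le_sum fun j _ => ?_
          rw [Matrix.hadamard_apply, abs_mul]
          exact mul_le_mul_of_nonneg_left (abs_entry_le B i j) (abs_nonneg _)
      _ ≤ _ := by
          rw [← Finset.sum_mul]
          exact mul_le_mul_of_nonneg_right (row_sum_le A i) (apply_nonneg _ _)
  · intro j
    calc ∑ i, |(A ⊙ B) i j| ≤ ∑ i, |A i j| * sumNorm n B := by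
          refine Finset.sum_le_sum fun i _ => ?_
          rw [Matrix.hadamard_apply, abs_mul]
          exact mul_le_mul_of_nonneg_left (abs_entry_le B i j) (abs_nonneg _)
      _ ≤ _ := by
          rw [← Finset.sum_mul]
          exact mul_le_mul_of_nonneg_right (col_sum_le A j) (apply_nonneg _ _)

lemma sumNorm_le_of_abs_le {A B : Matrix (Fin n) (Fin n) ℝ} (h : ∀ i j, |A i j| ≤ |B i j|) :
    sumNorm n A ≤ sumNorm n B := by
  rw [sumNorm_le_iff (apply_nonneg _ _)]
  exact ⟨fun i => (Finset.sum_le_sum fun j _ => h i j).trans (row_sum_le B i),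
    fun j => (Finset.sum_le_sum fun i _ => h i j).trans (col_sum_le B j)⟩

/-- Deleting entries cannot increase absolute row and column sums; this bounds `twistedD` by
`twisted`. -/
lemma sumNorm_sub_diagonal_le (A : Matrix (Fin n) (Fin n) ℝ) :
    sumNorm n (A - Matrix.diagonal (Matrix.diag A)) ≤ sumNorm n A := by
  refine sumNorm_le_of_abs_le fun i j => ?_
  by_cases h : i = j
  · subst h; simp
  · simp [Matrix.diagonal_apply_ne _ h]

/-! ### Quadratic forms and averages -/

lemma abs_dotProduct_le (u v : Fin n → ℝ) : |u ⬝ᵥ v| ≤ ‖u‖ * ∑ i, |v i| := by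
  rw [dotProduct, Finset.mul_sum]
  refine (Finset.abs_sum_le_sum_abs _ _).trans (Finset.sum_le_sum fun i _ => ?_)
  rw [abs_mul]
  exact mul_le_mul_of_nonneg_right (norm_le_pi_norm u i) (abs_nonneg _)

lemma sum_abs_le_card_mul_norm (v : Fin n → ℝ) : ∑ i, |v i| ≤ n * ‖v‖ := by
  calc ∑ i, |v i| ≤ ∑ _i : Fin n, ‖v‖ := Finset.sum_le_sum fun i _ => norm_le_pi_norm v i
    _ = n * ‖v‖ := by simp

/-- The left side is 0 for n = 0, where the inverse has its default value; the inequality spares a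
case distinction in all averages. -/
lemma inv_mul_card_le_one (n : ℕ) : (n : ℝ)⁻¹ * n ≤ 1 := inv_mul_le_one

lemma abs_inv_mul_dotProduct_le (u v : Fin n → ℝ) : |(n : ℝ)⁻¹ * (u ⬝ᵥ v)| ≤ ‖u‖ * ‖v‖ := by
  rw [abs_mul, abs_of_nonneg (inv_nonneg.2 (Nat.cast_nonneg n))]
  calc (n : ℝ)⁻¹ * |u ⬝ᵥ v| ≤ (n : ℝ)⁻¹ * (‖u‖ * (n * ‖v‖)) := by
        gcongr
        exact (abs_dotProduct_le u v).trans (by gcongr; exact sum_abs_le_card_mul_norm v)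
    _ = ((n : ℝ)⁻¹ * n) * (‖u‖ * ‖v‖) := by ring
    _ ≤ 1 * (‖u‖ * ‖v‖) := by gcongr; exact inv_mul_card_le_one n
    _ = _ := one_mul _

/-- Cauchy–Schwarz with the weights |A i j|, whose sum over j is a row sum. -/
lemma mulVec_sq_le (A : Matrix (Fin n) (Fin n) ℝ) (v : Fin n → ℝ) (i : Fin n) :
    (A *ᵥ v) i ^ 2 ≤ sumNorm n A * ∑ j, |A i j| * v j ^ 2 := by
  have h1 : (A *ᵥ v) i ^ 2 ≤ (∑ j, |A i j|) * ∑ j, |A i j| * v j ^ 2 := by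
    change (∑ j, A i j * v j) ^ 2 ≤ _
    refine Finset.sum_sq_le_sum_mul_sum_of_sq_le_mul _ (f := fun j => |A i j|)
      (g := fun j => |A i j| * v j ^ 2) (fun _ _ => abs_nonneg _)
      (fun _ _ => by positivity) fun j _ => le_of_eq ?_
    rw [mul_pow, ← sq_abs (A i j)]; ring
  refine h1.trans (mul_le_mul_of_nonneg_right (row_sum_le A i) ?_)
  exact Finset.sum_nonneg fun _ _ => by positivity

lemma sum_abs_mul_le (A : Matrix (Fin n) (Fin n) ℝ) {w : Fin n → ℝ} (hw : ∀ i, 0 ≤ w i) :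
    ∑ i, ∑ j, |A i j| * w j ≤ sumNorm n A * ∑ j, w j := by
  rw [Finset.sum_comm, Finset.mul_sum]
  refine Finset.sum_le_sum fun j _ => ?_
  rw [← Finset.sum_mul]
  exact mul_le_mul_of_nonneg_right (col_sum_le A j) (hw j)

/-- Schur's test: one factor of the norm comes from the row sums, the other from the column sums. -/
lemma sum_mulVec_sq_le (A : Matrix (Fin n) (Fin n) ℝ) (v : Fin n → ℝ) :
    ∑ i, (A *ᵥ v) i ^ 2 ≤ sumNorm n A ^ 2 * ∑ i, v i ^ 2 := by
  calc ∑ i, (A *ᵥ v) i ^ 2 ≤ ∑ i, sumNorm n A * ∑ j, |A i j| * v j ^ 2 :=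
        Finset.sum_le_sum fun i _ => mulVec_sq_le A v i
    _ ≤ sumNorm n A * (sumNorm n A * ∑ j, v j ^ 2) := by
        rw [← Finset.mul_sum]
        exact mul_le_mul_of_nonneg_left (sum_abs_mul_le A fun _ => sq_nonneg _)
          (apply_nonneg _ _)
    _ = _ := by ring

/-- Schur's test in ℓ⁴: weighted Cauchy–Schwarz twice yields three factors from the row sums, and
summation over i yields the fourth from the column sums. -/
lemma sum_mulVec_pow_four_le (A : Matrix (Fin n) (Fin n) ℝ) (v : Fin n → ℝ) :
    ∑ i, (A *ᵥ v) i ^ 4 ≤ sumNorm n A ^ 4 * ∑ i, v i ^ 4 := by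
  have h0 : 0 ≤ sumNorm n A := apply_nonneg _ _
  have h1 : ∀ i, (A *ᵥ v) i ^ 4 ≤ sumNorm n A ^ 3 * ∑ j, |A i j| * v j ^ 4 := by
    intro i
    have h2 : (∑ j, |A i j| * v j ^ 2) ^ 2 ≤ sumNorm n A * ∑ j, |A i j| * v j ^ 4 := by
      have h3 : (∑ j, |A i j| * v j ^ 2) ^ 2 ≤ (∑ j, |A i j|) * ∑ j, |A i j| * v j ^ 4 :=
        Finset.sum_sq_le_sum_mul_sum_of_sq_le_mul _ (fun _ _ => abs_nonneg _)
          (fun _ _ => by positivity) fun j _ => le_of_eq (by ring)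
      refine h3.trans (mul_le_mul_of_nonneg_right (row_sum_le A i) ?_)
      exact Finset.sum_nonneg fun _ _ => by positivity
    calc (A *ᵥ v) i ^ 4 = ((A *ᵥ v) i ^ 2) ^ 2 := by ring
      _ ≤ (sumNorm n A * ∑ j, |A i j| * v j ^ 2) ^ 2 := by
          gcongr; exact mulVec_sq_le A v i
      _ = sumNorm n A ^ 2 * (∑ j, |A i j| * v j ^ 2) ^ 2 := by ring
      _ ≤ sumNorm n A ^ 2 * (sumNorm n A * ∑ j, |A i j| * v j ^ 4) := by gcongr
      _ = _ := by ring
  calc ∑ i, (A *ᵥ v) i ^ 4 ≤ ∑ i, sumNorm n A ^ 3 * ∑ j, |A i j| * v j ^ 4 :=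
        Finset.sum_le_sum fun i _ => h1 i
    _ ≤ sumNorm n A ^ 3 * (sumNorm n A * ∑ j, v j ^ 4) := by
        rw [← Finset.mul_sum]
        exact mul_le_mul_of_nonneg_left (sum_abs_mul_le A fun _ => by positivity)
          (by positivity)
    _ = _ := by ring

lemma dotProduct_mulVec_sq_le (A : Matrix (Fin n) (Fin n) ℝ) (u v : Fin n → ℝ) :
    (u ⬝ᵥ A *ᵥ v) ^ 2 ≤ sumNorm n A ^ 2 * ((∑ i, u i ^ 2) * ∑ i, v i ^ 2) := by
  calc (u ⬝ᵥ A *ᵥ v) ^ 2 ≤ (∑ i, u i ^ 2) * ∑ i, (A *ᵥ v) i ^ 2 :=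
        Finset.sum_mul_sq_le_sq_mul_sq _ _ _
    _ ≤ (∑ i, u i ^ 2) * (sumNorm n A ^ 2 * ∑ i, v i ^ 2) :=
        mul_le_mul_of_nonneg_left (sum_mulVec_sq_le A v)
          (Finset.sum_nonneg fun _ _ => sq_nonneg _)
    _ = _ := by ring

lemma abs_dotProduct_mulVec_self_le (A : Matrix (Fin n) (Fin n) ℝ) (v : Fin n → ℝ) :
    |v ⬝ᵥ A *ᵥ v| ≤ sumNorm n A * ∑ i, v i ^ 2 := by
  refine abs_le_of_sq_le_sq ?_ ?_
  · rw [mul_pow, sq (∑ i, v i ^ 2)]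
    exact dotProduct_mulVec_sq_le A v v
  · exact mul_nonneg (apply_nonneg _ _) (Finset.sum_nonneg fun _ _ => sq_nonneg _)

end SumNorm

/-! ### Families that are bounded and Lipschitz, uniformly in the sample size -/

section UnifLip

variable {α : Type*} [PseudoMetricSpace α] {s : Set α}

/-- For all large `n`, the family `f n` is bounded and Lipschitz on `s`, with constants that do not
depend on `n`. -/
def UnifLip {E : ℕ → Type*} [∀ n, AddCommGroup (E n)] (N : ∀ n, AddGroupSeminorm (E n))
    (s : Set α) (f : ∀ n, α → E n) : Prop :=
  ∃ C : ℝ, 0 ≤ C ∧ ∀ᶠ n in atTop, (∀ x ∈ s, N n (f n x) ≤ C) ∧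
    ∀ x ∈ s, ∀ y ∈ s, N n (f n x - f n y) ≤ C * dist x y

variable {E F G : ℕ → Type*} [∀ n, AddCommGroup (E n)] [∀ n, AddCommGroup (F n)]
  [∀ n, AddCommGroup (G n)] {N : ∀ n, AddGroupSeminorm (E n)} {N' : ∀ n, AddGroupSeminorm (F n)}
  {N'' : ∀ n, AddGroupSeminorm (G n)}

lemma UnifLip.congr {f g : ∀ n, α → E n} (hf : UnifLip N s f)
    (h : ∀ᶠ n in atTop, ∀ x ∈ s, f n x = g n x) : UnifLip N s g := by
  obtain ⟨C, hC, hf⟩ := hf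
  refine ⟨C, hC, ?_⟩
  filter_upwards [hf, h] with n hf h
  refine ⟨fun x hx => h x hx ▸ hf.1 x hx, fun x hx y hy => ?_⟩
  rw [← h x hx, ← h y hy]
  exact hf.2 x hx y hy

lemma UnifLip.const {f : ∀ n, E n} {C : ℝ} (h : ∀ᶠ n in atTop, N n (f n) ≤ C) :
    UnifLip N s (fun n _ => f n) := by
  refine ⟨max C 0, le_max_right _ _, ?_⟩
  filter_upwards [h] with n h
  refine ⟨fun x _ => h.trans (le_max_left _ _), fun x _ y _ => ?_⟩
  rw [sub_self, map_zero]
  positivity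

lemma UnifLip.linear {f : ∀ n, α → E n} (hf : UnifLip N s f) (L : ∀ n, E n → F n)
    (hsub : ∀ n x y, L n x - L n y = L n (x - y)) (hL : ∀ n x, N' n (L n x) ≤ N n x) :
    UnifLip N' s (fun n x => L n (f n x)) := by
  obtain ⟨C, hC, hf⟩ := hf
  refine ⟨C, hC, ?_⟩
  filter_upwards [hf] with n hf
  refine ⟨fun x hx => (hL n _).trans (hf.1 x hx), fun x hx y hy => ?_⟩
  rw [hsub]
  exact (hL n _).trans (hf.2 x hx y hy)

lemma UnifLip.add {f g : ∀ n, α → E n} (hf : UnifLip N s f) (hg : UnifLip N s g) :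
    UnifLip N s (fun n x => f n x + g n x) := by
  obtain ⟨C, hC, hf⟩ := hf
  obtain ⟨D, hD, hg⟩ := hg
  refine ⟨C + D, add_nonneg hC hD, ?_⟩
  filter_upwards [hf, hg] with n hf hg
  refine ⟨fun x hx => (map_add_le_add _ _ _).trans (add_le_add (hf.1 x hx) (hg.1 x hx)),
    fun x hx y hy => ?_⟩
  rw [add_sub_add_comm, add_mul]
  exact (map_add_le_add _ _ _).trans (add_le_add (hf.2 x hx y hy) (hg.2 x hx y hy))

lemma UnifLip.neg {f : ∀ n, α → E n} (hf : UnifLip N s f) :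
    UnifLip N s (fun n x => -f n x) :=
  hf.linear (fun _ x => -x) (fun _ _ _ => by abel) fun n x => (map_neg_eq_map (N n) x).le

lemma UnifLip.sub {f g : ∀ n, α → E n} (hf : UnifLip N s f) (hg : UnifLip N s g) :
    UnifLip N s (fun n x => f n x - g n x) := by
  simpa only [sub_eq_add_neg] using hf.add hg.neg

lemma UnifLip.sum {ι : Type*} (t : Finset ι) {f : ι → ∀ n, α → E n}
    (hf : ∀ i ∈ t, UnifLip N s (f i)) : UnifLip N s (fun n x => ∑ i ∈ t, f i n x) := by
  classical
  induction t using Finset.induction_on with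
  | empty =>
    simpa using UnifLip.const (N := N) (s := s) (f := fun n => (0 : E n)) (C := 0)
      (Eventually.of_forall fun n => (map_zero (N n)).le)
  | insert a t ha ih =>
    simp only [Finset.sum_insert ha]
    exact (hf a (Finset.mem_insert_self a t)).add
      (ih fun i hi => hf i (Finset.mem_insert_of_mem hi))

/-- The product rule, stated once for all products in use: matrix products, matrix times vector,
scalar multiples, and normalized dot products. -/
lemma UnifLip.bilin {f : ∀ n, α → E n} {g : ∀ n, α → F n} (hf : UnifLip N s f)
    (hg : UnifLip N' s g) (b : ∀ n, E n → F n → G n)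
    (hsub : ∀ n x y x' y', b n x y - b n x' y' = b n (x - x') y + b n x' (y - y'))
    (hb : ∀ n x y, N'' n (b n x y) ≤ N n x * N' n y) :
    UnifLip N'' s (fun n x => b n (f n x) (g n x)) := by
  obtain ⟨C, hC, hf⟩ := hf
  obtain ⟨D, hD, hg⟩ := hg
  -- The bound needs C * D and the Lipschitz estimate 2 * C * D; the sum serves for both.
  refine ⟨2 * C * D + C * D, by positivity, ?_⟩
  filter_upwards [hf, hg] with n hf hg
  refine ⟨fun x hx => ?_, fun x hx y hy => ?_⟩
  · calc N'' n (b n (f n x) (g n x)) ≤ N n (f n x) * N' n (g n x) := hb n _ _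
      _ ≤ C * D := mul_le_mul (hf.1 x hx) (hg.1 x hx) (apply_nonneg _ _) hC
      _ ≤ _ := by nlinarith [mul_nonneg hC hD]
  · have hd : 0 ≤ dist x y := dist_nonneg
    rw [hsub]
    calc _ ≤ N n (f n x - f n y) * N' n (g n x) + N n (f n y) * N' n (g n x - g n y) :=
          (map_add_le_add _ _ _).trans (add_le_add (hb n _ _) (hb n _ _))
      _ ≤ C * dist x y * D + C * (D * dist x y) :=
          add_le_add (mul_le_mul (hf.2 x hx y hy) (hg.1 x hx) (apply_nonneg _ _) (by positivity))
            (mul_le_mul (hf.1 y hy) (hg.2 x hx y hy) (apply_nonneg _ _) hC)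
      _ ≤ _ := by nlinarith [mul_nonneg (mul_nonneg hC hD) hd]

/-- Uniformly bounded and Lipschitz families of matrices. -/
abbrev LipMat (s : Set α) (A : ∀ n, α → Matrix (Fin n) (Fin n) ℝ) : Prop :=
  UnifLip sumNorm s A

/-- Uniformly bounded and Lipschitz families of vectors. -/
abbrev LipVec (s : Set α) (v : ∀ n, α → Fin n → ℝ) : Prop :=
  UnifLip (fun n => normAddGroupSeminorm (Fin n → ℝ)) s v

/-- Uniformly bounded and Lipschitz families of real numbers. -/
abbrev LipReal (s : Set α) (r : ℕ → α → ℝ) : Prop :=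
  UnifLip (fun _ => normAddGroupSeminorm ℝ) s r

lemma LipMat.mul {A B : ∀ n, α → Matrix (Fin n) (Fin n) ℝ} (hA : LipMat s A)
    (hB : LipMat s B) : LipMat s (fun n x => A n x * B n x) :=
  UnifLip.bilin hA hB (fun _ x y => x * y) (fun _ x y x' y' => by noncomm_ring)
    fun _ x y => sumNorm_mul_le x y

lemma LipMat.transpose {A : ∀ n, α → Matrix (Fin n) (Fin n) ℝ} (hA : LipMat s A) :
    LipMat s (fun n x => (A n x)ᵀ) :=
  UnifLip.linear hA (fun _ x => xᵀ) (fun _ x y => (Matrix.transpose_sub x y).symm)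
    fun _ x => (sumNorm_transpose x).le

lemma LipMat.sub_diagonal {A : ∀ n, α → Matrix (Fin n) (Fin n) ℝ} (hA : LipMat s A) :
    LipMat s (fun n x => A n x - Matrix.diagonal (Matrix.diag (A n x))) :=
  UnifLip.linear hA (fun _ x => x - Matrix.diagonal (Matrix.diag x))
    (fun _ x y => by
      ext i j
      by_cases h : i = j
      · subst h; simp
      · simp [Matrix.diagonal_apply_ne _ h])
    fun _ x => sumNorm_sub_diagonal_le x

lemma LipMat.mulVec {A : ∀ n, α → Matrix (Fin n) (Fin n) ℝ} {v : ∀ n, α → Fin n → ℝ}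
    (hA : LipMat s A) (hv : LipVec s v) : LipVec s (fun n x => A n x *ᵥ v n x) :=
  UnifLip.bilin hA hv (fun _ x y => x *ᵥ y)
    (fun _ x y x' y' => by rw [Matrix.sub_mulVec, Matrix.mulVec_sub]; abel)
    fun _ x y => norm_mulVec_le x y

lemma LipVec.smul {r : ℕ → α → ℝ} {v : ∀ n, α → Fin n → ℝ} (hr : LipReal s r)
    (hv : LipVec s v) : LipVec s (fun n x => r n x • v n x) :=
  UnifLip.bilin hr hv (fun _ x y => x • y)
    (fun _ x y x' y' => by rw [sub_smul, smul_sub]; abel)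
    fun _ x y => (norm_smul x y).le

lemma LipReal.mul {r t : ℕ → α → ℝ} (hr : LipReal s r) (ht : LipReal s t) :
    LipReal s (fun n x => r n x * t n x) :=
  UnifLip.bilin hr ht (fun _ x y => x * y) (fun _ x y x' y' => by ring)
    fun _ x y => (norm_mul x y).le

lemma LipVec.inv_mul_dotProduct {u v : ∀ n, α → Fin n → ℝ} (hu : LipVec s u)
    (hv : LipVec s v) : LipReal s (fun n x => (n : ℝ)⁻¹ * (u n x ⬝ᵥ v n x)) :=
  UnifLip.bilin hu hv (fun n x y => (n : ℝ)⁻¹ * (x ⬝ᵥ y))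
    (fun _ x y x' y' => by rw [sub_dotProduct, dotProduct_sub]; ring)
    fun _ x y => abs_inv_mul_dotProduct_le x y

lemma LipReal.const (r : ℝ) : LipReal s (fun _ _ => r) :=
  UnifLip.const (C := |r|) (Eventually.of_forall fun _ => le_rfl)

lemma LipReal.prod {ι : Type*} (t : Finset ι) {f : ι → ℕ → α → ℝ}
    (hf : ∀ i ∈ t, LipReal s (f i)) : LipReal s (fun n x => ∏ i ∈ t, f i n x) := by
  classical
  induction t using Finset.induction_on with
  | empty => simpa using LipReal.const (s := s) 1
  | insert a t ha ih =>
    simp only [Finset.prod_insert ha]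
    exact (hf a (Finset.mem_insert_self a t)).mul
      (ih fun i hi => hf i (Finset.mem_insert_of_mem hi))

lemma LipReal.inv {r : ℕ → α → ℝ} (hr : LipReal s r) {η : ℝ} (hη : 0 < η)
    (h : ∀ᶠ n in atTop, ∀ x ∈ s, η ≤ |r n x|) : LipReal s (fun n x => (r n x)⁻¹) := by
  obtain ⟨C, hC, hr⟩ := hr
  refine ⟨η⁻¹ + C * (η⁻¹ * η⁻¹), by positivity, ?_⟩
  filter_upwards [hr, h] with n hr h
  have hinv : ∀ x ∈ s, |r n x|⁻¹ ≤ η⁻¹ := fun x hx => inv_anti₀ hη (h x hx)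
  refine ⟨fun x hx => ?_, fun x hx y hy => ?_⟩
  · change |(r n x)⁻¹| ≤ _
    rw [abs_inv]
    exact (hinv x hx).trans (le_add_of_nonneg_right (by positivity))
  · change |(r n x)⁻¹ - (r n y)⁻¹| ≤ _
    have hx0 : r n x ≠ 0 := abs_pos.1 (hη.trans_le (h x hx))
    have hy0 : r n y ≠ 0 := abs_pos.1 (hη.trans_le (h y hy))
    have hd : |r n x - r n y| ≤ C * dist x y := hr.2 x hx y hy
    have hd0 : 0 ≤ dist x y := dist_nonneg
    rw [inv_sub_inv hx0 hy0, abs_div, abs_mul, abs_sub_comm, div_eq_mul_inv, mul_inv]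
    calc _ ≤ C * dist x y * (η⁻¹ * η⁻¹) := by
          gcongr
          · exact h x hx
          · exact h y hy
      _ ≤ _ := by nlinarith [mul_nonneg (inv_nonneg.2 hη.le) hd0]

variable {k : ℕ}

lemma LipReal.det {H : ℕ → α → Matrix (Fin k) (Fin k) ℝ}
    (hH : ∀ a b, LipReal s (fun n x => H n x a b)) : LipReal s (fun n x => (H n x).det) := by
  simp only [Matrix.det_apply']
  exact UnifLip.sum _ fun σ _ => (LipReal.const _).mul (LipReal.prod _ fun i _ => hH _ _)

/-- Cramer's rule: an entry of the inverse is a determinant with one row replaced by a unit vector,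
divided by a determinant that stays away from zero. The dimension k is fixed, so determinants are
polynomials with a fixed number of terms. -/
lemma LipReal.inv_apply {H : ℕ → α → Matrix (Fin k) (Fin k) ℝ}
    (hH : ∀ a b, LipReal s (fun n x => H n x a b)) {η : ℝ} (hη : 0 < η)
    (h : ∀ᶠ n in atTop, ∀ x ∈ s, η ≤ |(H n x).det|) (a b : Fin k) :
    LipReal s (fun n x => (H n x)⁻¹ a b) := by
  simp only [Matrix.inv_def, Ring.inverse_eq_inv', Matrix.smul_apply, smul_eq_mul,
    Matrix.adjugate_apply]
  refine ((LipReal.det hH).inv hη h).mul (LipReal.det fun i j => ?_)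
  by_cases hi : i = b
  · subst hi
    simp only [Matrix.updateRow_self]
    exact LipReal.const _
  · simp only [Matrix.updateRow_ne hi]
    exact hH i j

end UnifLip

/-! ### Matrices with bounded row and column sums, and their exponentials, as Lipschitz families. -/

lemma UniformlyBoundedSums.exists_sumNorm_le {A : (n : ℕ) → Matrix (Fin n) (Fin n) ℝ}
    (hA : UniformlyBoundedSums A) : ∃ C : ℝ, 0 ≤ C ∧ ∀ n, sumNorm n (A n) ≤ C := by
  obtain ⟨C, hC⟩ := hA
  refine ⟨max C 0, le_max_right _ _, fun n => ?_⟩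
  rw [sumNorm_le_iff (le_max_right _ _)]
  exact ⟨fun i => ((hC n).1 i).trans (le_max_left _ _),
    fun j => ((hC n).2 j).trans (le_max_left _ _)⟩

lemma UniformlyBoundedSums.lipMat {α : Type*} [PseudoMetricSpace α] {s : Set α}
    {A : (n : ℕ) → Matrix (Fin n) (Fin n) ℝ} (hA : UniformlyBoundedSums A) :
    LipMat s (fun n _ => A n) := by
  obtain ⟨C, -, hC⟩ := hA.exists_sumNorm_le
  exact UnifLip.const (Eventually.of_forall hC)

lemma UniformlyBoundedSums.lipMat_exp {α : Type*} [PseudoMetricSpace α] {s : Set α}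
    {A : (n : ℕ) → Matrix (Fin n) (Fin n) ℝ} (hA : UniformlyBoundedSums A) {t : α → ℝ} {c : ℝ}
    (ht : ∀ x ∈ s, |t x| ≤ c) (hlip : ∀ x y, |t x - t y| ≤ dist x y) :
    LipMat s (fun n x => NormedSpace.exp (t x • A n)) := by
  obtain ⟨C, hC0, hC⟩ := hA.exists_sumNorm_le
  -- The absolute value of `c` keeps the constants monotone without a sign condition on `c`.
  refine ⟨Real.exp (|c| * C) + Real.exp (|c| * C) * C, by positivity,
    Eventually.of_forall fun n => ⟨fun x hx => ?_, fun x hx y hy => ?_⟩⟩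
  · refine (sumNorm_exp_smul_le (A n) ((ht x hx).trans (le_abs_self c))).trans ?_
    refine le_trans ?_ (le_add_of_nonneg_right (by positivity))
    have := hC n
    gcongr
  · refine (sumNorm_exp_smul_sub_le (A n) ((ht y hy).trans (le_abs_self c))
      ((ht x hx).trans (le_abs_self c))).trans ?_
    refine le_trans (b := Real.exp (|c| * C) * C * dist x y) ?_ ?_
    · have := hC n
      have := hlip x y
      gcongr
    · exact mul_le_mul_of_nonneg_right (le_add_of_nonneg_left (by positivity)) dist_nonneg

/-! ### Convergence in probability as convergence along a filter -/

section ProbFilter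

variable {Ω : Type*} [MeasurableSpace Ω] (μ : Measure Ω)

/-- The filter of the sets that are reached with probability tending to one. Convergence in
probability is convergence along this filter. -/
def probFilter : Filter (ℕ × Ω) where
  -- The measure is used as an outer measure: monotonicity and subadditivity suffice, so events that
  -- involve the estimator need not be measurable.
  sets := {S | Tendsto (fun n => μ {ω | (n, ω) ∉ S}) atTop (𝓝 0)}
  univ_sets := by simp
  sets_of_superset := fun {S T} hS hST =>
    tendsto_of_tendsto_of_tendsto_of_le_of_le tendsto_const_nhds hS (fun _ => zero_le)
      fun n => measure_mono fun ω h hS' => h (hST hS')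
  inter_sets := fun {S T} hS hT => by
    have h : Tendsto (fun n => μ {ω | (n, ω) ∉ S} + μ {ω | (n, ω) ∉ T}) atTop (𝓝 (0 + 0)) :=
      Tendsto.add hS hT
    rw [add_zero] at h
    refine tendsto_of_tendsto_of_tendsto_of_le_of_le tendsto_const_nhds h (fun _ => zero_le)
      fun n => (measure_mono fun ω h => ?_).trans (measure_union_le _ _)
    by_contra hc
    simp only [Set.mem_union, Set.mem_ofPred_eq, not_or, not_not] at hc
    exact h hc

variable {μ}

lemma eventually_probFilter {P : ℕ × Ω → Prop} :
    (∀ᶠ p in probFilter μ, P p) ↔ Tendsto (fun n => μ {ω | ¬ P (n, ω)}) atTop (𝓝 0) :=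
  Iff.rfl

/-- Transfers nonrandom statements valid for all large n to the filter on ℕ × Ω. -/
lemma tendsto_fst_probFilter : Tendsto Prod.fst (probFilter μ) atTop := by
  intro S hS
  change ∀ᶠ p in probFilter μ, p.1 ∈ S
  rw [eventually_probFilter]
  refine tendsto_const_nhds.congr' ?_
  filter_upwards [hS] with n hn
  simp [hn]

lemma tendstoInMeasure_of_tendsto_probFilter {f : ℕ → Ω → ℝ}
    (h : Tendsto (fun p : ℕ × Ω => f p.1 p.2) (probFilter μ) (𝓝 0)) :
    TendstoInMeasure μ f atTop (fun _ => 0) := by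
  rw [tendstoInMeasure_iff_norm]
  intro ε hε
  have h1 := (Metric.tendsto_nhds.1 h) ε hε
  rw [eventually_probFilter] at h1
  simpa [Real.dist_eq, not_lt] using h1

lemma tendsto_zero_of_sq {ι : Type*} {l : Filter ι} {f : ι → ℝ}
    (h : Tendsto (fun p => f p ^ 2) l (𝓝 0)) : Tendsto f l (𝓝 0) := by
  have h1 := h.sqrt
  simp only [Real.sqrt_sq_eq_abs, Real.sqrt_zero] at h1
  exact (tendsto_zero_iff_abs_tendsto_zero f).2 h1

variable [IsProbabilityMeasure μ]

lemma measure_ge_le_of_integral_le {T : Ω → ℝ} (h0 : ∀ ω, 0 ≤ T ω) (hT : Integrable T μ)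
    {C K : ℝ} (hC : ∫ ω, T ω ∂μ ≤ C) (hK : 0 < K) :
    μ {ω | K ≤ T ω} ≤ ENNReal.ofReal (C / K) := by
  rw [← ofReal_measureReal]
  refine ENNReal.ofReal_le_ofReal ((le_div_iff₀ hK).2 ?_)
  rw [mul_comm]
  exact (mul_meas_ge_le_integral_of_nonneg (Eventually.of_forall h0) hT K).trans hC

/-- A product of a sequence that tends to zero in probability and a nonnegative sequence whose
expectations are bounded tends to zero in probability. -/
lemma tendsto_mul_of_integral_le {Z T : ℕ × Ω → ℝ} (hZ : Tendsto Z (probFilter μ) (𝓝 0))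
    (h0 : ∀ p, 0 ≤ T p) {C : ℝ}
    (hT : ∀ n, Integrable (fun ω => T (n, ω)) μ ∧ ∫ ω, T (n, ω) ∂μ ≤ C) :
    Tendsto (fun p => Z p * T p) (probFilter μ) (𝓝 0) := by
  rw [Metric.tendsto_nhds]
  intro ε hε
  rw [eventually_probFilter, ENNReal.tendsto_nhds_zero]
  intro δ hδ
  -- By Markov's inequality `T` exceeds this level with probability at most δ / 2; below it, |Z| < ε
  -- / K is enough.
  obtain ⟨K, hK, hKδ⟩ : ∃ K : ℝ, 0 < K ∧ ENNReal.ofReal (C / K) ≤ δ / 2 := by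
    have h1 : Tendsto (fun K : ℝ => ENNReal.ofReal (C / K)) atTop (𝓝 (ENNReal.ofReal 0)) :=
      ENNReal.tendsto_ofReal (tendsto_id.const_div_atTop C)
    rw [ENNReal.ofReal_zero, ENNReal.tendsto_nhds_zero] at h1
    obtain ⟨K, h2, h3⟩ := ((h1 (δ / 2) (ENNReal.half_pos hδ.ne')).and
      (eventually_gt_atTop 0)).exists
    exact ⟨K, h3, h2⟩
  have h1 := (Metric.tendsto_nhds.1 hZ) (ε / K) (by positivity)
  rw [eventually_probFilter, ENNReal.tendsto_nhds_zero] at h1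
  filter_upwards [h1 (δ / 2) (ENNReal.half_pos hδ.ne')] with n hn
  calc μ {ω | ¬ dist (Z (n, ω) * T (n, ω)) 0 < ε}
      ≤ μ ({ω | ¬ dist (Z (n, ω)) 0 < ε / K} ∪ {ω | K ≤ T (n, ω)}) := by
        refine measure_mono fun ω hω => ?_
        by_contra hc
        simp only [Set.mem_union, Set.mem_ofPred_eq, not_or, not_not, not_le,
          dist_zero_right, Real.norm_eq_abs] at hc hω
        refine hω ?_
        rw [abs_mul, abs_of_nonneg (h0 _)]
        calc |Z (n, ω)| * T (n, ω) ≤ |Z (n, ω)| * K := by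
              gcongr; exact hc.2.le
          _ < ε / K * K := mul_lt_mul_of_pos_right hc.1 hK
          _ = ε := div_mul_cancel₀ _ hK.ne'
    _ ≤ δ / 2 + δ / 2 := (measure_union_le _ _).trans
        (add_le_add hn ((measure_ge_le_of_integral_le (fun _ => h0 _) (hT n).1 (hT n).2 hK).trans
          hKδ))
    _ = δ := ENNReal.add_halves δ

lemma tendsto_of_integral_le {T : ℕ × Ω → ℝ} (h0 : ∀ p, 0 ≤ T p) {a : ℕ → ℝ}
    (ha : Tendsto a atTop (𝓝 0))
    (hT : ∀ᶠ n in atTop, Integrable (fun ω => T (n, ω)) μ ∧ ∫ ω, T (n, ω) ∂μ ≤ a n) :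
    Tendsto T (probFilter μ) (𝓝 0) := by
  rw [Metric.tendsto_nhds]
  intro ε hε
  rw [eventually_probFilter]
  have h1 : Tendsto (fun n => ENNReal.ofReal (a n / ε)) atTop (𝓝 0) := by
    have h2 := ENNReal.tendsto_ofReal (ha.div_const ε)
    simpa using h2
  refine tendsto_of_tendsto_of_tendsto_of_le_of_le' tendsto_const_nhds h1
    (Eventually.of_forall fun _ => zero_le) ?_
  filter_upwards [hT] with n hn
  refine le_trans (le_of_eq ?_) (measure_ge_le_of_integral_le (fun ω => h0 (n, ω)) hn.1 hn.2 hε)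
  simp only [dist_zero_right, Real.norm_eq_abs, not_lt, abs_of_nonneg (h0 _)]

/-- Convergence in mean square implies convergence in probability. -/
lemma tendsto_of_integral_sq_le {f : ℕ × Ω → ℝ} {a : ℕ → ℝ} (ha : Tendsto a atTop (𝓝 0))
    (hf : ∀ᶠ n in atTop, Integrable (fun ω => f (n, ω) ^ 2) μ ∧ ∫ ω, f (n, ω) ^ 2 ∂μ ≤ a n) :
    Tendsto f (probFilter μ) (𝓝 0) :=
  tendsto_zero_of_sq (tendsto_of_integral_le (fun _ => sq_nonneg _) ha hf)

end ProbFilter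

/-- Pointwise convergence of an equi-Lipschitz family on a compact set is uniform. -/
lemma tendsto_prod_principal_of_lipschitz {ι α : Type*} {l : Filter ι} [PseudoMetricSpace α]
    {s : Set α} (hs : IsCompact s) {f : ι × α → ℝ}
    (hpt : ∀ x ∈ s, Tendsto (fun p => f (p, x)) l (𝓝 0)) {L : ℝ}
    (hL : ∀ᶠ p in l, ∀ x ∈ s, ∀ y ∈ s, |f (p, x) - f (p, y)| ≤ L * dist x y) :
    Tendsto f (l ×ˢ 𝓟 s) (𝓝 0) := by
  rw [Metric.tendsto_nhds]
  intro ε hε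
  have hL1 : 0 < |L| + 1 := by positivity
  -- The radius makes the Lipschitz error at most ε / 2; the added 1 avoids division by zero when
  -- `L` is zero.
  obtain ⟨t, hts, htf, hcov⟩ := hs.finite_cover_balls
    (show 0 < ε / (2 * (|L| + 1)) by positivity)
  -- Only finitely many centers are involved, so the pointwise limits hold simultaneously along any
  -- filter.
  have h1 : ∀ᶠ p in l, ∀ x ∈ t, |f (p, x)| < ε / 2 := by
    rw [eventually_all_finite htf]
    intro x hx
    have h2 := (Metric.tendsto_nhds.1 (hpt x (hts hx))) (ε / 2) (half_pos hε)
    simpa using h2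
  rw [eventually_prod_principal_iff]
  filter_upwards [h1, hL] with p hp hpL y hy
  obtain ⟨x, hx, hxy⟩ := Set.mem_iUnion₂.1 (hcov hy)
  rw [dist_zero_right, Real.norm_eq_abs]
  have h3 : |f (p, y)| ≤ |f (p, y) - f (p, x)| + |f (p, x)| := by
    simpa using abs_add_le (f (p, y) - f (p, x)) (f (p, x))
  have h4 : |f (p, y) - f (p, x)| ≤ ε / 2 := by
    calc _ ≤ L * dist y x := hpL y hy x (hts hx)
      _ ≤ (|L| + 1) * (ε / (2 * (|L| + 1))) :=
          mul_le_mul ((le_abs_self L).trans (by linarith)) (Metric.mem_ball.1 hxy).le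
            dist_nonneg hL1.le
      _ = ε / 2 := by field_simp
  linarith [hp x hx]

/-! ### Moments of linear and quadratic forms in independent errors -/

section Moments

variable {Ω : Type*} [MeasurableSpace Ω] {μ : Measure Ω} [IsProbabilityMeasure μ]
  {ι : Type*} [Fintype ι] [DecidableEq ι] {v : Ω → ι → ℝ}

/-- Independent square integrable random variables with mean zero. -/
structure IndepCentered (μ : Measure Ω) (v : Ω → ι → ℝ) : Prop where
  measurable : ∀ i, Measurable fun ω => v ω i
  indep : iIndepFun (fun i ω => v ω i) μ
  mean : ∀ i, ∫ ω, v ω i ∂μ = 0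
  memLp : ∀ i, MemLp (fun ω => v ω i) 2 μ

/-- An error is independent of every function of the other errors, so the integral factors through
its mean, which is zero. All vanishing mixed moments below come from this. -/
lemma IndepCentered.integral_mul_comp (h : IndepCentered μ v) {i : ι} {t : Finset ι}
    (hi : i ∉ t) {g : (t → ℝ) → ℝ} (hg : Measurable g) :
    ∫ ω, v ω i * g (fun j => v ω j) ∂μ = 0 := by
  have h1 := h.indep.indepFun_finset {i} t (Finset.disjoint_singleton_left.2 hi) h.measurable
  have hφ : Measurable fun x : ({i} : Finset ι) → ℝ => x ⟨i, Finset.mem_singleton_self i⟩ :=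
    measurable_pi_apply _
  have h2 := h1.comp hφ hg
  have h3 := h2.integral_fun_mul_eq_mul_integral (h.measurable i).aestronglyMeasurable
    (hg.comp (measurable_pi_lambda _ fun j => h.measurable j)).aestronglyMeasurable
  simp only [Function.comp_def] at h3
  rw [h3, h.mean i, zero_mul]

lemma IndepCentered.integral_mul (h : IndepCentered μ v) (i j : ι) :
    ∫ ω, v ω i * v ω j ∂μ = if i = j then ∫ ω, v ω i ^ 2 ∂μ else 0 := by
  split_ifs with hij
  · subst hij; simp only [sq]
  · exact h.integral_mul_comp (t := {j}) (by simpa using hij)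
      (g := fun x => x ⟨j, by simp⟩) (by fun_prop)

/-- An index that occurs once makes the moment vanish. As i ≠ j and k ≠ l, what is left is {i, j} =
{k, l}, where independence produces a product of two variances and never a fourth moment. -/
lemma IndepCentered.integral_mul_mul_mul (h : IndepCentered μ v) {i j k l : ι} (hij : i ≠ j)
    (hkl : k ≠ l) :
    ∫ ω, v ω i * v ω j * (v ω k * v ω l) ∂μ =
      (if i = k ∧ j = l then (∫ ω, v ω i ^ 2 ∂μ) * ∫ ω, v ω j ^ 2 ∂μ else 0) +
      (if i = l ∧ j = k then (∫ ω, v ω i ^ 2 ∂μ) * ∫ ω, v ω j ^ 2 ∂μ else 0) := by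
  have hsq : ∫ ω, v ω i * v ω j * (v ω i * v ω j) ∂μ =
      (∫ ω, v ω i ^ 2 ∂μ) * ∫ ω, v ω j ^ 2 ∂μ := by
    have h1 := (h.indep.indepFun hij).comp (measurable_id.pow_const 2) (measurable_id.pow_const 2)
    have h2 := h1.integral_fun_mul_eq_mul_integral
      ((measurable_id.pow_const 2).comp (h.measurable i)).aestronglyMeasurable
      ((measurable_id.pow_const 2).comp (h.measurable j)).aestronglyMeasurable
    simp only [Function.comp_def, id] at h2
    rw [← h2]
    congr 1 with ω
    ring
  by_cases hi : i ∈ ({k, l} : Finset ι)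
  · by_cases hj : j ∈ ({k, l} : Finset ι)
    · simp only [Finset.mem_insert, Finset.mem_singleton] at hi hj
      rcases hi with rfl | rfl
      · rcases hj with rfl | rfl
        · exact absurd rfl hij
        · simp [hsq, hij]
      · rcases hj with rfl | rfl
        · simp only [mul_comm (v _ j) (v _ i), hsq]
          simp [hij]
        · exact absurd rfl hij
    · have h1 := h.integral_mul_comp (i := j) (t := {i, k, l})
        (by simp only [Finset.mem_insert, not_or] at hj ⊢; exact ⟨hij.symm, hj⟩)
        (g := fun x => x ⟨i, by simp⟩ * (x ⟨k, by simp⟩ * x ⟨l, by simp⟩)) (by fun_prop)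
      simp only [Finset.mem_insert, Finset.mem_singleton, not_or] at hj
      rw [if_neg (fun hc => hj.2 hc.2), if_neg (fun hc => hj.1 hc.2), add_zero, ← h1]
      congr 1 with ω
      ring
  · have h1 := h.integral_mul_comp (i := i) (t := {j, k, l})
        (by simp only [Finset.mem_insert, not_or] at hi ⊢; exact ⟨hij, hi⟩)
        (g := fun x => x ⟨j, by simp⟩ * (x ⟨k, by simp⟩ * x ⟨l, by simp⟩)) (by fun_prop)
    simp only [Finset.mem_insert, Finset.mem_singleton, not_or] at hi
    rw [if_neg (fun hc => hi.1 hc.1), if_neg (fun hc => hi.2 hc.1), add_zero, ← h1]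
    congr 1 with ω
    ring

/-- One of the distinct indices i and j differs from l and so occurs only once. -/
lemma IndepCentered.integral_mul_mul (h : IndepCentered μ v) (l : ι) {i j : ι} (hij : i ≠ j) :
    ∫ ω, v ω l * (v ω i * v ω j) ∂μ = 0 := by
  by_cases hi : i = l
  · have h1 := h.integral_mul_comp (i := j) (t := {i, l})
      (by subst hi; simpa using hij.symm)
      (g := fun x => x ⟨l, by simp⟩ * x ⟨i, by simp⟩) (by fun_prop)
    rw [← h1]
    congr 1 with ω
    ring
  · have h1 := h.integral_mul_comp (i := i) (t := {j, l}) (by simp [hij, hi])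
      (g := fun x => x ⟨l, by simp⟩ * x ⟨j, by simp⟩) (by fun_prop)
    rw [← h1]
    congr 1 with ω
    ring

/-- The squares are independent and integrable, so their product is integrable. Hence zero-diagonal
quadratic forms are square integrable under second moments alone, which is why they can also be
formed in the centered squared errors. -/
lemma IndepCentered.memLp_mul (h : IndepCentered μ v) {i j : ι} (hij : i ≠ j) :
    MemLp (fun ω => v ω i * v ω j) 2 μ := by
  refine (memLp_two_iff_integrable_sq
    ((h.measurable i).mul (h.measurable j)).aestronglyMeasurable).2 ?_
  have h1 := (h.indep.indepFun hij).comp (measurable_id.pow_const 2) (measurable_id.pow_const 2)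
  have h2 := h1.integrable_mul (h.memLp i).integrable_sq (h.memLp j).integrable_sq
  refine h2.congr (Eventually.of_forall fun ω => ?_)
  simp [mul_pow]

lemma IndepCentered.memLp_dotProduct (h : IndepCentered μ v) (c : ι → ℝ) :
    MemLp (fun ω => c ⬝ᵥ v ω) 2 μ :=
  memLp_finsetSum _ fun i _ => (h.memLp i).const_mul (c i)

lemma dotProduct_mulVec_eq_sum (A : Matrix ι ι ℝ) (u w : ι → ℝ) :
    u ⬝ᵥ A *ᵥ w = ∑ p : ι × ι, A p.1 p.2 * (u p.1 * w p.2) := by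
  rw [Fintype.sum_prod_type]
  simp only [dotProduct, mulVec, Finset.mul_sum]
  exact Finset.sum_congr rfl fun i _ => Finset.sum_congr rfl fun j _ => by ring

lemma IndepCentered.memLp_quadratic_term (h : IndepCentered μ v) {A : Matrix ι ι ℝ}
    (hA : ∀ i, A i i = 0) (p : ι × ι) :
    MemLp (fun ω => A p.1 p.2 * (v ω p.1 * v ω p.2)) 2 μ := by
  by_cases hp : p.1 = p.2
  · simp only [hp, hA, zero_mul]
    exact MemLp.zero
  · exact (h.memLp_mul hp).const_mul _

lemma IndepCentered.memLp_quadratic (h : IndepCentered μ v) {A : Matrix ι ι ℝ}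
    (hA : ∀ i, A i i = 0) : MemLp (fun ω => v ω ⬝ᵥ A *ᵥ v ω) 2 μ := by
  simp only [dotProduct_mulVec_eq_sum]
  exact memLp_finsetSum _ fun p _ => h.memLp_quadratic_term hA p

lemma IndepCentered.integrable (h : IndepCentered μ v) (i : ι) :
    Integrable (fun ω => v ω i) μ := (h.memLp i).integrable (by norm_num)

lemma IndepCentered.integral_dotProduct (h : IndepCentered μ v) (c : ι → ℝ) :
    ∫ ω, c ⬝ᵥ v ω ∂μ = 0 := by
  simp only [dotProduct]
  rw [integral_finsetSum _ fun i _ => (h.integrable i).const_mul _]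
  simp [integral_const_mul, h.mean]

lemma IndepCentered.integrable_mul (h : IndepCentered μ v) (i j : ι) :
    Integrable (fun ω => v ω i * v ω j) μ :=
  (h.memLp i).integrable_mul (h.memLp j)

lemma IndepCentered.integrable_quadratic (h : IndepCentered μ v) (A : Matrix ι ι ℝ) :
    Integrable (fun ω => v ω ⬝ᵥ A *ᵥ v ω) μ := by
  simp only [dotProduct_mulVec_eq_sum]
  exact integrable_finsetSum _ fun p _ => (h.integrable_mul _ _).const_mul _

lemma IndepCentered.integral_quadratic (h : IndepCentered μ v) (A : Matrix ι ι ℝ) :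
    ∫ ω, v ω ⬝ᵥ A *ᵥ v ω ∂μ = ∑ i, A i i * ∫ ω, v ω i ^ 2 ∂μ := by
  simp only [dotProduct_mulVec_eq_sum]
  rw [integral_finsetSum _ fun p _ => (h.integrable_mul _ _).const_mul _]
  simp only [integral_const_mul, h.integral_mul, Fintype.sum_prod_type]
  simp

/-- The product of two linear forms is the quadratic form of the rank one matrix c d'. -/
lemma IndepCentered.integral_dotProduct_mul (h : IndepCentered μ v) (c d : ι → ℝ) :
    ∫ ω, (c ⬝ᵥ v ω) * (d ⬝ᵥ v ω) ∂μ = ∑ i, c i * d i * ∫ ω, v ω i ^ 2 ∂μ := by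
  have h1 : ∀ ω, (c ⬝ᵥ v ω) * (d ⬝ᵥ v ω) = v ω ⬝ᵥ Matrix.vecMulVec c d *ᵥ v ω := by
    intro ω
    rw [dotProduct_mulVec_eq_sum, Fintype.sum_prod_type]
    simp only [dotProduct, Finset.sum_mul_sum, Matrix.vecMulVec_apply]
    exact Finset.sum_congr rfl fun i _ => Finset.sum_congr rfl fun j _ => by ring
  simp only [h1, h.integral_quadratic, Matrix.vecMulVec_apply]

lemma IndepCentered.integral_dotProduct_mul_quadratic (h : IndepCentered μ v) (c : ι → ℝ)
    {A : Matrix ι ι ℝ} (hA : ∀ i, A i i = 0) :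
    ∫ ω, (c ⬝ᵥ v ω) * (v ω ⬝ᵥ A *ᵥ v ω) ∂μ = 0 := by
  have hint : ∀ (i : ι) (p : ι × ι), Integrable
      (fun ω => c i * v ω i * (A p.1 p.2 * (v ω p.1 * v ω p.2))) μ := fun i p =>
    ((h.memLp i).const_mul (c i)).integrable_mul (h.memLp_quadratic_term hA p)
  simp only [dotProduct_mulVec_eq_sum]
  simp only [dotProduct, Finset.sum_mul_sum]
  rw [integral_finsetSum _ fun i _ => integrable_finsetSum _ fun p _ => hint i p]
  refine Finset.sum_eq_zero fun i _ => ?_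
  rw [integral_finsetSum _ fun p _ => hint i p]
  refine Finset.sum_eq_zero fun p _ => ?_
  by_cases hp : p.1 = p.2
  · simp [hp, hA]
  · have h1 : ∀ ω, c i * v ω i * (A p.1 p.2 * (v ω p.1 * v ω p.2)) =
        c i * A p.1 p.2 * (v ω i * (v ω p.1 * v ω p.2)) := fun ω => by ring
    simp only [h1, integral_const_mul, h.integral_mul_mul i hp, mul_zero]

lemma IndepCentered.integral_quadratic_mul (h : IndepCentered μ v) {A B : Matrix ι ι ℝ}
    (hA : ∀ i, A i i = 0) (hB : ∀ i, B i i = 0) :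
    ∫ ω, (v ω ⬝ᵥ A *ᵥ v ω) * (v ω ⬝ᵥ B *ᵥ v ω) ∂μ =
      ∑ i, ∑ j, A i j * (B i j + B j i) *
        ((∫ ω, v ω i ^ 2 ∂μ) * ∫ ω, v ω j ^ 2 ∂μ) := by
  have hint : ∀ p q : ι × ι, Integrable (fun ω => A p.1 p.2 * (v ω p.1 * v ω p.2) *
      (B q.1 q.2 * (v ω q.1 * v ω q.2))) μ := fun p q =>
    (h.memLp_quadratic_term hA p).integrable_mul (h.memLp_quadratic_term hB q)
  simp only [dotProduct_mulVec_eq_sum, Finset.sum_mul_sum]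
  rw [integral_finsetSum _ fun p _ => integrable_finsetSum _ fun q _ => hint p q,
    Fintype.sum_prod_type]
  refine Finset.sum_congr rfl fun i _ => Finset.sum_congr rfl fun j _ => ?_
  rw [integral_finsetSum _ fun q _ => hint (i, j) q]
  by_cases hij : i = j
  · subst hij
    simp [hA]
  have h1 : ∀ q : ι × ι, ∫ ω, A i j * (v ω i * v ω j) * (B q.1 q.2 * (v ω q.1 * v ω q.2)) ∂μ =
      (if i = q.1 ∧ j = q.2 then A i j * B q.1 q.2 *
        ((∫ ω, v ω i ^ 2 ∂μ) * ∫ ω, v ω j ^ 2 ∂μ) else 0) +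
      (if i = q.2 ∧ j = q.1 then A i j * B q.1 q.2 *
        ((∫ ω, v ω i ^ 2 ∂μ) * ∫ ω, v ω j ^ 2 ∂μ) else 0) := by
    intro q
    by_cases hq : q.1 = q.2
    · simp [hq, hB]
    · have h2 : ∀ ω, A i j * (v ω i * v ω j) * (B q.1 q.2 * (v ω q.1 * v ω q.2)) =
        A i j * B q.1 q.2 * (v ω i * v ω j * (v ω q.1 * v ω q.2)) := fun ω => by ring
      simp only [h2, integral_const_mul, h.integral_mul_mul_mul hij hq, mul_add, mul_ite,
        mul_zero]
  simp only [h1, Fintype.sum_prod_type, Finset.sum_add_distrib, ite_and]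
  simp only [Finset.sum_ite_eq, Finset.mem_univ, if_true, Finset.sum_ite_irrel,
    Finset.sum_const_zero]
  ring

end Moments

/-! ### The model in terms of the errors -/

section Model

variable {n k : ℕ} (W M : Matrix (Fin n) (Fin n) ℝ) (X : Matrix (Fin n) (Fin k) ℝ)

/-- The vector of observations as a function of the vector of errors. -/
def outcome (β₀ : Fin k → ℝ) (lam₀ ρ₀ : ℝ) (v : Fin n → ℝ) : Fin n → ℝ :=
  NormedSpace.exp ((-lam₀) • W) *ᵥ (X *ᵥ β₀ + NormedSpace.exp ((-ρ₀) • M) *ᵥ v)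

/-- The coefficient matrix of the errors in the transformed observations. -/
def noiseMat (lam₀ ρ₀ : ℝ) (ζ : ℝ × ℝ) : Matrix (Fin n) (Fin n) ℝ :=
  NormedSpace.exp (ζ.2 • M) * NormedSpace.exp (ζ.1 • W) * NormedSpace.exp ((-lam₀) • W) *
    NormedSpace.exp ((-ρ₀) • M)

/-- The mean of the transformed observations. -/
def meanVec (β₀ : Fin k → ℝ) (lam₀ : ℝ) (ζ : ℝ × ℝ) : Fin n → ℝ :=
  (NormedSpace.exp (ζ.2 • M) * NormedSpace.exp (ζ.1 • W) * NormedSpace.exp ((-lam₀) • W)) *ᵥ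
    (X *ᵥ β₀)

/-- The transformed regressors, the columns of `e^{ρM} X`. -/
def regr (ρ : ℝ) (a : Fin k) : Fin n → ℝ :=
  NormedSpace.exp (ρ • M) *ᵥ fun i => X i a

/-- The normalized Gram matrix of the transformed regressors. -/
def gram (ρ : ℝ) : Matrix (Fin k) (Fin k) ℝ :=
  (n : ℝ)⁻¹ • (Xᵀ * NormedSpace.exp (ρ • Mᵀ) * NormedSpace.exp (ρ • M) * X)

/-- The least squares coefficients of `z` with respect to the transformed regressors. -/
def projCoef (ρ : ℝ) (z : Fin n → ℝ) (a : Fin k) : ℝ :=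
  ∑ b, (gram M X ρ)⁻¹ a b * ((n : ℝ)⁻¹ * (regr M X ρ b ⬝ᵥ z))

/-- The linear combination of the transformed regressors with given coefficients. -/
def regrComb (ρ : ℝ) (β : Fin k → ℝ) : Fin n → ℝ := ∑ a, β a • regr M X ρ a

variable {W M X}

lemma exp_neg_smul_mul (t : ℝ) :
    NormedSpace.exp ((-t) • M) * NormedSpace.exp (t • M) = 1 := by
  rw [neg_smul, Matrix.exp_neg]
  exact Matrix.nonsing_inv_mul _ ((Matrix.isUnit_iff_isUnit_det _).1 (Matrix.isUnit_exp _))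

lemma exp_mul_exp_neg_smul (t : ℝ) :
    NormedSpace.exp (t • M) * NormedSpace.exp ((-t) • M) = 1 := by
  have h := exp_neg_smul_mul (M := M) (-t)
  rwa [neg_neg] at h

/-- Matrix exponentials are invertible, so the two model equations determine the observations from
the errors. -/
lemma eq_outcome {β₀ : Fin k → ℝ} {lam₀ ρ₀ : ℝ} {y u v : Fin n → ℝ}
    (hy : NormedSpace.exp (lam₀ • W) *ᵥ y = X *ᵥ β₀ + u)
    (hu : NormedSpace.exp (ρ₀ • M) *ᵥ u = v) : y = outcome W M X β₀ lam₀ ρ₀ v := by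
  rw [outcome, ← hu, Matrix.mulVec_mulVec, exp_neg_smul_mul, Matrix.one_mulVec, ← hy,
    Matrix.mulVec_mulVec, exp_neg_smul_mul, Matrix.one_mulVec]

lemma exp_mulVec_outcome (β₀ : Fin k → ℝ) (lam₀ ρ₀ : ℝ) (ζ : ℝ × ℝ) (v : Fin n → ℝ) :
    NormedSpace.exp (ζ.2 • M) *ᵥ (NormedSpace.exp (ζ.1 • W) *ᵥ outcome W M X β₀ lam₀ ρ₀ v) =
      meanVec W M X β₀ lam₀ ζ + noiseMat W M lam₀ ρ₀ ζ *ᵥ v := by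
  simp only [outcome, meanVec, noiseMat, Matrix.mulVec_add, Matrix.mulVec_mulVec,
    Matrix.mul_assoc]

lemma regrComb_eq (ρ : ℝ) (β : Fin k → ℝ) :
    regrComb M X ρ β = NormedSpace.exp (ρ • M) *ᵥ (X *ᵥ β) := by
  have h : X *ᵥ β = ∑ a, β a • fun i => X i a := by
    ext i
    simp [Matrix.mulVec, dotProduct, mul_comm]
  rw [h, Matrix.mulVec_sum]
  simp only [regrComb, regr, Matrix.mulVec_smul]

lemma transpose_mul_exp_mulVec (ρ : ℝ) (z : Fin n → ℝ) (a : Fin k) :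
    ((Xᵀ * NormedSpace.exp (ρ • Mᵀ)) *ᵥ z) a = regr M X ρ a ⬝ᵥ z := by
  rw [← Matrix.transpose_smul, Matrix.exp_transpose, ← Matrix.transpose_mul]
  rfl

lemma gram_apply (ρ : ℝ) (a b : Fin k) :
    gram M X ρ a b = (n : ℝ)⁻¹ * (regr M X ρ a ⬝ᵥ regr M X ρ b) := by
  rw [gram, Matrix.smul_apply, smul_eq_mul, ← transpose_mul_exp_mulVec,
    Matrix.mul_assoc _ _ X]
  rfl

lemma projCoef_eq (ρ : ℝ) (z : Fin n → ℝ) :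
    projCoef M X ρ z = (gram M X ρ)⁻¹ *ᵥ fun b => (n : ℝ)⁻¹ * (regr M X ρ b ⬝ᵥ z) := rfl

lemma projCoef_add (ρ : ℝ) (z z' : Fin n → ℝ) :
    projCoef M X ρ (z + z') = projCoef M X ρ z + projCoef M X ρ z' := by
  simp only [projCoef_eq, dotProduct_add, mul_add]
  rw [← Matrix.mulVec_add]
  rfl

lemma projCoef_regrComb {ρ : ℝ} (hG : IsUnit (gram M X ρ).det) (β : Fin k → ℝ) :
    projCoef M X ρ (regrComb M X ρ β) = β := by
  have h : (fun b => (n : ℝ)⁻¹ * (regr M X ρ b ⬝ᵥ regrComb M X ρ β)) = gram M X ρ *ᵥ β := by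
    ext b
    simp only [regrComb, dotProduct_sum, dotProduct_smul, Matrix.mulVec, gram_apply,
      Finset.mul_sum, smul_eq_mul]
    exact Finset.sum_congr rfl fun c _ => by ring
  rw [projCoef_eq, h, Matrix.mulVec_mulVec, Matrix.nonsing_inv_mul _ hG, Matrix.one_mulVec]

/-- The estimator consists of the least squares coefficients of the transformed observations on the
transformed regressors. The factors 1/n cancel; they are introduced so that the Gram matrix and its
inverse stay bounded. -/
lemma betaHat_eq {ζ : ℝ × ℝ} (hn : n ≠ 0) (hG : IsUnit (gram M X ζ.2).det) (y : Fin n → ℝ) :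
    betaHat W M X y ζ = projCoef M X ζ.2
      (NormedSpace.exp (ζ.2 • M) *ᵥ (NormedSpace.exp (ζ.1 • W) *ᵥ y)) := by
  have hn' : (n : ℝ) ≠ 0 := Nat.cast_ne_zero.2 hn
  set P := Xᵀ * NormedSpace.exp (ζ.2 • Mᵀ) * NormedSpace.exp (ζ.2 • M) * X with hP
  have hg : gram M X ζ.2 = (n : ℝ)⁻¹ • P := rfl
  have hPdet : IsUnit P.det := by
    rw [hg, Matrix.det_smul] at hG
    exact isUnit_of_mul_isUnit_right hG
  have hinv : P⁻¹ = (n : ℝ)⁻¹ • (gram M X ζ.2)⁻¹ := by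
    have h1 := Matrix.inv_smul' (A := P) (Units.mk0 (n : ℝ)⁻¹ (inv_ne_zero hn')) hPdet
    rw [Units.smul_def, Units.val_mk0] at h1
    rw [hg, h1, Units.smul_def]
    simp [smul_smul, hn']
  have hz : (fun b => (n : ℝ)⁻¹ * (regr M X ζ.2 b ⬝ᵥ
      (NormedSpace.exp (ζ.2 • M) *ᵥ (NormedSpace.exp (ζ.1 • W) *ᵥ y)))) =
      (n : ℝ)⁻¹ • ((Xᵀ * NormedSpace.exp (ζ.2 • Mᵀ)) *ᵥ
        (NormedSpace.exp (ζ.2 • M) *ᵥ (NormedSpace.exp (ζ.1 • W) *ᵥ y))) := by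
    ext b
    rw [← transpose_mul_exp_mulVec]
    rfl
  rw [betaHat, ← hP, hinv, projCoef_eq, hz, Matrix.mulVec_smul]
  simp only [Matrix.mulVec_mulVec, Matrix.smul_mul, Matrix.smul_mulVec, Matrix.mul_assoc]

lemma resid_outcome (β₀ : Fin k → ℝ) (lam₀ ρ₀ : ℝ) (ζ : ℝ × ℝ) (v : Fin n → ℝ)
    (β : Fin k → ℝ) :
    resid W M X (outcome W M X β₀ lam₀ ρ₀ v) β ζ =
      meanVec W M X β₀ lam₀ ζ + noiseMat W M lam₀ ρ₀ ζ *ᵥ v - regrComb M X ζ.2 β := by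
  rw [resid, Matrix.mulVec_sub, exp_mulVec_outcome, regrComb_eq]

lemma scoreLam_outcome (β₀ : Fin k → ℝ) (lam₀ ρ₀ : ℝ) (ζ : ℝ × ℝ) (v : Fin n → ℝ)
    (β : Fin k → ℝ) :
    scoreLam W M X (outcome W M X β₀ lam₀ ρ₀ v) β ζ =
      -((meanVec W M X β₀ lam₀ ζ + noiseMat W M lam₀ ρ₀ ζ *ᵥ v) ⬝ᵥ
        twistedD W M ζ.2 *ᵥ resid W M X (outcome W M X β₀ lam₀ ρ₀ v) β ζ) := by
  rw [scoreLam, ← exp_mulVec_outcome]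
  congr 1
  rw [← Matrix.transpose_smul, ← Matrix.transpose_smul, Matrix.exp_transpose,
    Matrix.exp_transpose, ← Matrix.transpose_mul, Matrix.mulVec_mulVec, ← Matrix.mulVec_mulVec,
    Matrix.dotProduct_mulVec, Matrix.vecMul_transpose]

lemma meanVec_true (β₀ : Fin k → ℝ) (lam₀ ρ₀ : ℝ) :
    meanVec W M X β₀ lam₀ (lam₀, ρ₀) = regrComb M X ρ₀ β₀ := by
  rw [meanVec, mul_assoc, exp_mul_exp_neg_smul, mul_one, regrComb_eq]

lemma noiseMat_true (lam₀ ρ₀ : ℝ) : noiseMat W M lam₀ ρ₀ (lam₀, ρ₀) = 1 := by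
  rw [noiseMat, mul_assoc (NormedSpace.exp _), exp_mul_exp_neg_smul, mul_one,
    exp_mul_exp_neg_smul]

lemma twistedD_diag (W M : Matrix (Fin n) (Fin n) ℝ) (ρ : ℝ) (i : Fin n) :
    twistedD W M ρ i i = 0 := by simp [twistedD]

/-! ### The variance matrix of the score -/

/-- The coefficients of the linear part of the score in the errors. -/
def scoreVec (W M : Matrix (Fin n) (Fin n) ℝ) (X : Matrix (Fin n) (Fin k) ℝ) (β : Fin k → ℝ)
    (ρ : ℝ) : Fin k ⊕ Fin 2 → Fin n → ℝ :=
  Sum.elim (regr M X ρ) ![-((twistedD W M ρ)ᵀ *ᵥ regrComb M X ρ β), 0]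

/-- The matrices of the quadratic part of the score in the errors. -/
def scoreMat (k : ℕ) (W M : Matrix (Fin n) (Fin n) ℝ) (ρ : ℝ) :
    Fin k ⊕ Fin 2 → Matrix (Fin n) (Fin n) ℝ :=
  Sum.elim (fun _ => 0) ![-twistedD W M ρ, -M]

/-- The adjustment of the score removes the diagonal of 𝕎, and M has none. The score is thereby
centered at the true parameters whatever the variances are, and its covariances involve no higher
moments of the errors. -/
lemma scoreMat_diag (hM : ∀ i, M i i = 0) (ρ : ℝ) (a : Fin k ⊕ Fin 2) (i : Fin n) :
    scoreMat k W M ρ a i i = 0 := by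
  rcases a with a | a
  · rfl
  · fin_cases a
    · simp [scoreMat, twistedD_diag]
    · simp [scoreMat, hM]

/-- At the true parameters the residual vector is the error vector, so each component is a linear
plus a quadratic form in it. -/
lemma score_true (β₀ : Fin k → ℝ) (lam₀ ρ₀ : ℝ) (v : Fin n → ℝ) (a : Fin k ⊕ Fin 2) :
    score W M X (outcome W M X β₀ lam₀ ρ₀ v) β₀ (lam₀, ρ₀) a =
      scoreVec W M X β₀ ρ₀ a ⬝ᵥ v + v ⬝ᵥ scoreMat k W M ρ₀ a *ᵥ v := by
  have hr : resid W M X (outcome W M X β₀ lam₀ ρ₀ v) β₀ (lam₀, ρ₀) = v := by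
    rw [resid_outcome, meanVec_true, noiseMat_true, Matrix.one_mulVec, add_sub_cancel_left]
  rcases a with a | a
  · simp only [score, Sum.elim_inl, scoreBeta, hr, scoreVec, scoreMat, Matrix.zero_mulVec,
      dotProduct_zero, add_zero]
    exact transpose_mul_exp_mulVec _ _ _
  · fin_cases a
    · simp only [score, Sum.elim_inr, scoreLam_outcome, hr, scoreVec, scoreMat, meanVec_true,
        noiseMat_true, Matrix.one_mulVec]
      simp [Matrix.neg_mulVec, add_dotProduct, Matrix.mulVec_transpose,
        Matrix.dotProduct_mulVec, Matrix.add_vecMul]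
      ring
    · simp [score, scoreRho, hr, scoreVec, scoreMat, Matrix.neg_mulVec]

/-- The entry of the variance matrix as a function of the variances of the errors. -/
def omegaEntry (s : Fin n → ℝ) (c d : Fin n → ℝ) (A B : Matrix (Fin n) (Fin n) ℝ) : ℝ :=
  (n : ℝ)⁻¹ * ((c * d) ⬝ᵥ s) + (n : ℝ)⁻¹ * (s ⬝ᵥ (A ⊙ (B + Bᵀ)) *ᵥ s)

lemma dotProduct_hadamard_mulVec (s : Fin n → ℝ) (A B : Matrix (Fin n) (Fin n) ℝ) :
    s ⬝ᵥ (A ⊙ B) *ᵥ s = ∑ i, ∑ j, A i j * B i j * (s i * s j) := by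
  rw [dotProduct_mulVec_eq_sum, Fintype.sum_prod_type]
  rfl

/-- Interchanging the summation indices in the transposed part exchanges the roles of A and B. This
reduces the blocks below the diagonal to those above it. -/
lemma omegaEntry_comm (s c d : Fin n → ℝ) (A B : Matrix (Fin n) (Fin n) ℝ) :
    omegaEntry s c d A B = omegaEntry s d c B A := by
  rw [omegaEntry, omegaEntry, mul_comm c d, dotProduct_hadamard_mulVec,
    dotProduct_hadamard_mulVec]
  congr 2
  simp only [Matrix.add_apply, Matrix.transpose_apply, mul_add, add_mul, Finset.sum_add_distrib]
  congr 1
  · exact Finset.sum_congr rfl fun i _ => Finset.sum_congr rfl fun j _ => by ring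
  · rw [Finset.sum_comm]
    exact Finset.sum_congr rfl fun i _ => Finset.sum_congr rfl fun j _ => by ring

/-- The trace pairs the (i, j) entry of A with the (j, i) entry of B + Bᵀ; by symmetry this is the
Hadamard product. -/
lemma trace_diagonal_mul (s : Fin n → ℝ) (A B : Matrix (Fin n) (Fin n) ℝ) :
    Matrix.trace (Matrix.diagonal s * A * Matrix.diagonal s * (B + Bᵀ)) =
      s ⬝ᵥ (A ⊙ (B + Bᵀ)) *ᵥ s := by
  rw [dotProduct_hadamard_mulVec, Matrix.trace]
  refine Finset.sum_congr rfl fun i _ => ?_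
  rw [Matrix.diag_apply, Matrix.mul_apply]
  refine Finset.sum_congr rfl fun j _ => ?_
  rw [Matrix.mul_diagonal, Matrix.diagonal_mul, Matrix.add_apply, Matrix.add_apply,
    Matrix.transpose_apply, Matrix.transpose_apply]
  ring

/-- Moving the outer factors onto the two vectors leaves a weighted sum over the diagonal `s`.
Suitable P, Q and unit vectors give every block of `omegaForm` that contains X. -/
lemma transpose_mul_diagonal_mul (s : Fin n → ℝ) (P Q : Matrix (Fin n) (Fin n) ℝ) (ρ : ℝ)
    (x y : Fin k → ℝ) :
    x ⬝ᵥ (Xᵀ * NormedSpace.exp (ρ • Mᵀ) * P * Matrix.diagonal s * Q *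
      NormedSpace.exp (ρ • M) * X) *ᵥ y =
    ((Pᵀ *ᵥ regrComb M X ρ x) * (Q *ᵥ regrComb M X ρ y)) ⬝ᵥ s := by
  simp only [← Matrix.mulVec_mulVec]
  rw [← Matrix.transpose_smul, Matrix.exp_transpose, Matrix.dotProduct_mulVec,
    Matrix.vecMul_transpose, Matrix.dotProduct_mulVec, Matrix.vecMul_transpose, ← regrComb_eq,
    ← regrComb_eq, Matrix.dotProduct_mulVec, ← Matrix.mulVec_transpose]
  simp only [dotProduct, Matrix.mulVec_diagonal, Pi.mul_apply]
  exact Finset.sum_congr rfl fun i _ => by ring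

lemma regrComb_single (ρ : ℝ) (a : Fin k) :
    regrComb M X ρ (Pi.single a 1) = regr M X ρ a := by
  rw [regrComb_eq, Matrix.mulVec_single_one]
  rfl

lemma omegaForm_diagonal (β : Fin k → ℝ) (ρ : ℝ) (s : Fin n → ℝ) (a b : Fin k ⊕ Fin 2) :
    omegaForm W M X β ρ (Matrix.diagonal s) a b =
      omegaEntry s (scoreVec W M X β ρ a) (scoreVec W M X β ρ b)
        (scoreMat k W M ρ a) (scoreMat k W M ρ b) := by
  -- The minus signs of the two quadratic score components cancel in pairs.
  have hneg : ∀ A B : Matrix (Fin n) (Fin n) ℝ, (-A) ⊙ (-B + (-B)ᵀ) = A ⊙ (B + Bᵀ) := by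
    intro A B
    ext i j
    simp only [Matrix.hadamard_apply, Matrix.neg_apply, Matrix.add_apply,
      Matrix.transpose_apply]
    ring
  have h12 : ∀ a : Fin k, (n : ℝ)⁻¹ * -((Xᵀ * NormedSpace.exp (ρ • Mᵀ) * Matrix.diagonal s *
      (twistedD W M ρ)ᵀ * NormedSpace.exp (ρ • M) * X) *ᵥ β) a =
      omegaEntry s (scoreVec W M X β ρ (Sum.inl a)) (scoreVec W M X β ρ (Sum.inr 0))
        (scoreMat k W M ρ (Sum.inl a)) (scoreMat k W M ρ (Sum.inr 0)) := by
    intro a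
    have h := transpose_mul_diagonal_mul (M := M) (X := X) s 1 (twistedD W M ρ)ᵀ ρ
      (Pi.single a 1) β
    rw [single_one_dotProduct, Matrix.mul_one, regrComb_single, Matrix.transpose_one,
      Matrix.one_mulVec] at h
    rw [h]
    simp [omegaEntry, scoreVec, scoreMat, neg_dotProduct]
  have h23 : (n : ℝ)⁻¹ * Matrix.trace (Matrix.diagonal s * twistedD W M ρ * Matrix.diagonal s *
      (M + Mᵀ)) =
      omegaEntry s (scoreVec W M X β ρ (Sum.inr 0)) (scoreVec W M X β ρ (Sum.inr 1))
        (scoreMat k W M ρ (Sum.inr 0)) (scoreMat k W M ρ (Sum.inr 1)) := by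
    rw [trace_diagonal_mul, omegaEntry]
    simp only [scoreVec, scoreMat, Sum.elim_inr, Matrix.cons_val_zero, Matrix.cons_val_one]
    rw [hneg, mul_zero, zero_dotProduct, mul_zero, zero_add]
  rcases a with a | a <;> rcases b with b | b
  · have h := transpose_mul_diagonal_mul (M := M) (X := X) s 1 1 ρ
      (Pi.single a 1) (Pi.single b 1)
    rw [single_one_dotProduct, Matrix.mul_one, Matrix.mul_one, regrComb_single, regrComb_single,
      Matrix.transpose_one, Matrix.one_mulVec, Matrix.one_mulVec,
      Matrix.mulVec_single_one] at h
    simp only [omegaForm, Matrix.smul_apply, Matrix.fromBlocks_apply₁₁, smul_eq_mul]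
    rw [Matrix.col_apply] at h
    rw [h]
    simp [omegaEntry, scoreVec, scoreMat]
  · fin_cases b
    · exact h12 a
    · simp [omegaForm, omegaEntry, scoreVec, scoreMat]
  · fin_cases a
    · rw [omegaEntry_comm]
      exact h12 b
    · simp [omegaForm, omegaEntry, scoreVec, scoreMat]
  · fin_cases a <;> fin_cases b
    · have h := transpose_mul_diagonal_mul (M := M) (X := X) s (twistedD W M ρ)
        (twistedD W M ρ)ᵀ ρ β β
      simp only [omegaForm, Matrix.smul_apply, smul_eq_mul, omegaEntry, scoreVec, scoreMat]
      simp only [Matrix.fromBlocks_apply₂₂, Fin.zero_eta, Matrix.of_apply, Matrix.cons_val_zero,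
        Sum.elim_inr]
      rw [h, trace_diagonal_mul, hneg, neg_mul_neg, mul_add]
    · exact h23
    · rw [omegaEntry_comm]
      exact h23
    · simp only [omegaForm, Matrix.smul_apply, smul_eq_mul, omegaEntry, scoreVec, scoreMat]
      simp only [Matrix.fromBlocks_apply₂₂, Fin.mk_one, Matrix.of_apply, Matrix.cons_val_one,
        Matrix.cons_val_fin_one, Sum.elim_inr, trace_diagonal_mul]
      rw [hneg, mul_zero, zero_dotProduct, mul_zero, zero_add]

variable {Ω : Type*} [MeasurableSpace Ω] {μ : Measure Ω} [IsProbabilityMeasure μ]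

/-- Each component has mean zero, so the covariance is the expectation of the product.
Linear-quadratic cross terms vanish because the matrices have zero diagonals; the other terms depend
on the errors only through their variances. -/
lemma omegaTrue_eq {v : Ω → Fin n → ℝ} (hv : IndepCentered μ v) (hM : ∀ i, M i i = 0)
    (β₀ : Fin k → ℝ) (lam₀ ρ₀ : ℝ) (a b : Fin k ⊕ Fin 2) :
    omegaTrue μ W M X (fun ω => outcome W M X β₀ lam₀ ρ₀ (v ω)) β₀ (lam₀, ρ₀) a b =
      omegaEntry (fun i => ∫ ω, v ω i ^ 2 ∂μ) (scoreVec W M X β₀ ρ₀ a)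
        (scoreVec W M X β₀ ρ₀ b) (scoreMat k W M ρ₀ a) (scoreMat k W M ρ₀ b) := by
  have hA := fun a => scoreMat_diag (W := W) (k := k) hM ρ₀ a
  set c := scoreVec W M X β₀ ρ₀
  set A := scoreMat k W M ρ₀
  have hlin := fun a => hv.memLp_dotProduct (c a)
  have hquad := fun a => hv.memLp_quadratic (hA a)
  have hmem : ∀ a, MemLp (fun ω => c a ⬝ᵥ v ω + v ω ⬝ᵥ A a *ᵥ v ω) 2 μ := fun a =>
    (hlin a).add (hquad a)
  have hmean : ∀ a, ∫ ω, c a ⬝ᵥ v ω + v ω ⬝ᵥ A a *ᵥ v ω ∂μ = 0 := by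
    intro a
    rw [integral_add ((hlin a).integrable (by norm_num)) ((hquad a).integrable (by norm_num)),
      hv.integral_dotProduct, hv.integral_quadratic]
    simp [hA]
  have hprod : ∫ ω, (c a ⬝ᵥ v ω + v ω ⬝ᵥ A a *ᵥ v ω) * (c b ⬝ᵥ v ω + v ω ⬝ᵥ A b *ᵥ v ω) ∂μ =
      ∑ i, c a i * c b i * ∫ ω, v ω i ^ 2 ∂μ + ∑ i, ∑ j, A a i j * (A b i j + A b j i) *
        ((∫ ω, v ω i ^ 2 ∂μ) * ∫ ω, v ω j ^ 2 ∂μ) := by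
    have hexp : ∀ ω, (c a ⬝ᵥ v ω + v ω ⬝ᵥ A a *ᵥ v ω) * (c b ⬝ᵥ v ω + v ω ⬝ᵥ A b *ᵥ v ω) =
        ((c a ⬝ᵥ v ω) * (c b ⬝ᵥ v ω) + (c a ⬝ᵥ v ω) * (v ω ⬝ᵥ A b *ᵥ v ω)) +
        ((c b ⬝ᵥ v ω) * (v ω ⬝ᵥ A a *ᵥ v ω) +
          (v ω ⬝ᵥ A a *ᵥ v ω) * (v ω ⬝ᵥ A b *ᵥ v ω)) := fun ω => by ring
    simp only [hexp]
    have i1 := (hlin a).integrable_mul (hlin b)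
    have i2 := (hlin a).integrable_mul (hquad b)
    have i3 := (hlin b).integrable_mul (hquad a)
    have i4 := (hquad a).integrable_mul (hquad b)
    simp only [Pi.mul_def] at i1 i2 i3 i4
    have e := integral_add (i1.add i2) (i3.add i4)
    simp only [Pi.add_apply] at e
    rw [e, integral_add i1 i2, integral_add i3 i4,
      hv.integral_dotProduct_mul, hv.integral_dotProduct_mul_quadratic _ (hA b),
      hv.integral_dotProduct_mul_quadratic _ (hA a), hv.integral_quadratic_mul (hA a) (hA b)]
    ring
  have hcov : cov[fun ω => c a ⬝ᵥ v ω + v ω ⬝ᵥ A a *ᵥ v ω,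
      fun ω => c b ⬝ᵥ v ω + v ω ⬝ᵥ A b *ᵥ v ω; μ] = _ :=
    covariance_eq_sub (hmem a) (hmem b)
  rw [hmean, hmean, mul_zero, sub_zero] at hcov
  simp only [Pi.mul_apply] at hcov
  rw [hprod] at hcov
  simp only [omegaTrue, Matrix.of_apply, score_true]
  rw [covariance_const_mul_left, covariance_const_mul_right, hcov, ← mul_assoc, ← mul_inv,
    Real.mul_self_sqrt (Nat.cast_nonneg n), omegaEntry, dotProduct_hadamard_mulVec, mul_add]
  rfl

end Model

/-! ### Laws of large numbers -/

section LLN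

variable {Ω : Type*} [MeasurableSpace Ω] {μ : Measure Ω} [IsProbabilityMeasure μ]
  {ξ : (n : ℕ) → Ω → Fin n → ℝ}

lemma tendsto_inv_mul_const (C : ℝ) : Tendsto (fun n : ℕ => (n : ℝ)⁻¹ * C) atTop (𝓝 0) := by
  simpa using (tendsto_inv_atTop_nhds_zero_nat (𝕜 := ℝ)).mul_const C

lemma inv_sq_mul_le {n : ℕ} {x C : ℝ} (hC : 0 ≤ C) (hx : x ≤ n * C) :
    ((n : ℝ)⁻¹) ^ 2 * x ≤ (n : ℝ)⁻¹ * C := by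
  calc ((n : ℝ)⁻¹) ^ 2 * x ≤ ((n : ℝ)⁻¹) ^ 2 * (n * C) := by gcongr
    _ = ((n : ℝ)⁻¹ * n) * ((n : ℝ)⁻¹ * C) := by ring
    _ ≤ 1 * ((n : ℝ)⁻¹ * C) := by gcongr; exact inv_mul_card_le_one n
    _ = _ := one_mul _

lemma tendsto_linear (hξ : ∀ n, IndepCentered μ (ξ n)) {K : ℝ} (hK0 : 0 ≤ K)
    (hK : ∀ n i, ∫ ω, ξ n ω i ^ 2 ∂μ ≤ K) {w : ∀ n, Fin n → ℝ} {C : ℝ}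
    (hw : ∀ᶠ n in atTop, ‖w n‖ ≤ C) :
    Tendsto (fun p : ℕ × Ω => (p.1 : ℝ)⁻¹ * (w p.1 ⬝ᵥ ξ p.1 p.2)) (probFilter μ) (𝓝 0) := by
  refine tendsto_of_integral_sq_le (tendsto_inv_mul_const (C ^ 2 * K)) ?_
  filter_upwards [hw] with n hw
  have hint := (hξ n).memLp_dotProduct (w n)
  simp only [mul_pow]
  refine ⟨hint.integrable_sq.const_mul _, ?_⟩
  rw [integral_const_mul]
  refine inv_sq_mul_le (by positivity) ?_
  simp only [sq (w n ⬝ᵥ _)]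
  rw [(hξ n).integral_dotProduct_mul]
  calc ∑ i, w n i * w n i * ∫ ω, ξ n ω i ^ 2 ∂μ ≤ ∑ _i : Fin n, C ^ 2 * K := by
        refine Finset.sum_le_sum fun i _ => ?_
        have h1 : w n i * w n i ≤ C ^ 2 := by
          rw [← sq, ← sq_abs]
          gcongr
          exact (norm_le_pi_norm (w n) i).trans hw
        exact mul_le_mul h1 (hK n i) (integral_nonneg fun _ => sq_nonneg _) (by positivity)
    _ = n * (C ^ 2 * K) := by simp

/-- The second moment of the form is a double sum of O(n) size: one factor |A i j| is summed along
rows, and the other is bounded entrywise. Dividing by n² leaves O(1/n). The variables are left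
general because both the errors and their centered squares are inserted. -/
lemma tendsto_quadratic_of_diag_eq_zero (hξ : ∀ n, IndepCentered μ (ξ n)) {K : ℝ} (hK0 : 0 ≤ K)
    (hK : ∀ n i, ∫ ω, ξ n ω i ^ 2 ∂μ ≤ K) {A : ∀ n, Matrix (Fin n) (Fin n) ℝ} {C : ℝ}
    (hC : 0 ≤ C) (hA : ∀ᶠ n in atTop, sumNorm n (A n) ≤ C) (hdiag : ∀ n i, A n i i = 0) :
    Tendsto (fun p : ℕ × Ω => (p.1 : ℝ)⁻¹ * (ξ p.1 p.2 ⬝ᵥ A p.1 *ᵥ ξ p.1 p.2))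
      (probFilter μ) (𝓝 0) := by
  refine tendsto_of_integral_sq_le (tendsto_inv_mul_const (C * (2 * C * (K * K)))) ?_
  filter_upwards [hA] with n hA
  have hint := (hξ n).memLp_quadratic (hdiag n)
  simp only [mul_pow]
  refine ⟨hint.integrable_sq.const_mul _, ?_⟩
  rw [integral_const_mul]
  refine inv_sq_mul_le (by positivity) ?_
  simp only [sq (_ ⬝ᵥ _)]
  rw [(hξ n).integral_quadratic_mul (hdiag n) (hdiag n)]
  calc _ ≤ ∑ i, ∑ j, |A n i j| * (2 * C * (K * K)) := by
        refine Finset.sum_le_sum fun i _ => Finset.sum_le_sum fun j _ => ?_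
        have h1 : |A n i j + A n j i| ≤ 2 * C := by
          have h2 := (abs_entry_le (A n) i j).trans hA
          have h3 := (abs_entry_le (A n) j i).trans hA
          linarith [abs_add_le (A n i j) (A n j i)]
        have hi : 0 ≤ ∫ ω, ξ n ω i ^ 2 ∂μ := integral_nonneg fun _ => sq_nonneg _
        have hj : 0 ≤ ∫ ω, ξ n ω j ^ 2 ∂μ := integral_nonneg fun _ => sq_nonneg _
        calc _ ≤ |A n i j * (A n i j + A n j i) *
              ((∫ ω, ξ n ω i ^ 2 ∂μ) * ∫ ω, ξ n ω j ^ 2 ∂μ)| := le_abs_self _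
          _ = |A n i j| * (|A n i j + A n j i| *
              ((∫ ω, ξ n ω i ^ 2 ∂μ) * ∫ ω, ξ n ω j ^ 2 ∂μ)) := by
              rw [abs_mul, abs_mul, abs_of_nonneg (mul_nonneg hi hj), mul_assoc]
          _ ≤ _ := by
              gcongr
              · exact hK n i
              · exact hK n j
    _ ≤ ∑ _i : Fin n, C * (2 * C * (K * K)) := by
        refine Finset.sum_le_sum fun i _ => ?_
        rw [← Finset.sum_mul]
        gcongr
        exact (row_sum_le (A n) i).trans hA
    _ = n * (C * (2 * C * (K * K))) := by simp

end LLN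

/-! ### Errors with bounded fourth moments and their centered squares. -/

section Errors

variable {Ω : Type*} [MeasurableSpace Ω] {μ : Measure Ω} [IsProbabilityMeasure μ]
  {V : (n : ℕ) → Ω → Fin n → ℝ}

/-- The variances of the errors. -/
def errVar (μ : Measure Ω) (V : (n : ℕ) → Ω → Fin n → ℝ) (n : ℕ) (i : Fin n) : ℝ :=
  ∫ ω, V n ω i ^ 2 ∂μ

/-- Centered independent errors with uniformly bounded fourth moments. -/
structure FourthMoments (μ : Measure Ω) (V : (n : ℕ) → Ω → Fin n → ℝ) (K : ℝ) : Prop where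
  one_le : 1 ≤ K
  centered : ∀ n, IndepCentered μ (V n)
  integrable : ∀ n i, Integrable (fun ω => V n ω i ^ 4) μ
  bound : ∀ n i, ∫ ω, V n ω i ^ 4 ∂μ ≤ K

lemma HeteroskedasticErrors.exists_fourthMoments (hV : HeteroskedasticErrors μ V) :
    ∃ K, FourthMoments μ V K := by
  obtain ⟨hmeas, hind, hmean, δ, hδ, C, hC⟩ := hV
  -- The higher moment controls the fourth one: |x| ≤ 1 and |x| ≥ 1 are bounded by the two summands.
  have hpt : ∀ x : ℝ, x ^ 4 ≤ 1 + |x| ^ (4 + δ) := by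
    intro x
    have h4 : x ^ 4 = |x| ^ (4 : ℝ) := by
      rw [show (4 : ℝ) = ((4 : ℕ) : ℝ) by norm_num, Real.rpow_natCast]
      exact (Even.pow_abs (by decide) x).symm
    rw [h4]
    rcases le_total |x| 1 with hx | hx
    · have h1 := Real.rpow_le_one (abs_nonneg x) hx (show (0 : ℝ) ≤ 4 by norm_num)
      have h2 : 0 ≤ |x| ^ (4 + δ) := Real.rpow_nonneg (abs_nonneg x) _
      linarith
    · have h1 := Real.rpow_le_rpow_of_exponent_le hx (show (4 : ℝ) ≤ 4 + δ by linarith)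
      linarith
  have hint1 : ∀ n i, Integrable (fun ω => 1 + |V n ω i| ^ (4 + δ)) μ := fun n i =>
    (integrable_const 1).add (hC n i).1
  have hint4 : ∀ n i, Integrable (fun ω => V n ω i ^ 4) μ := fun n i =>
    (hint1 n i).mono' ((hmeas n i).pow_const 4).aestronglyMeasurable
      (Eventually.of_forall fun ω => by
        rw [Real.norm_of_nonneg (by positivity)]
        exact hpt _)
  have hint2 : ∀ n i, Integrable (fun ω => V n ω i ^ 2) μ := fun n i =>
    ((integrable_const 1).add (hint4 n i)).mono' ((hmeas n i).pow_const 2).aestronglyMeasurable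
      (Eventually.of_forall fun ω => by
        rw [Real.norm_of_nonneg (by positivity), Pi.add_apply]
        nlinarith [sq_nonneg (V n ω i ^ 2 - 1)])
  refine ⟨1 + |C|, le_add_of_nonneg_right (abs_nonneg C), fun n => ⟨hmeas n, hind n, hmean n,
    fun i => (memLp_two_iff_integrable_sq (hmeas n i).aestronglyMeasurable).2 (hint2 n i)⟩,
    hint4, fun n i => ?_⟩
  calc ∫ ω, V n ω i ^ 4 ∂μ ≤ ∫ ω, 1 + |V n ω i| ^ (4 + δ) ∂μ :=
        integral_mono (hint4 n i) (hint1 n i) fun ω => hpt _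
    _ = 1 + ∫ ω, |V n ω i| ^ (4 + δ) ∂μ := by
        rw [integral_add (integrable_const 1) (hC n i).1]; simp
    _ ≤ 1 + |C| := by linarith [(hC n i).2, le_abs_self C]

variable {K : ℝ}

lemma errVar_nonneg (n : ℕ) (i : Fin n) : 0 ≤ errVar μ V n i :=
  integral_nonneg fun _ => sq_nonneg _

lemma FourthMoments.errVar_le (h : FourthMoments μ V K) (n : ℕ) (i : Fin n) :
    errVar μ V n i ≤ 1 + K := by
  calc errVar μ V n i ≤ ∫ ω, 1 + V n ω i ^ 4 ∂μ :=
        integral_mono ((h.centered n).memLp i).integrable_sq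
          ((integrable_const 1).add (h.integrable n i)) fun ω => by
            change V n ω i ^ 2 ≤ 1 + V n ω i ^ 4
            nlinarith [sq_nonneg (V n ω i ^ 2 - 1)]
    _ = 1 + ∫ ω, V n ω i ^ 4 ∂μ := by
        rw [integral_add (integrable_const 1) (h.integrable n i)]; simp
    _ ≤ 1 + K := by linarith [h.bound n i]

lemma FourthMoments.norm_errVar_le (h : FourthMoments μ V K) (n : ℕ) :
    ‖errVar μ V n‖ ≤ 1 + K := by
  have h1 := h.one_le
  refine (pi_norm_le_iff_of_nonneg (by linarith)).2 fun i => ?_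
  rw [Real.norm_of_nonneg (errVar_nonneg n i)]
  exact h.errVar_le n i

/-- The centered squares of the errors. -/
def sqDev (μ : Measure Ω) (V : (n : ℕ) → Ω → Fin n → ℝ) (n : ℕ) (ω : Ω) (i : Fin n) : ℝ :=
  V n ω i ^ 2 - errVar μ V n i

lemma FourthMoments.memLp_sq (h : FourthMoments μ V K) (n : ℕ) (i : Fin n) :
    MemLp (fun ω => V n ω i ^ 2) 2 μ := by
  refine (memLp_two_iff_integrable_sq
    (((h.centered n).measurable i).pow_const 2).aestronglyMeasurable).2 ?_
  refine (h.integrable n i).congr (Eventually.of_forall fun ω => ?_)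
  simp only
  ring

lemma FourthMoments.centered_sqDev (h : FourthMoments μ V K) (n : ℕ) :
    IndepCentered μ (sqDev μ V n) where
  measurable i := (((h.centered n).measurable i).pow_const 2).sub_const _
  indep := (h.centered n).indep.comp (fun i x => x ^ 2 - errVar μ V n i)
    fun i => (measurable_id.pow_const 2).sub_const _
  mean i := by
    simp only [sqDev]
    rw [integral_sub ((h.centered n).memLp i).integrable_sq (integrable_const _)]
    simp [errVar]
  memLp i := (h.memLp_sq n i).sub (memLp_const _)

lemma FourthMoments.integral_sqDev_sq_le (h : FourthMoments μ V K) (n : ℕ) (i : Fin n) :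
    ∫ ω, sqDev μ V n ω i ^ 2 ∂μ ≤ K := by
  have h2 := ((h.centered n).memLp i).integrable_sq
  have h1 : ∀ ω, sqDev μ V n ω i ^ 2 =
      V n ω i ^ 4 - 2 * errVar μ V n i * V n ω i ^ 2 + errVar μ V n i ^ 2 := fun ω => by
    simp only [sqDev]; ring
  have e1 := integral_add ((h.integrable n i).sub (h2.const_mul (2 * errVar μ V n i)))
    (integrable_const (errVar μ V n i ^ 2))
  have e2 := integral_sub (h.integrable n i) (h2.const_mul (2 * errVar μ V n i))
  simp only [Pi.sub_apply] at e1 e2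
  simp only [h1]
  rw [e1, e2, integral_const_mul]
  have e3 : ∫ ω, V n ω i ^ 2 ∂μ = errVar μ V n i := rfl
  rw [e3]
  simp only [integral_const, probReal_univ, one_smul]
  nlinarith [h.bound n i, sq_nonneg (errVar μ V n i)]

lemma FourthMoments.tendsto_linear (h : FourthMoments μ V K) {w : ∀ n, Fin n → ℝ} {C : ℝ}
    (hw : ∀ᶠ n in atTop, ‖w n‖ ≤ C) :
    Tendsto (fun p : ℕ × Ω => (p.1 : ℝ)⁻¹ * (w p.1 ⬝ᵥ V p.1 p.2)) (probFilter μ) (𝓝 0) :=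
  MESS.tendsto_linear h.centered (by linarith [h.one_le]) h.errVar_le hw

lemma FourthMoments.tendsto_linear_sqDev (h : FourthMoments μ V K) {w : ∀ n, Fin n → ℝ} {C : ℝ}
    (hw : ∀ᶠ n in atTop, ‖w n‖ ≤ C) :
    Tendsto (fun p : ℕ × Ω => (p.1 : ℝ)⁻¹ * (w p.1 ⬝ᵥ sqDev μ V p.1 p.2))
      (probFilter μ) (𝓝 0) :=
  MESS.tendsto_linear h.centered_sqDev (by linarith [h.one_le]) h.integral_sqDev_sq_le hw

/-- The off-diagonal part is a zero-diagonal quadratic form in the errors; the diagonal part, after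
centering, is linear in `sqDev`. -/
lemma FourthMoments.tendsto_quadratic (h : FourthMoments μ V K)
    {A : ∀ n, Matrix (Fin n) (Fin n) ℝ} {C : ℝ} (hC : 0 ≤ C)
    (hA : ∀ᶠ n in atTop, sumNorm n (A n) ≤ C) :
    Tendsto (fun p : ℕ × Ω => (p.1 : ℝ)⁻¹ * (V p.1 p.2 ⬝ᵥ A p.1 *ᵥ V p.1 p.2) -
      (p.1 : ℝ)⁻¹ * ((A p.1).diag ⬝ᵥ errVar μ V p.1)) (probFilter μ) (𝓝 0) := by
  have h1 := tendsto_quadratic_of_diag_eq_zero h.centered (by linarith [h.one_le])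
    h.errVar_le (A := fun n => A n - Matrix.diagonal (A n).diag) hC
    (hA.mono fun n hn => (sumNorm_sub_diagonal_le _).trans hn) (fun n i => by simp)
  have h2 := h.tendsto_linear_sqDev (w := fun n => (A n).diag) (hA.mono fun n hn =>
    (pi_norm_le_iff_of_nonneg hC).2 fun i => (abs_entry_le (A n) i i).trans hn)
  have h3 := h1.add h2
  rw [add_zero] at h3
  refine h3.congr fun p => ?_
  have h4 : V p.1 p.2 ⬝ᵥ Matrix.diagonal (A p.1).diag *ᵥ V p.1 p.2 =
      (A p.1).diag ⬝ᵥ fun i => V p.1 p.2 i ^ 2 := by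
    simp only [dotProduct, Matrix.mulVec_diagonal]
    exact Finset.sum_congr rfl fun i _ => by ring
  have h5 : sqDev μ V p.1 p.2 = (fun i => V p.1 p.2 i ^ 2) - errVar μ V p.1 := rfl
  rw [Matrix.sub_mulVec, dotProduct_sub, h4, h5, dotProduct_sub]
  ring

lemma inv_mul_sum_le {n : ℕ} {w : Fin n → ℝ} {C : ℝ} (hC : 0 ≤ C) (hw : ∀ i, w i ≤ C) :
    (n : ℝ)⁻¹ * ∑ i, w i ≤ C := by
  calc (n : ℝ)⁻¹ * ∑ i, w i ≤ (n : ℝ)⁻¹ * ∑ _i : Fin n, C := by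
        gcongr with i
        exact hw i
    _ = ((n : ℝ)⁻¹ * n) * C := by simp; ring
    _ ≤ 1 * C := by gcongr; exact inv_mul_card_le_one n
    _ = C := one_mul C

/-- The average of the variances is at most 1 + K, and the average deviation from it is below 1 with
probability tending to one. -/
lemma FourthMoments.eventually_sum_sq_le (h : FourthMoments μ V K) :
    ∀ᶠ p : ℕ × Ω in probFilter μ, (p.1 : ℝ)⁻¹ * ∑ i, V p.1 p.2 i ^ 2 ≤ 2 + K := by
  have h1 := h.tendsto_linear_sqDev (w := fun n _ => 1)
    (Eventually.of_forall fun n => (pi_norm_le_iff_of_nonneg zero_le_one).2 fun i => by simp)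
  filter_upwards [(Metric.tendsto_nhds.1 h1) 1 one_pos] with p hp
  rw [dist_zero_right, Real.norm_eq_abs] at hp
  have h2 : (fun _ => (1 : ℝ)) ⬝ᵥ sqDev μ V p.1 p.2 =
      ∑ i, V p.1 p.2 i ^ 2 - ∑ i, errVar μ V p.1 i := by
    simp [dotProduct, sqDev, Finset.sum_sub_distrib]
  rw [h2, mul_sub] at hp
  have h3 := inv_mul_sum_le (by linarith [h.one_le]) (h.errVar_le p.1)
  linarith [(abs_lt.1 hp).2]

/-! ### Uniform laws of large numbers -/

variable {α : Type*} [PseudoMetricSpace α] {s : Set α}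

/-- The form is Lipschitz in the parameter with constant C n⁻¹ Σ |v_i|, which is at most C (3 + K)
with probability tending to one because |x| ≤ 1 + x². Pointwise convergence is then uniform. -/
lemma FourthMoments.tendstoUniformly_linear (h : FourthMoments μ V K) (hs : IsCompact s)
    {w : ∀ n, α → Fin n → ℝ} (hw : LipVec s w) :
    Tendsto (fun q : (ℕ × Ω) × α => (q.1.1 : ℝ)⁻¹ * (w q.1.1 q.2 ⬝ᵥ V q.1.1 q.1.2))
      (probFilter μ ×ˢ 𝓟 s) (𝓝 0) := by
  obtain ⟨C, hC, hw⟩ := hw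
  refine tendsto_prod_principal_of_lipschitz hs (fun x hx =>
    h.tendsto_linear (w := fun n => w n x) (hw.mono fun n hn => hn.1 x hx)) (L := C * (3 + K)) ?_
  filter_upwards [tendsto_fst_probFilter.eventually hw, h.eventually_sum_sq_le]
    with p hp hv x hx y hy
  have h1 : (p.1 : ℝ)⁻¹ * ∑ i, |V p.1 p.2 i| ≤ 3 + K := by
    calc (p.1 : ℝ)⁻¹ * ∑ i, |V p.1 p.2 i| ≤ (p.1 : ℝ)⁻¹ * ∑ i, (1 + V p.1 p.2 i ^ 2) := by
          gcongr with i
          rw [← sq_abs]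
          nlinarith [sq_nonneg (|V p.1 p.2 i| - 1)]
      _ = (p.1 : ℝ)⁻¹ * ∑ _i : Fin p.1, (1 : ℝ) + (p.1 : ℝ)⁻¹ * ∑ i, V p.1 p.2 i ^ 2 := by
          rw [Finset.sum_add_distrib, mul_add]
      _ ≤ 1 + (2 + K) := add_le_add (inv_mul_sum_le zero_le_one fun _ => le_rfl) hv
      _ = 3 + K := by ring
  have h2 : ‖w p.1 x - w p.1 y‖ ≤ C * dist x y := hp.2 x hx y hy
  rw [← mul_sub, ← sub_dotProduct, abs_mul, abs_of_nonneg (by positivity)]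
  calc (p.1 : ℝ)⁻¹ * |(w p.1 x - w p.1 y) ⬝ᵥ V p.1 p.2|
      ≤ (p.1 : ℝ)⁻¹ * (‖w p.1 x - w p.1 y‖ * ∑ i, |V p.1 p.2 i|) := by
        gcongr; exact abs_dotProduct_le _ _
    _ = ‖w p.1 x - w p.1 y‖ * ((p.1 : ℝ)⁻¹ * ∑ i, |V p.1 p.2 i|) := by ring
    _ ≤ C * dist x y * (3 + K) := by gcongr
    _ = _ := by ring

lemma FourthMoments.tendstoUniformly_quadratic (h : FourthMoments μ V K) (hs : IsCompact s)
    {A : ∀ n, α → Matrix (Fin n) (Fin n) ℝ} (hA : LipMat s A) :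
    Tendsto (fun q : (ℕ × Ω) × α =>
      (q.1.1 : ℝ)⁻¹ * (V q.1.1 q.1.2 ⬝ᵥ A q.1.1 q.2 *ᵥ V q.1.1 q.1.2) -
      (q.1.1 : ℝ)⁻¹ * ((A q.1.1 q.2).diag ⬝ᵥ errVar μ V q.1.1))
      (probFilter μ ×ˢ 𝓟 s) (𝓝 0) := by
  obtain ⟨C, hC, hA⟩ := hA
  refine tendsto_prod_principal_of_lipschitz hs (fun x hx =>
    h.tendsto_quadratic (A := fun n => A n x) hC (hA.mono fun n hn => hn.1 x hx)) (L := C * (2 + K) + C * (1 + K)) ?_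
  filter_upwards [tendsto_fst_probFilter.eventually hA, h.eventually_sum_sq_le]
    with p hp hv x hx y hy
  have hK := h.one_le
  have h2 : sumNorm p.1 (A p.1 x - A p.1 y) ≤ C * dist x y := hp.2 x hx y hy
  set D := A p.1 x - A p.1 y with hD
  have e1 : (p.1 : ℝ)⁻¹ * (V p.1 p.2 ⬝ᵥ A p.1 x *ᵥ V p.1 p.2) -
      (p.1 : ℝ)⁻¹ * ((A p.1 x).diag ⬝ᵥ errVar μ V p.1) -
      ((p.1 : ℝ)⁻¹ * (V p.1 p.2 ⬝ᵥ A p.1 y *ᵥ V p.1 p.2) -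
      (p.1 : ℝ)⁻¹ * ((A p.1 y).diag ⬝ᵥ errVar μ V p.1)) =
      (p.1 : ℝ)⁻¹ * (V p.1 p.2 ⬝ᵥ D *ᵥ V p.1 p.2) -
      (p.1 : ℝ)⁻¹ * (D.diag ⬝ᵥ errVar μ V p.1) := by
    rw [hD, Matrix.sub_mulVec, dotProduct_sub, Matrix.diag_sub, sub_dotProduct]
    ring
  have e2 : |(p.1 : ℝ)⁻¹ * (V p.1 p.2 ⬝ᵥ D *ᵥ V p.1 p.2)| ≤ C * dist x y * (2 + K) := by
    rw [abs_mul, abs_of_nonneg (by positivity)]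
    calc (p.1 : ℝ)⁻¹ * |V p.1 p.2 ⬝ᵥ D *ᵥ V p.1 p.2|
        ≤ (p.1 : ℝ)⁻¹ * (sumNorm p.1 D * ∑ i, V p.1 p.2 i ^ 2) := by
          gcongr; exact abs_dotProduct_mulVec_self_le _ _
      _ = sumNorm p.1 D * ((p.1 : ℝ)⁻¹ * ∑ i, V p.1 p.2 i ^ 2) := by ring
      _ ≤ _ := by gcongr
  have e3 : |(p.1 : ℝ)⁻¹ * (D.diag ⬝ᵥ errVar μ V p.1)| ≤ C * dist x y * (1 + K) := by
    refine (abs_inv_mul_dotProduct_le _ _).trans (mul_le_mul ?_ (h.norm_errVar_le _)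
      (norm_nonneg _) (by positivity))
    exact (pi_norm_le_iff_of_nonneg (by positivity)).2 fun i =>
      (abs_entry_le D i i).trans h2
  rw [e1]
  calc _ ≤ _ := abs_sub _ _
    _ ≤ C * dist x y * (2 + K) + C * dist x y * (1 + K) := add_le_add e2 e3
    _ = _ := by ring

lemma LipReal.tendsto_mul_zero {r : ℕ → α → ℝ} (hr : LipReal s r) {e : (ℕ × Ω) × α → ℝ}
    (he : Tendsto e (probFilter μ ×ˢ 𝓟 s) (𝓝 0)) :
    Tendsto (fun q => r q.1.1 q.2 * e q) (probFilter μ ×ˢ 𝓟 s) (𝓝 0) := by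
  obtain ⟨C, hC, hr⟩ := hr
  have h1 : ∀ᶠ q : (ℕ × Ω) × α in probFilter μ ×ˢ 𝓟 s, |r q.1.1 q.2| ≤ C := by
    rw [eventually_prod_principal_iff]
    filter_upwards [tendsto_fst_probFilter.eventually hr] with p hp x hx
    exact hp.1 x hx
  refine bdd_le_mul_tendsto_zero' C h1 he

end Errors

/-! ### The families of matrices and vectors of the model -/

section Families

variable {k : ℕ} {c : ℝ} {W M : (n : ℕ) → Matrix (Fin n) (Fin n) ℝ}
  {X : (n : ℕ) → Matrix (Fin n) (Fin k) ℝ}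

lemma isCompact_paramSpace (c : ℝ) : IsCompact (paramSpace c) := isCompact_Icc.prod isCompact_Icc

lemma lipMat_exp_fst (hW : UniformlyBoundedSums W) :
    LipMat (paramSpace c) (fun n (ζ : ℝ × ℝ) => NormedSpace.exp (ζ.1 • W n)) :=
  hW.lipMat_exp (fun _ hζ => abs_le.2 hζ.1) fun x y => by
    rw [Prod.dist_eq]; exact le_max_left _ _

lemma lipMat_exp_snd (hM : UniformlyBoundedSums M) :
    LipMat (paramSpace c) (fun n (ζ : ℝ × ℝ) => NormedSpace.exp (ζ.2 • M n)) :=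
  hM.lipMat_exp (fun _ hζ => abs_le.2 hζ.2) fun x y => by
    rw [Prod.dist_eq]; exact le_max_right _ _

lemma lipMat_exp_neg_snd (hM : UniformlyBoundedSums M) :
    LipMat (paramSpace c) (fun n (ζ : ℝ × ℝ) => NormedSpace.exp ((-ζ.2) • M n)) :=
  hM.lipMat_exp (fun _ hζ => by rw [abs_neg]; exact abs_le.2 hζ.2) fun x y => by
    rw [Prod.dist_eq, neg_sub_neg, abs_sub_comm]; exact le_max_right _ _

lemma lipMat_exp_const (hM : UniformlyBoundedSums M) (t : ℝ) :
    LipMat (paramSpace c) (fun n (_ : ℝ × ℝ) => NormedSpace.exp (t • M n)) :=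
  hM.lipMat_exp (c := |t|) (fun _ _ => le_rfl) fun x y => by simp

lemma lipMat_noiseMat (hW : UniformlyBoundedSums W) (hM : UniformlyBoundedSums M)
    (lam₀ ρ₀ : ℝ) : LipMat (paramSpace c) (fun n ζ => noiseMat (W n) (M n) lam₀ ρ₀ ζ) :=
  (((lipMat_exp_snd hM).mul (lipMat_exp_fst hW)).mul (lipMat_exp_const hW _)).mul
    (lipMat_exp_const hM _)

lemma lipMat_twistedD (hW : UniformlyBoundedSums W) (hM : UniformlyBoundedSums M) :
    LipMat (paramSpace c) (fun n (ζ : ℝ × ℝ) => twistedD (W n) (M n) ζ.2) := by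
  refine UnifLip.congr (((lipMat_exp_snd hM).mul hW.lipMat).mul
    (lipMat_exp_neg_snd hM)).sub_diagonal (Eventually.of_forall fun n ζ _ => ?_)
  rw [twistedD, twisted, neg_smul]

lemma lipVec_col (hX : ∃ C : ℝ, ∀ n i a, |X n i a| ≤ C) (a : Fin k) :
    LipVec (paramSpace c) (fun n _ i => X n i a) := by
  obtain ⟨C, hC⟩ := hX
  exact UnifLip.const (C := |C|) (Eventually.of_forall fun n =>
    (pi_norm_le_iff_of_nonneg (abs_nonneg C)).2 fun i => (hC n i a).trans (le_abs_self C))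

lemma lipVec_regr (hM : UniformlyBoundedSums M) (hX : ∃ C : ℝ, ∀ n i a, |X n i a| ≤ C)
    (a : Fin k) : LipVec (paramSpace c) (fun n ζ => regr (M n) (X n) ζ.2 a) :=
  (lipMat_exp_snd hM).mulVec (lipVec_col hX a)

lemma lipVec_meanVec (hW : UniformlyBoundedSums W) (hM : UniformlyBoundedSums M)
    (hX : ∃ C : ℝ, ∀ n i a, |X n i a| ≤ C) (β₀ : Fin k → ℝ) (lam₀ : ℝ) :
    LipVec (paramSpace c) (fun n ζ => meanVec (W n) (M n) (X n) β₀ lam₀ ζ) := by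
  have h : LipVec (paramSpace c) (fun n _ => X n *ᵥ β₀) := by
    refine UnifLip.congr (UnifLip.sum Finset.univ fun a _ =>
      LipVec.smul (LipReal.const (β₀ a)) (lipVec_col hX a)) (Eventually.of_forall fun n ζ _ => ?_)
    ext i
    simp [Matrix.mulVec, dotProduct, mul_comm]
  exact (((lipMat_exp_snd hM).mul (lipMat_exp_fst hW)).mul (lipMat_exp_const hW _)).mulVec h

lemma lipReal_gram (hM : UniformlyBoundedSums M) (hX : ∃ C : ℝ, ∀ n i a, |X n i a| ≤ C)
    (a b : Fin k) : LipReal (paramSpace c) (fun n ζ => gram (M n) (X n) ζ.2 a b) :=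
  UnifLip.congr ((lipVec_regr hM hX a).inv_mul_dotProduct (lipVec_regr hM hX b))
    (Eventually.of_forall fun _ _ _ => (gram_apply _ _ _).symm)

/-- The determinant of the limit inherits the Lipschitz bound, so it is continuous and, being
nonzero, bounded away from zero on the compact parameter space. Uniform convergence passes half of
this bound on to the Gram matrices. -/
lemma exists_le_abs_det_gram (hM : UniformlyBoundedSums M) (hX : RegularRegressors c M X) :
    ∃ η : ℝ, 0 < η ∧ ∀ᶠ n in atTop, ∀ ζ ∈ paramSpace c, η ≤ |(gram (M n) (X n) ζ.2).det| := by
  obtain ⟨hbd, -, H, hH, hdet⟩ := hX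
  have hpt : ∀ ζ ∈ paramSpace c,
      Tendsto (fun n => (gram (M n) (X n) ζ.2).det) atTop (𝓝 (H ζ.2).det) := by
    intro ζ hζ
    have h1 : Tendsto (fun n => gram (M n) (X n) ζ.2) atTop (𝓝 (H ζ.2)) :=
      tendsto_pi_nhds.2 fun a => tendsto_pi_nhds.2 fun b => (hH a b).tendsto_at hζ.2
    exact ((continuous_id.matrix_det).tendsto (H ζ.2)).comp h1
  obtain ⟨C, hC, hlip⟩ := LipReal.det (lipReal_gram (c := c) hM hbd)
  have hlip' : ∀ ζ ∈ paramSpace c, ∀ ζ' ∈ paramSpace c,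
      |(H ζ.2).det - (H ζ'.2).det| ≤ C * dist ζ ζ' := by
    intro ζ hζ ζ' hζ'
    refine le_of_tendsto ((hpt ζ hζ).sub (hpt ζ' hζ')).abs ?_
    filter_upwards [hlip] with n hn
    exact hn.2 ζ hζ ζ' hζ'
  have hcont : ContinuousOn (fun ζ : ℝ × ℝ => |(H ζ.2).det|) (paramSpace c) := by
    refine ContinuousOn.abs (LipschitzOnWith.continuousOn (K := C.toNNReal) ?_)
    refine LipschitzOnWith.of_dist_le_mul fun ζ hζ ζ' hζ' => ?_
    rw [Real.coe_toNNReal C hC]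
    exact hlip' ζ hζ ζ' hζ'
  obtain ⟨η, hη, hle⟩ := (isCompact_paramSpace c).exists_forall_le' hcont (a := 0)
    fun ζ hζ => abs_pos.2 (hdet ζ.2 hζ.2).ne_zero
  have hunif : Tendsto (fun p : ℕ × (ℝ × ℝ) => (gram (M p.1) (X p.1) p.2.2).det - (H p.2.2).det)
      (atTop ×ˢ 𝓟 (paramSpace c)) (𝓝 0) := by
    refine tendsto_prod_principal_of_lipschitz (isCompact_paramSpace c) (fun ζ hζ => ?_)
      (L := C + C) ?_
    · simpa using (hpt ζ hζ).sub_const (H ζ.2).det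
    · filter_upwards [hlip] with n hn ζ hζ ζ' hζ'
      have e1 : |(gram (M n) (X n) ζ.2).det - (gram (M n) (X n) ζ'.2).det| ≤ C * dist ζ ζ' :=
        hn.2 ζ hζ ζ' hζ'
      have e2 := hlip' ζ hζ ζ' hζ'
      rw [sub_sub_sub_comm]
      exact (abs_sub _ _).trans (by linarith)
  refine ⟨η / 2, half_pos hη, ?_⟩
  have h3 := (Metric.tendsto_nhds.1 hunif) (η / 2) (half_pos hη)
  rw [eventually_prod_principal_iff] at h3
  filter_upwards [h3] with n hn ζ hζ
  have h4 := hn ζ hζ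
  rw [dist_zero_right, Real.norm_eq_abs, abs_sub_comm] at h4
  have h5 := abs_sub_abs_le_abs_sub (H ζ.2).det (gram (M n) (X n) ζ.2).det
  linarith [hle ζ hζ]

lemma eventually_isUnit_det_gram (hM : UniformlyBoundedSums M) (hX : RegularRegressors c M X) :
    ∀ᶠ n in atTop, ∀ ζ ∈ paramSpace c, IsUnit (gram (M n) (X n) ζ.2).det := by
  obtain ⟨η, hη, h⟩ := exists_le_abs_det_gram hM hX
  filter_upwards [h] with n hn ζ hζ
  exact isUnit_iff_ne_zero.2 (abs_pos.1 (hη.trans_le (hn ζ hζ)))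

lemma lipReal_gram_inv (hM : UniformlyBoundedSums M) (hX : RegularRegressors c M X)
    (a b : Fin k) : LipReal (paramSpace c) (fun n ζ => (gram (M n) (X n) ζ.2)⁻¹ a b) := by
  obtain ⟨η, hη, h⟩ := exists_le_abs_det_gram hM hX
  exact LipReal.inv_apply (lipReal_gram hM hX.1) hη h a b

lemma lipReal_projCoef (hM : UniformlyBoundedSums M) (hX : RegularRegressors c M X)
    {z : ∀ n, ℝ × ℝ → Fin n → ℝ} (hz : LipVec (paramSpace c) z) (a : Fin k) :
    LipReal (paramSpace c) (fun n ζ => projCoef (M n) (X n) ζ.2 (z n ζ) a) :=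
  UnifLip.sum Finset.univ fun b _ => (lipReal_gram_inv hM hX a b).mul
    ((lipVec_regr hM hX.1 b).inv_mul_dotProduct hz)

lemma lipVec_regrComb (hM : UniformlyBoundedSums M) (hX : ∃ C : ℝ, ∀ n i a, |X n i a| ≤ C)
    {r : ℕ → ℝ × ℝ → Fin k → ℝ} (hr : ∀ a, LipReal (paramSpace c) (fun n ζ => r n ζ a)) :
    LipVec (paramSpace c) (fun n ζ => regrComb (M n) (X n) ζ.2 (r n ζ)) :=
  UnifLip.sum Finset.univ fun a _ => LipVec.smul (hr a) (lipVec_regr hM hX a)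

end Families

/-! ### Uniform convergence of the concentrated score -/

section Score

variable {Ω : Type*} [MeasurableSpace Ω] {μ : Measure Ω} [IsProbabilityMeasure μ]
  {V : (n : ℕ) → Ω → Fin n → ℝ} {K : ℝ}

lemma sum_smul_dotProduct_mulVec {n k : ℕ} (A : Matrix (Fin n) (Fin n) ℝ) (e : Fin k → ℝ)
    (x : Fin k → Fin n → ℝ) (z : Fin n → ℝ) :
    (∑ a, e a • x a) ⬝ᵥ A *ᵥ z = ∑ a, e a * (x a ⬝ᵥ A *ᵥ z) := by
  simp only [sum_dotProduct, smul_dotProduct, smul_eq_mul]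

lemma dotProduct_mulVec_sum_smul {n k : ℕ} (A : Matrix (Fin n) (Fin n) ℝ) (e : Fin k → ℝ)
    (x : Fin k → Fin n → ℝ) (z : Fin n → ℝ) :
    z ⬝ᵥ A *ᵥ (∑ a, e a • x a) = ∑ a, e a * (z ⬝ᵥ A *ᵥ x a) := by
  simp only [Matrix.mulVec_sum, Matrix.mulVec_smul, dotProduct_sum, dotProduct_smul, smul_eq_mul]

lemma mulVec_dotProduct_mulVec {n : ℕ} (N A : Matrix (Fin n) (Fin n) ℝ) (v z : Fin n → ℝ) :
    (N *ᵥ v) ⬝ᵥ A *ᵥ z = (Nᵀ *ᵥ (A *ᵥ z)) ⬝ᵥ v := by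
  rw [dotProduct_comm, Matrix.dotProduct_mulVec, ← Matrix.mulVec_transpose]

lemma dotProduct_mulVec_mulVec {n : ℕ} (N A : Matrix (Fin n) (Fin n) ℝ) (v z : Fin n → ℝ) :
    z ⬝ᵥ A *ᵥ (N *ᵥ v) = (Nᵀ *ᵥ (Aᵀ *ᵥ z)) ⬝ᵥ v := by
  rw [Matrix.dotProduct_mulVec, Matrix.dotProduct_mulVec, ← Matrix.mulVec_transpose,
    ← Matrix.mulVec_transpose]

lemma mulVec_dotProduct_mulVec_mulVec {n : ℕ} (N A : Matrix (Fin n) (Fin n) ℝ)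
    (v : Fin n → ℝ) :
    (N *ᵥ v) ⬝ᵥ A *ᵥ (N *ᵥ v) = v ⬝ᵥ (Nᵀ * A * N) *ᵥ v := by
  rw [mulVec_dotProduct_mulVec, dotProduct_comm, Matrix.mulVec_mulVec, Matrix.mulVec_mulVec]

variable {α : Type*} [PseudoMetricSpace α] {s : Set α}

/-- Common form of both concentrated score components, where `e` and `f` are the vanishing random
coefficients of the regressors. Apart from P'AQ, the terms free of `e` and `f` are linear or
quadratic in the errors. Every other term is a vanishing coefficient times averages that are bounded
or vanish. -/
lemma FourthMoments.tendstoUniformly_perturbed {k : ℕ} (h : FourthMoments μ V K)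
    (hs : IsCompact s) {N A : ∀ n, α → Matrix (Fin n) (Fin n) ℝ} (hN : LipMat s N)
    (hA : LipMat s A) {P Q : ∀ n, α → Fin n → ℝ} (hP : LipVec s P) (hQ : LipVec s Q)
    {x : Fin k → ∀ n, α → Fin n → ℝ} (hx : ∀ a, LipVec s (x a))
    {e f : (ℕ × Ω) × α → Fin k → ℝ}
    (he : ∀ a, Tendsto (fun q => e q a) (probFilter μ ×ˢ 𝓟 s) (𝓝 0))
    (hf : ∀ a, Tendsto (fun q => f q a) (probFilter μ ×ˢ 𝓟 s) (𝓝 0)) :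
    Tendsto (fun q : (ℕ × Ω) × α => (q.1.1 : ℝ)⁻¹ *
      ((P q.1.1 q.2 + N q.1.1 q.2 *ᵥ V q.1.1 q.1.2 - ∑ a, e q a • x a q.1.1 q.2) ⬝ᵥ
        A q.1.1 q.2 *ᵥ
        (Q q.1.1 q.2 + N q.1.1 q.2 *ᵥ V q.1.1 q.1.2 - ∑ a, f q a • x a q.1.1 q.2)) -
      (q.1.1 : ℝ)⁻¹ * (P q.1.1 q.2 ⬝ᵥ A q.1.1 q.2 *ᵥ Q q.1.1 q.2 +
        ((N q.1.1 q.2)ᵀ * A q.1.1 q.2 * N q.1.1 q.2).diag ⬝ᵥ errVar μ V q.1.1))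
      (probFilter μ ×ˢ 𝓟 s) (𝓝 0) := by
  have lin1 : ∀ {u : ∀ n, α → Fin n → ℝ}, LipVec s u →
      Tendsto (fun q : (ℕ × Ω) × α => (q.1.1 : ℝ)⁻¹ *
        (u q.1.1 q.2 ⬝ᵥ A q.1.1 q.2 *ᵥ (N q.1.1 q.2 *ᵥ V q.1.1 q.1.2)))
        (probFilter μ ×ˢ 𝓟 s) (𝓝 0) := by
    intro u hu
    simp only [dotProduct_mulVec_mulVec]
    exact h.tendstoUniformly_linear hs
      (w := fun n y => (N n y)ᵀ *ᵥ ((A n y)ᵀ *ᵥ u n y)) (hN.transpose.mulVec (hA.transpose.mulVec hu))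
  have lin2 : ∀ {u : ∀ n, α → Fin n → ℝ}, LipVec s u →
      Tendsto (fun q : (ℕ × Ω) × α => (q.1.1 : ℝ)⁻¹ *
        ((N q.1.1 q.2 *ᵥ V q.1.1 q.1.2) ⬝ᵥ A q.1.1 q.2 *ᵥ u q.1.1 q.2))
        (probFilter μ ×ˢ 𝓟 s) (𝓝 0) := by
    intro u hu
    simp only [mulVec_dotProduct_mulVec]
    exact h.tendstoUniformly_linear hs
      (w := fun n y => (N n y)ᵀ *ᵥ (A n y *ᵥ u n y)) (hN.transpose.mulVec (hA.mulVec hu))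
  have bil : ∀ {u z : ∀ n, α → Fin n → ℝ}, LipVec s u → LipVec s z →
      LipReal s (fun n y => (n : ℝ)⁻¹ * (u n y ⬝ᵥ A n y *ᵥ z n y)) := fun hu hz =>
    hu.inv_mul_dotProduct (hA.mulVec hz)
  have cross1 : ∀ a, Tendsto (fun q : (ℕ × Ω) × α => e q a * ((q.1.1 : ℝ)⁻¹ *
      (x a q.1.1 q.2 ⬝ᵥ A q.1.1 q.2 *ᵥ (Q q.1.1 q.2 + N q.1.1 q.2 *ᵥ V q.1.1 q.1.2))))
      (probFilter μ ×ˢ 𝓟 s) (𝓝 0) := by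
    intro a
    have h1 := ((bil (hx a) hQ).tendsto_mul_zero (he a)).add ((he a).mul (lin1 (hx a)))
    rw [mul_zero, add_zero] at h1
    refine h1.congr fun q => ?_
    rw [Matrix.mulVec_add, dotProduct_add]
    ring
  have cross2 : ∀ a, Tendsto (fun q : (ℕ × Ω) × α => f q a * ((q.1.1 : ℝ)⁻¹ *
      ((P q.1.1 q.2 + N q.1.1 q.2 *ᵥ V q.1.1 q.1.2) ⬝ᵥ A q.1.1 q.2 *ᵥ x a q.1.1 q.2)))
      (probFilter μ ×ˢ 𝓟 s) (𝓝 0) := by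
    intro a
    have h1 := ((bil hP (hx a)).tendsto_mul_zero (hf a)).add ((hf a).mul (lin2 (hx a)))
    rw [mul_zero, add_zero] at h1
    refine h1.congr fun q => ?_
    rw [add_dotProduct]
    ring
  have cross3 : ∀ a b, Tendsto (fun q : (ℕ × Ω) × α => e q a * ((q.1.1 : ℝ)⁻¹ *
      (x a q.1.1 q.2 ⬝ᵥ A q.1.1 q.2 *ᵥ x b q.1.1 q.2) * f q b))
      (probFilter μ ×ˢ 𝓟 s) (𝓝 0) := by
    intro a b
    have h1 := (he a).mul ((bil (hx a) (hx b)).tendsto_mul_zero (hf b))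
    rwa [mul_zero] at h1
  have quad := h.tendstoUniformly_quadratic hs
    (A := fun n y => (N n y)ᵀ * A n y * N n y) ((hN.transpose.mul hA).mul hN)
  have s1 := tendsto_finsetSum Finset.univ fun a _ => cross1 a
  have s2 := tendsto_finsetSum Finset.univ fun a _ => cross2 a
  have s3 := tendsto_finsetSum Finset.univ fun a _ =>
    tendsto_finsetSum Finset.univ fun b _ => cross3 a b
  have hall := (((((lin1 hP).add (lin2 hQ)).add quad).sub s1).sub s2).add s3
  simp only [Finset.sum_const_zero, add_zero, sub_zero] at hall
  refine hall.congr fun q => ?_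
  rw [← mulVec_dotProduct_mulVec_mulVec]
  set y := N q.1.1 q.2 *ᵥ V q.1.1 q.1.2
  set A' := A q.1.1 q.2
  set p := P q.1.1 q.2
  set z := Q q.1.1 q.2
  have t1 : ∑ a, e q a * ((q.1.1 : ℝ)⁻¹ * (x a q.1.1 q.2 ⬝ᵥ A' *ᵥ (z + y))) =
      (q.1.1 : ℝ)⁻¹ * ((∑ a, e q a • x a q.1.1 q.2) ⬝ᵥ A' *ᵥ (z + y)) := by
    rw [sum_smul_dotProduct_mulVec, Finset.mul_sum]
    exact Finset.sum_congr rfl fun a _ => by ring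
  have t2 : ∑ a, f q a * ((q.1.1 : ℝ)⁻¹ * ((p + y) ⬝ᵥ A' *ᵥ x a q.1.1 q.2)) =
      (q.1.1 : ℝ)⁻¹ * ((p + y) ⬝ᵥ A' *ᵥ (∑ a, f q a • x a q.1.1 q.2)) := by
    rw [dotProduct_mulVec_sum_smul, Finset.mul_sum]
    exact Finset.sum_congr rfl fun a _ => by ring
  have t3 : ∑ a, ∑ b, e q a * ((q.1.1 : ℝ)⁻¹ *
      (x a q.1.1 q.2 ⬝ᵥ A' *ᵥ x b q.1.1 q.2) * f q b) =
      (q.1.1 : ℝ)⁻¹ * ((∑ a, e q a • x a q.1.1 q.2) ⬝ᵥ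
        A' *ᵥ (∑ a, f q a • x a q.1.1 q.2)) := by
    rw [sum_smul_dotProduct_mulVec, Finset.mul_sum]
    refine Finset.sum_congr rfl fun a _ => ?_
    rw [dotProduct_mulVec_sum_smul, Finset.mul_sum, Finset.mul_sum]
    exact Finset.sum_congr rfl fun b _ => by ring
  rw [t1, t2, t3]
  simp only [Matrix.mulVec_add, Matrix.mulVec_sub, dotProduct_add, add_dotProduct,
    dotProduct_sub, sub_dotProduct]
  ring

/-- The expectation of the product in `FourthMoments.tendstoUniformly_perturbed` without `e` and
`f`; it identifies the centering there with the population score. -/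
lemma IndepCentered.integral_perturbed {n : ℕ} {v : Ω → Fin n → ℝ} (hv : IndepCentered μ v)
    (N A : Matrix (Fin n) (Fin n) ℝ) (p z : Fin n → ℝ) :
    ∫ ω, (p + N *ᵥ v ω) ⬝ᵥ A *ᵥ (z + N *ᵥ v ω) ∂μ =
      p ⬝ᵥ A *ᵥ z + (Nᵀ * A * N).diag ⬝ᵥ fun i => ∫ ω, v ω i ^ 2 ∂μ := by
  have h1 : ∀ ω, (p + N *ᵥ v ω) ⬝ᵥ A *ᵥ (z + N *ᵥ v ω) =
      (p ⬝ᵥ A *ᵥ z + (Nᵀ *ᵥ (Aᵀ *ᵥ p) + Nᵀ *ᵥ (A *ᵥ z)) ⬝ᵥ v ω) +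
        v ω ⬝ᵥ (Nᵀ * A * N) *ᵥ v ω := by
    intro ω
    rw [← mulVec_dotProduct_mulVec_mulVec, add_dotProduct (Nᵀ *ᵥ _), ← dotProduct_mulVec_mulVec,
      ← mulVec_dotProduct_mulVec]
    simp only [Matrix.mulVec_add, dotProduct_add, add_dotProduct]
    ring
  simp only [h1]
  have i1 := (hv.memLp_dotProduct (Nᵀ *ᵥ (Aᵀ *ᵥ p) + Nᵀ *ᵥ (A *ᵥ z))).integrable (by norm_num)
  have e1 := integral_add ((integrable_const (p ⬝ᵥ A *ᵥ z)).add i1)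
    (hv.integrable_quadratic (Nᵀ * A * N))
  have e2 := integral_add (integrable_const (μ := μ) (p ⬝ᵥ A *ᵥ z)) i1
  simp only [Pi.add_apply] at e1 e2
  rw [e1, e2, hv.integral_dotProduct, hv.integral_quadratic]
  simp [dotProduct]

end Score

/-! ### Convergence in probability of vectors and matrices of growing dimension -/

section ConvInProb

variable {Ω : Type*} [MeasurableSpace Ω] {μ : Measure Ω}

/-- The random elements `f` approach the bounded sequence `f₀` in probability, with respect to the
seminorms `N n`. -/
def ConvInProb {E : ℕ → Type*} [∀ n, AddCommGroup (E n)] (N : ∀ n, AddGroupSeminorm (E n))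
    (μ : Measure Ω) (f : ∀ p : ℕ × Ω, E p.1) (f₀ : ∀ n, E n) : Prop :=
  Tendsto (fun p : ℕ × Ω => N p.1 (f p - f₀ p.1)) (probFilter μ) (𝓝 0) ∧
    ∃ C : ℝ, 0 ≤ C ∧ ∀ᶠ n in atTop, N n (f₀ n) ≤ C

variable {E F G : ℕ → Type*} [∀ n, AddCommGroup (E n)] [∀ n, AddCommGroup (F n)]
  [∀ n, AddCommGroup (G n)] {N : ∀ n, AddGroupSeminorm (E n)} {N' : ∀ n, AddGroupSeminorm (F n)}
  {N'' : ∀ n, AddGroupSeminorm (G n)}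

lemma ConvInProb.congr {f g : ∀ p : ℕ × Ω, E p.1} {f₀ g₀ : ∀ n, E n}
    (hf : ConvInProb N μ f f₀) (h : ∀ᶠ p in probFilter μ, f p = g p)
    (h₀ : ∀ᶠ n in atTop, f₀ n = g₀ n) : ConvInProb N μ g g₀ := by
  obtain ⟨h1, C, hC, h2⟩ := hf
  refine ⟨h1.congr' ?_, C, hC, ?_⟩
  · filter_upwards [h, tendsto_fst_probFilter.eventually h₀] with p hp hp₀
    rw [hp, hp₀]
  · filter_upwards [h₀, h2] with n hn hC
    rwa [← hn]

lemma ConvInProb.linear {f : ∀ p : ℕ × Ω, E p.1} {f₀ : ∀ n, E n} (hf : ConvInProb N μ f f₀)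
    (L : ∀ n, E n → F n) (hsub : ∀ n x y, L n x - L n y = L n (x - y))
    (hL : ∀ n x, N' n (L n x) ≤ N n x) :
    ConvInProb N' μ (fun p => L p.1 (f p)) (fun n => L n (f₀ n)) := by
  obtain ⟨h1, C, hC, h2⟩ := hf
  refine ⟨squeeze_zero (fun _ => apply_nonneg _ _) (fun p => ?_) h1, C, hC,
    h2.mono fun n hn => (hL n _).trans hn⟩
  rw [hsub]
  exact hL _ _

lemma ConvInProb.add {f g : ∀ p : ℕ × Ω, E p.1} {f₀ g₀ : ∀ n, E n}
    (hf : ConvInProb N μ f f₀) (hg : ConvInProb N μ g g₀) :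
    ConvInProb N μ (fun p => f p + g p) (fun n => f₀ n + g₀ n) := by
  obtain ⟨h1, C, hC, h2⟩ := hf
  obtain ⟨h3, D, hD, h4⟩ := hg
  have h5 := h1.add h3
  rw [add_zero] at h5
  refine ⟨squeeze_zero (fun _ => apply_nonneg _ _) (fun p => ?_) h5, C + D, add_nonneg hC hD, ?_⟩
  · rw [add_sub_add_comm]
    exact map_add_le_add _ _ _
  · filter_upwards [h2, h4] with n hn hn'
    exact (map_add_le_add _ _ _).trans (add_le_add hn hn')

lemma ConvInProb.neg {f : ∀ p : ℕ × Ω, E p.1} {f₀ : ∀ n, E n} (hf : ConvInProb N μ f f₀) :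
    ConvInProb N μ (fun p => -f p) (fun n => -f₀ n) :=
  hf.linear (fun _ x => -x) (fun _ _ _ => by abel) fun n x => (map_neg_eq_map (N n) x).le

lemma ConvInProb.const {f₀ : ∀ n, E n} {C : ℝ} (hC : 0 ≤ C)
    (h : ∀ᶠ n in atTop, N n (f₀ n) ≤ C) : ConvInProb N μ (fun p => f₀ p.1) f₀ := by
  refine ⟨?_, C, hC, h⟩
  simp only [sub_self, map_zero]
  exact tendsto_const_nhds

lemma ConvInProb.zero : ConvInProb N μ (fun _ => 0) (fun _ => 0) :=
  ConvInProb.const (f₀ := fun n => (0 : E n)) le_rfl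
    (Eventually.of_forall fun n => (map_zero (N n)).le)

lemma ConvInProb.sum {ι : Type*} (t : Finset ι) {f : ι → ∀ p : ℕ × Ω, E p.1}
    {f₀ : ι → ∀ n, E n} (hf : ∀ i ∈ t, ConvInProb N μ (f i) (f₀ i)) :
    ConvInProb N μ (fun p => ∑ i ∈ t, f i p) (fun n => ∑ i ∈ t, f₀ i n) := by
  classical
  induction t using Finset.induction_on with
  | empty =>
    simp only [Finset.sum_empty]
    exact ConvInProb.zero
  | insert a t ha ih =>
    simp only [Finset.sum_insert ha]
    exact (hf a (Finset.mem_insert_self a t)).add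
      (ih fun i hi => hf i (Finset.mem_insert_of_mem hi))

/-- Products converge because `ConvInProb` includes boundedness of the approximated sequence: f = (f
- f₀) + f₀, and likewise for g. -/
lemma ConvInProb.bilin {f : ∀ p : ℕ × Ω, E p.1} {f₀ : ∀ n, E n} {g : ∀ p : ℕ × Ω, F p.1}
    {g₀ : ∀ n, F n} (hf : ConvInProb N μ f f₀) (hg : ConvInProb N' μ g g₀)
    (b : ∀ n, E n → F n → G n)
    (hsub : ∀ n x y x' y', b n x y - b n x' y' = b n (x - x') y + b n x' (y - y'))
    (hb : ∀ n x y, N'' n (b n x y) ≤ N n x * N' n y) :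
    ConvInProb N'' μ (fun p => b p.1 (f p) (g p)) (fun n => b n (f₀ n) (g₀ n)) := by
  obtain ⟨h1, C, hC, h2⟩ := hf
  obtain ⟨h3, D, hD, h4⟩ := hg
  have h5 := (h1.mul (h3.add_const D)).add (h3.const_mul C)
  rw [zero_mul, mul_zero, add_zero] at h5
  refine ⟨squeeze_zero' (Eventually.of_forall fun _ => apply_nonneg _ _) ?_ h5, C * D,
    mul_nonneg hC hD, ?_⟩
  · filter_upwards [tendsto_fst_probFilter.eventually h2,
      tendsto_fst_probFilter.eventually h4] with p hp hp'
    have h6 : N' p.1 (g p) ≤ N' p.1 (g p - g₀ p.1) + D := by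
      have := map_add_le_add (N' p.1) (g p - g₀ p.1) (g₀ p.1)
      rw [sub_add_cancel] at this
      linarith
    rw [hsub]
    refine (map_add_le_add _ _ _).trans (add_le_add ((hb _ _ _).trans ?_) ((hb _ _ _).trans ?_))
    · exact mul_le_mul_of_nonneg_left h6 (apply_nonneg _ _)
    · exact mul_le_mul_of_nonneg_right hp (apply_nonneg _ _)
  · filter_upwards [h2, h4] with n hn hn'
    exact (hb _ _ _).trans (mul_le_mul hn hn' (apply_nonneg _ _) hC)

lemma ConvInProb.eventually_le {f : ∀ p : ℕ × Ω, E p.1} {f₀ : ∀ n, E n}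
    (hf : ConvInProb N μ f f₀) : ∃ C : ℝ, 0 ≤ C ∧ ∀ᶠ p in probFilter μ, N p.1 (f p) ≤ C := by
  obtain ⟨h1, C, hC, h2⟩ := hf
  refine ⟨C + 1, by positivity, ?_⟩
  filter_upwards [tendsto_fst_probFilter.eventually h2,
    (Metric.tendsto_nhds.1 h1) 1 one_pos] with p hp hp'
  rw [dist_zero_right, Real.norm_eq_abs, abs_of_nonneg (apply_nonneg _ _)] at hp'
  have := map_add_le_add (N p.1) (f p - f₀ p.1) (f₀ p.1)
  rw [sub_add_cancel] at this
  linarith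

/-- A consistent random argument may be inserted into a family whose Lipschitz constant does not
depend on n. -/
lemma UnifLip.convInProb {α : Type*} [PseudoMetricSpace α] {s : Set α} {f : ∀ n, α → E n}
    (hf : UnifLip N s f) {x : ℕ × Ω → α} {x₀ : α} (hx₀ : x₀ ∈ s)
    (hxs : ∀ᶠ p in probFilter μ, x p ∈ s) (hx : Tendsto x (probFilter μ) (𝓝 x₀)) :
    ConvInProb N μ (fun p => f p.1 (x p)) (fun n => f n x₀) := by
  obtain ⟨C, hC, hf⟩ := hf
  have h1 := (tendsto_iff_dist_tendsto_zero.1 hx).const_mul C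
  rw [mul_zero] at h1
  refine ⟨squeeze_zero' (Eventually.of_forall fun _ => apply_nonneg _ _) ?_ h1, C, hC,
    hf.mono fun n hn => hn.1 x₀ hx₀⟩
  filter_upwards [hxs, tendsto_fst_probFilter.eventually hf] with p hp hpf
  exact hpf.2 _ hp _ hx₀

/-- Convergence in probability of vectors in the maximum norm. -/
abbrev ConvVec (μ : Measure Ω) (f : ∀ p : ℕ × Ω, Fin p.1 → ℝ) (f₀ : ∀ n, Fin n → ℝ) : Prop :=
  ConvInProb (fun n => normAddGroupSeminorm (Fin n → ℝ)) μ f f₀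

/-- Convergence in probability of matrices in the row sum and the column sum norm. -/
abbrev ConvMat (μ : Measure Ω) (f : ∀ p : ℕ × Ω, Matrix (Fin p.1) (Fin p.1) ℝ)
    (f₀ : ∀ n, Matrix (Fin n) (Fin n) ℝ) : Prop :=
  ConvInProb sumNorm μ f f₀

/-- Convergence in probability of real numbers to a bounded sequence. -/
abbrev ConvReal (μ : Measure Ω) (f : ℕ × Ω → ℝ) (f₀ : ℕ → ℝ) : Prop :=
  ConvInProb (E := fun _ => ℝ) (fun _ => normAddGroupSeminorm ℝ) μ f f₀

lemma convReal_zero_of_tendsto {f : ℕ × Ω → ℝ} (hf : Tendsto f (probFilter μ) (𝓝 0)) :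
    ConvReal μ f (fun _ => 0) := by
  refine ⟨?_, 0, le_rfl, Eventually.of_forall fun n => (map_zero (normAddGroupSeminorm ℝ)).le⟩
  have h := tendsto_zero_iff_norm_tendsto_zero.1 hf
  simpa using h

lemma ConvVec.mul {f g : ∀ p : ℕ × Ω, Fin p.1 → ℝ} {f₀ g₀ : ∀ n, Fin n → ℝ}
    (hf : ConvVec μ f f₀) (hg : ConvVec μ g g₀) :
    ConvVec μ (fun p => f p * g p) (fun n => f₀ n * g₀ n) :=
  ConvInProb.bilin hf hg (fun _ x y => x * y) (fun _ x y x' y' => by ring)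
    fun _ x y => norm_mul_le x y

lemma ConvMat.mulVec {f : ∀ p : ℕ × Ω, Matrix (Fin p.1) (Fin p.1) ℝ}
    {f₀ : ∀ n, Matrix (Fin n) (Fin n) ℝ} {g : ∀ p : ℕ × Ω, Fin p.1 → ℝ} {g₀ : ∀ n, Fin n → ℝ}
    (hf : ConvMat μ f f₀) (hg : ConvVec μ g g₀) :
    ConvVec μ (fun p => f p *ᵥ g p) (fun n => f₀ n *ᵥ g₀ n) :=
  ConvInProb.bilin hf hg (fun _ x y => x *ᵥ y)
    (fun _ x y x' y' => by rw [Matrix.sub_mulVec, Matrix.mulVec_sub]; abel)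
    fun _ x y => norm_mulVec_le x y

lemma ConvMat.hadamard {f g : ∀ p : ℕ × Ω, Matrix (Fin p.1) (Fin p.1) ℝ}
    {f₀ g₀ : ∀ n, Matrix (Fin n) (Fin n) ℝ} (hf : ConvMat μ f f₀) (hg : ConvMat μ g g₀) :
    ConvMat μ (fun p => f p ⊙ g p) (fun n => f₀ n ⊙ g₀ n) :=
  ConvInProb.bilin hf hg (fun _ x y => x ⊙ y)
    (fun _ x y x' y' => by ext i j; simp [Matrix.hadamard_apply]; ring)
    fun _ x y => sumNorm_hadamard_le x y

lemma ConvMat.transpose {f : ∀ p : ℕ × Ω, Matrix (Fin p.1) (Fin p.1) ℝ}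
    {f₀ : ∀ n, Matrix (Fin n) (Fin n) ℝ} (hf : ConvMat μ f f₀) :
    ConvMat μ (fun p => (f p)ᵀ) (fun n => (f₀ n)ᵀ) :=
  ConvInProb.linear hf (fun _ x => xᵀ) (fun _ x y => (Matrix.transpose_sub x y).symm)
    fun _ x => (sumNorm_transpose x).le

lemma ConvReal.smul {r : ℕ × Ω → ℝ} {r₀ : ℕ → ℝ} {g : ∀ p : ℕ × Ω, Fin p.1 → ℝ}
    {g₀ : ∀ n, Fin n → ℝ} (hr : ConvReal μ r r₀) (hg : ConvVec μ g g₀) :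
    ConvVec μ (fun p => r p • g p) (fun n => r₀ n • g₀ n) :=
  ConvInProb.bilin (E := fun _ => ℝ) hr hg (fun _ x y => x • y)
    (fun _ x y x' y' => by rw [sub_smul, smul_sub]; abel)
    fun _ x y => (norm_smul x y).le

end ConvInProb

/-! ### Averages of squared residuals -/

section Residuals

variable {Ω : Type*} [MeasurableSpace Ω] {μ : Measure Ω} [IsProbabilityMeasure μ]
  {V : (n : ℕ) → Ω → Fin n → ℝ} {K : ℝ}

lemma FourthMoments.integral_sum_pow_four_le (h : FourthMoments μ V K) (n : ℕ) :
    Integrable (fun ω => (n : ℝ)⁻¹ * ∑ i, V n ω i ^ 4) μ ∧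
      ∫ ω, (n : ℝ)⁻¹ * ∑ i, V n ω i ^ 4 ∂μ ≤ K := by
  refine ⟨(integrable_finsetSum _ fun i _ => h.integrable n i).const_mul _, ?_⟩
  rw [integral_const_mul, integral_finsetSum _ fun i _ => h.integrable n i]
  exact inv_mul_sum_le (by linarith [h.one_le]) (h.bound n)

/-- The average of v_i⁴ is controlled only in expectation, hence bounded in probability by Markov's
inequality; this suffices next to a vanishing factor. -/
lemma FourthMoments.tendsto_mul_sum_pow_four (h : FourthMoments μ V K) {Z : ℕ × Ω → ℝ}
    (hZ : Tendsto Z (probFilter μ) (𝓝 0)) :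
    Tendsto (fun p : ℕ × Ω => Z p * ((p.1 : ℝ)⁻¹ * ∑ i, V p.1 p.2 i ^ 4)) (probFilter μ)
      (𝓝 0) :=
  tendsto_mul_of_integral_le (T := fun p => (p.1 : ℝ)⁻¹ * ∑ i, V p.1 p.2 i ^ 4) hZ
    (fun _ => mul_nonneg (by positivity) (Finset.sum_nonneg fun _ _ => by positivity))
    h.integral_sum_pow_four_le

lemma add_add_pow_four_le (a b c : ℝ) : (a + b + c) ^ 4 ≤ 27 * (a ^ 4 + b ^ 4 + c ^ 4) := by
  have h1 : (a + b + c) ^ 2 ≤ 3 * (a ^ 2 + b ^ 2 + c ^ 2) := by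
    nlinarith [sq_nonneg (a - b), sq_nonneg (b - c), sq_nonneg (a - c)]
  have h2 : (a ^ 2 + b ^ 2 + c ^ 2) ^ 2 ≤ 3 * (a ^ 4 + b ^ 4 + c ^ 4) := by
    nlinarith [sq_nonneg (a ^ 2 - b ^ 2), sq_nonneg (b ^ 2 - c ^ 2), sq_nonneg (a ^ 2 - c ^ 2)]
  calc (a + b + c) ^ 4 = ((a + b + c) ^ 2) ^ 2 := by ring
    _ ≤ (3 * (a ^ 2 + b ^ 2 + c ^ 2)) ^ 2 := by gcongr
    _ = 9 * (a ^ 2 + b ^ 2 + c ^ 2) ^ 2 := by ring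
    _ ≤ _ := by linarith

/-- Covers the three sources of residual error: a small matrix applied to the errors, treated by
Schur's test in ℓ⁴, and two vectors that are small in the maximum norm. -/
lemma FourthMoments.tendsto_sum_pow_four (h : FourthMoments μ V K)
    {B : ∀ p : ℕ × Ω, Matrix (Fin p.1) (Fin p.1) ℝ} {r r' : ∀ p : ℕ × Ω, Fin p.1 → ℝ}
    (hB : Tendsto (fun p => sumNorm p.1 (B p)) (probFilter μ) (𝓝 0))
    (hr : Tendsto (fun p => ‖r p‖) (probFilter μ) (𝓝 0))
    (hr' : Tendsto (fun p => ‖r' p‖) (probFilter μ) (𝓝 0)) :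
    Tendsto (fun p : ℕ × Ω => (p.1 : ℝ)⁻¹ * ∑ i, (B p *ᵥ V p.1 p.2 + r p + r' p) i ^ 4)
      (probFilter μ) (𝓝 0) := by
  have hB4 := hB.pow 4
  rw [zero_pow (by norm_num)] at hB4
  have h1 := (((h.tendsto_mul_sum_pow_four hB4).add (hr.pow 4)).add (hr'.pow 4)).const_mul 27
  norm_num at h1
  refine squeeze_zero (fun p => ?_) (fun p => ?_) h1
  · exact mul_nonneg (by positivity) (Finset.sum_nonneg fun _ _ => by positivity)
  · have hvec : ∀ u : Fin p.1 → ℝ, (p.1 : ℝ)⁻¹ * ∑ i, u i ^ 4 ≤ ‖u‖ ^ 4 := fun u =>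
      inv_mul_sum_le (by positivity) fun i => by
        rw [← Even.pow_abs (by decide : Even 4)]
        exact pow_le_pow_left₀ (abs_nonneg _) (norm_le_pi_norm u i) 4
    have hmat : (p.1 : ℝ)⁻¹ * ∑ i, (B p *ᵥ V p.1 p.2) i ^ 4 ≤
        sumNorm p.1 (B p) ^ 4 * ((p.1 : ℝ)⁻¹ * ∑ i, V p.1 p.2 i ^ 4) := by
      calc _ ≤ (p.1 : ℝ)⁻¹ * (sumNorm p.1 (B p) ^ 4 * ∑ i, V p.1 p.2 i ^ 4) := by
            gcongr; exact sum_mulVec_pow_four_le _ _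
        _ = _ := by ring
    calc _ ≤ (p.1 : ℝ)⁻¹ * ∑ i, 27 * ((B p *ᵥ V p.1 p.2) i ^ 4 + r p i ^ 4 + r' p i ^ 4) := by
          gcongr with i
          exact add_add_pow_four_le _ _ _
      _ = 27 * ((p.1 : ℝ)⁻¹ * ∑ i, (B p *ᵥ V p.1 p.2) i ^ 4 + (p.1 : ℝ)⁻¹ * ∑ i, r p i ^ 4 +
          (p.1 : ℝ)⁻¹ * ∑ i, r' p i ^ 4) := by
          rw [← Finset.mul_sum, Finset.sum_add_distrib, Finset.sum_add_distrib]
          ring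
      _ ≤ _ := by
          have := hvec (r p)
          have := hvec (r' p)
          linarith

lemma inv_mul_sum_mul_sq_le {n : ℕ} (f g : Fin n → ℝ) :
    ((n : ℝ)⁻¹ * ∑ i, f i * g i) ^ 2 ≤
      ((n : ℝ)⁻¹ * ∑ i, f i ^ 2) * ((n : ℝ)⁻¹ * ∑ i, g i ^ 2) := by
  calc _ = ((n : ℝ)⁻¹) ^ 2 * (∑ i, f i * g i) ^ 2 := by ring
    _ ≤ ((n : ℝ)⁻¹) ^ 2 * ((∑ i, f i ^ 2) * ∑ i, g i ^ 2) := by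
        gcongr; exact Finset.sum_mul_sq_le_sq_mul_sq _ _ _
    _ = _ := by ring

/-- Since (v + r)² - v² = r (2v + r), Cauchy–Schwarz bounds the square of the average by the average
of r⁴ times that of (2v + r)⁴ ≤ 128 v⁴ + 8 r⁴. -/
lemma FourthMoments.tendsto_sum_sq_sub_sq (h : FourthMoments μ V K)
    {r : ∀ p : ℕ × Ω, Fin p.1 → ℝ}
    (hr : Tendsto (fun p : ℕ × Ω => (p.1 : ℝ)⁻¹ * ∑ i, r p i ^ 4) (probFilter μ) (𝓝 0)) :
    Tendsto (fun p : ℕ × Ω => (p.1 : ℝ)⁻¹ *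
      ∑ i, ((V p.1 p.2 i + r p i) ^ 2 - V p.1 p.2 i ^ 2) ^ 2) (probFilter μ) (𝓝 0) := by
  have h1 := ((h.tendsto_mul_sum_pow_four hr).const_mul 128).add ((hr.mul hr).const_mul 8)
  simp only [mul_zero, add_zero] at h1
  refine tendsto_zero_of_sq (squeeze_zero (fun p => sq_nonneg _) (fun p => ?_) h1)
  have h2 : ∀ i, ((V p.1 p.2 i + r p i) ^ 2 - V p.1 p.2 i ^ 2) ^ 2 =
      r p i ^ 2 * (2 * V p.1 p.2 i + r p i) ^ 2 := fun i => by ring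
  simp only [h2]
  refine (inv_mul_sum_mul_sq_le _ _).trans ?_
  have h3 : (p.1 : ℝ)⁻¹ * ∑ i, ((2 * V p.1 p.2 i + r p i) ^ 2) ^ 2 ≤
      128 * ((p.1 : ℝ)⁻¹ * ∑ i, V p.1 p.2 i ^ 4) + 8 * ((p.1 : ℝ)⁻¹ * ∑ i, r p i ^ 4) := by
    calc _ ≤ (p.1 : ℝ)⁻¹ * ∑ i, (128 * V p.1 p.2 i ^ 4 + 8 * r p i ^ 4) := by
          gcongr with i
          have h4 : (2 * V p.1 p.2 i + r p i) ^ 2 ≤ 2 * (4 * V p.1 p.2 i ^ 2 + r p i ^ 2) := by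
            nlinarith [sq_nonneg (2 * V p.1 p.2 i - r p i)]
          calc _ ≤ (2 * (4 * V p.1 p.2 i ^ 2 + r p i ^ 2)) ^ 2 := by gcongr
            _ ≤ _ := by nlinarith [sq_nonneg (4 * V p.1 p.2 i ^ 2 - r p i ^ 2)]
      _ = _ := by rw [Finset.sum_add_distrib, ← Finset.mul_sum, ← Finset.mul_sum]; ring
  have h5 : ∀ i, (r p i ^ 2) ^ 2 = r p i ^ 4 := fun i => by ring
  simp only [h5]
  calc _ ≤ ((p.1 : ℝ)⁻¹ * ∑ i, r p i ^ 4) *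
        (128 * ((p.1 : ℝ)⁻¹ * ∑ i, V p.1 p.2 i ^ 4) + 8 * ((p.1 : ℝ)⁻¹ * ∑ i, r p i ^ 4)) :=
        mul_le_mul_of_nonneg_left h3
          (mul_nonneg (by positivity) (Finset.sum_nonneg fun _ _ => by positivity))
    _ = _ := by ring

variable {s : ∀ p : ℕ × Ω, Fin p.1 → ℝ}

/-- The squared errors. -/
def sqErr (V : (n : ℕ) → Ω → Fin n → ℝ) (p : ℕ × Ω) (i : Fin p.1) : ℝ := V p.1 p.2 i ^ 2

lemma sum_sqErr_sq (p : ℕ × Ω) : ∑ i, sqErr V p i ^ 2 = ∑ i, V p.1 p.2 i ^ 4 :=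
  Finset.sum_congr rfl fun i _ => by rw [sqErr]; ring

/-- Weighted averages of squared residuals. -/
lemma FourthMoments.tendsto_weighted_average (h : FourthMoments μ V K)
    (hs : Tendsto (fun p : ℕ × Ω => (p.1 : ℝ)⁻¹ * ∑ i, (s p i - sqErr V p i) ^ 2)
      (probFilter μ) (𝓝 0)) {w : ∀ p : ℕ × Ω, Fin p.1 → ℝ} {w₀ : ∀ n, Fin n → ℝ}
    (hw : ConvVec μ w w₀) :
    Tendsto (fun p : ℕ × Ω => (p.1 : ℝ)⁻¹ * (w p ⬝ᵥ s p) -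
      (p.1 : ℝ)⁻¹ * (w₀ p.1 ⬝ᵥ errVar μ V p.1)) (probFilter μ) (𝓝 0) := by
  obtain ⟨C, hC, hwC⟩ := hw.eventually_le
  obtain ⟨hw1, C', -, hC'⟩ := hw
  -- Three replacements in turn: squared residuals by squared errors (Cauchy–Schwarz), random
  -- weights by their limits, and squared errors by variances (law of large numbers).
  have t1 : Tendsto (fun p : ℕ × Ω => (p.1 : ℝ)⁻¹ * (w p ⬝ᵥ (s p - sqErr V p)))
      (probFilter μ) (𝓝 0) := by
    have h1 := hs.const_mul (C ^ 2)
    rw [mul_zero] at h1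
    refine tendsto_zero_of_sq (squeeze_zero' (Eventually.of_forall fun p => sq_nonneg _) ?_ h1)
    filter_upwards [hwC] with p hp
    refine (inv_mul_sum_mul_sq_le _ _).trans (mul_le_mul_of_nonneg_right
      (inv_mul_sum_le (by positivity) fun i => ?_)
      (mul_nonneg (by positivity) (Finset.sum_nonneg fun _ _ => sq_nonneg _)))
    rw [← sq_abs]
    exact pow_le_pow_left₀ (abs_nonneg _) ((norm_le_pi_norm (w p) i).trans hp) 2
  have t2 : Tendsto (fun p : ℕ × Ω => (p.1 : ℝ)⁻¹ * ((w p - w₀ p.1) ⬝ᵥ sqErr V p))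
      (probFilter μ) (𝓝 0) := by
    have h1 := hw1.mul_const (2 + K)
    rw [zero_mul] at h1
    refine squeeze_zero_norm' ?_ h1
    filter_upwards [h.eventually_sum_sq_le] with p hp
    rw [Real.norm_eq_abs, abs_mul, abs_of_nonneg (by positivity)]
    calc _ ≤ (p.1 : ℝ)⁻¹ * (‖w p - w₀ p.1‖ * ∑ i, |sqErr V p i|) := by
          gcongr; exact abs_dotProduct_le _ _
      _ = ‖w p - w₀ p.1‖ * ((p.1 : ℝ)⁻¹ * ∑ i, V p.1 p.2 i ^ 2) := by
          simp only [sqErr, abs_pow, sq_abs]; ring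
      _ ≤ _ := mul_le_mul_of_nonneg_left hp (norm_nonneg _)
  have t3 := h.tendsto_linear_sqDev hC'
  have hall := (t1.add t2).add t3
  simp only [add_zero] at hall
  refine hall.congr fun p => ?_
  have e1 : sqDev μ V p.1 p.2 = sqErr V p - errVar μ V p.1 := rfl
  rw [e1]
  simp only [dotProduct_sub, sub_dotProduct]
  ring

lemma inv_mul_dotProduct_mulVec_sq_le {n : ℕ} (A : Matrix (Fin n) (Fin n) ℝ)
    (u v : Fin n → ℝ) :
    ((n : ℝ)⁻¹ * (u ⬝ᵥ A *ᵥ v)) ^ 2 ≤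
      sumNorm n A ^ 2 * (((n : ℝ)⁻¹ * ∑ i, u i ^ 2) * ((n : ℝ)⁻¹ * ∑ i, v i ^ 2)) := by
  calc _ = ((n : ℝ)⁻¹) ^ 2 * (u ⬝ᵥ A *ᵥ v) ^ 2 := by ring
    _ ≤ ((n : ℝ)⁻¹) ^ 2 * (sumNorm n A ^ 2 * ((∑ i, u i ^ 2) * ∑ i, v i ^ 2)) := by
        gcongr; exact dotProduct_mulVec_sq_le A u v
    _ = _ := by ring

/-- Quadratic forms with zero diagonal in the squared residuals. -/
lemma FourthMoments.tendsto_quadratic_sq (h : FourthMoments μ V K)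
    (hs : Tendsto (fun p : ℕ × Ω => (p.1 : ℝ)⁻¹ * ∑ i, (s p i - sqErr V p i) ^ 2)
      (probFilter μ) (𝓝 0)) {A : ∀ p : ℕ × Ω, Matrix (Fin p.1) (Fin p.1) ℝ}
    {A₀ : ∀ n, Matrix (Fin n) (Fin n) ℝ} (hA : ConvMat μ A A₀) (hdiag : ∀ n i, A₀ n i i = 0) :
    Tendsto (fun p : ℕ × Ω => (p.1 : ℝ)⁻¹ * (s p ⬝ᵥ A p *ᵥ s p) -
      (p.1 : ℝ)⁻¹ * (errVar μ V p.1 ⬝ᵥ A₀ p.1 *ᵥ errVar μ V p.1)) (probFilter μ) (𝓝 0) := by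
  obtain ⟨C, hC, hAC⟩ := hA.eventually_le
  obtain ⟨hA1, C', hC'0, hC'⟩ := hA
  have hsn : ∀ p : ℕ × Ω, 0 ≤ (p.1 : ℝ)⁻¹ * ∑ i, (s p i - sqErr V p i) ^ 2 := fun p =>
    mul_nonneg (by positivity) (Finset.sum_nonneg fun _ _ => sq_nonneg _)
  have hdT := h.tendsto_mul_sum_pow_four hs
  simp only [← sum_sqErr_sq] at hdT
  -- With q the squared errors, d = s - q and η = q - σ², the difference is d'Aq + q'Ad + d'Ad +
  -- q'(A - A₀)q + η'A₀η + η'A₀σ² + σ²'A₀η; these are `t1` to `t7`. The zero diagonal of A₀ is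
  -- needed for η'A₀η, whose mean would otherwise involve fourth moments.
  have t1 : Tendsto (fun p : ℕ × Ω => (p.1 : ℝ)⁻¹ * ((s p - sqErr V p) ⬝ᵥ A p *ᵥ sqErr V p))
      (probFilter μ) (𝓝 0) := by
    have h1 := hdT.const_mul (C ^ 2)
    rw [mul_zero] at h1
    refine tendsto_zero_of_sq (squeeze_zero' (Eventually.of_forall fun p => sq_nonneg _) ?_ h1)
    filter_upwards [hAC] with p hp
    refine (inv_mul_dotProduct_mulVec_sq_le _ _ _).trans (mul_le_mul_of_nonneg_right
      (pow_le_pow_left₀ (apply_nonneg _ _) hp 2) (mul_nonneg (hsn p) ?_))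
    exact mul_nonneg (by positivity) (Finset.sum_nonneg fun _ _ => sq_nonneg _)
  have t2 : Tendsto (fun p : ℕ × Ω => (p.1 : ℝ)⁻¹ * (sqErr V p ⬝ᵥ A p *ᵥ (s p - sqErr V p)))
      (probFilter μ) (𝓝 0) := by
    have h1 := hdT.const_mul (C ^ 2)
    rw [mul_zero] at h1
    refine tendsto_zero_of_sq (squeeze_zero' (Eventually.of_forall fun p => sq_nonneg _) ?_ h1)
    filter_upwards [hAC] with p hp
    refine (inv_mul_dotProduct_mulVec_sq_le _ _ _).trans ?_
    rw [mul_comm ((p.1 : ℝ)⁻¹ * ∑ i, sqErr V p i ^ 2)]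
    refine mul_le_mul_of_nonneg_right
      (pow_le_pow_left₀ (apply_nonneg _ _) hp 2) (mul_nonneg (hsn p) ?_)
    exact mul_nonneg (by positivity) (Finset.sum_nonneg fun _ _ => sq_nonneg _)
  have t3 : Tendsto (fun p : ℕ × Ω => (p.1 : ℝ)⁻¹ *
      ((s p - sqErr V p) ⬝ᵥ A p *ᵥ (s p - sqErr V p))) (probFilter μ) (𝓝 0) := by
    have h1 := (hs.mul hs).const_mul (C ^ 2)
    rw [mul_zero, mul_zero] at h1
    refine tendsto_zero_of_sq (squeeze_zero' (Eventually.of_forall fun p => sq_nonneg _) ?_ h1)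
    filter_upwards [hAC] with p hp
    exact (inv_mul_dotProduct_mulVec_sq_le _ _ _).trans (mul_le_mul_of_nonneg_right
      (pow_le_pow_left₀ (apply_nonneg _ _) hp 2) (mul_nonneg (hsn p) (hsn p)))
  have t4 : Tendsto (fun p : ℕ × Ω => (p.1 : ℝ)⁻¹ *
      (sqErr V p ⬝ᵥ (A p - A₀ p.1) *ᵥ sqErr V p)) (probFilter μ) (𝓝 0) := by
    have h1 := h.tendsto_mul_sum_pow_four hA1
    simp only [← sum_sqErr_sq] at h1
    refine squeeze_zero_norm (fun p => ?_) h1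
    rw [Real.norm_eq_abs, abs_mul, abs_of_nonneg (by positivity)]
    calc _ ≤ (p.1 : ℝ)⁻¹ * (sumNorm p.1 (A p - A₀ p.1) * ∑ i, sqErr V p i ^ 2) := by
          gcongr; exact abs_dotProduct_mulVec_self_le _ _
      _ = _ := by ring
  have hK := h.one_le
  have t5 := tendsto_quadratic_of_diag_eq_zero h.centered_sqDev (by linarith)
    h.integral_sqDev_sq_le hC'0 hC' hdiag
  have t6 := h.tendsto_linear_sqDev (w := fun n => A₀ n *ᵥ errVar μ V n) (C := C' * (1 + K))
    (hC'.mono fun n hn => (norm_mulVec_le _ _).trans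
      (mul_le_mul hn (h.norm_errVar_le n) (norm_nonneg _) hC'0))
  have t7 := h.tendsto_linear_sqDev (w := fun n => (A₀ n)ᵀ *ᵥ errVar μ V n) (C := C' * (1 + K))
    (hC'.mono fun n hn => (norm_mulVec_le _ _).trans
      (mul_le_mul ((sumNorm_transpose _).le.trans hn) (h.norm_errVar_le n) (norm_nonneg _) hC'0))
  have hall := (((((t1.add t2).add t3).add t4).add t5).add t6).add t7
  simp only [add_zero] at hall
  refine hall.congr fun p => ?_
  have e1 : sqDev μ V p.1 p.2 = sqErr V p - errVar μ V p.1 := rfl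
  rw [dotProduct_comm (A₀ p.1 *ᵥ errVar μ V p.1), Matrix.mulVec_transpose,
    ← Matrix.dotProduct_mulVec, e1]
  simp only [dotProduct_sub, sub_dotProduct, Matrix.mulVec_sub, Matrix.sub_mulVec]
  ring

end Residuals

/-! ### Random arguments of families of vectors and matrices -/

section RandomArguments

variable {Ω : Type*} [MeasurableSpace Ω] {μ : Measure Ω} {α : Type*} [PseudoMetricSpace α]
  {s : Set α} {x : ℕ × Ω → α} {x₀ : α}

lemma LipVec.convVec {f : ∀ n, α → Fin n → ℝ} (hf : LipVec s f) (hx₀ : x₀ ∈ s)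
    (hxs : ∀ᶠ p in probFilter μ, x p ∈ s) (hx : Tendsto x (probFilter μ) (𝓝 x₀)) :
    ConvVec μ (fun p => f p.1 (x p)) (fun n => f n x₀) :=
  UnifLip.convInProb hf hx₀ hxs hx

lemma LipMat.convMat {f : ∀ n, α → Matrix (Fin n) (Fin n) ℝ} (hf : LipMat s f) (hx₀ : x₀ ∈ s)
    (hxs : ∀ᶠ p in probFilter μ, x p ∈ s) (hx : Tendsto x (probFilter μ) (𝓝 x₀)) :
    ConvMat μ (fun p => f p.1 (x p)) (fun n => f n x₀) :=
  UnifLip.convInProb hf hx₀ hxs hx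

lemma LipReal.convReal {f : ℕ → α → ℝ} (hf : LipReal s f) (hx₀ : x₀ ∈ s)
    (hxs : ∀ᶠ p in probFilter μ, x p ∈ s) (hx : Tendsto x (probFilter μ) (𝓝 x₀)) :
    ConvReal μ (fun p => f p.1 (x p)) (fun n => f n x₀) :=
  UnifLip.convInProb (E := fun _ => ℝ) hf hx₀ hxs hx

lemma ConvVec.neg {f : ∀ p : ℕ × Ω, Fin p.1 → ℝ} {f₀ : ∀ n, Fin n → ℝ} (hf : ConvVec μ f f₀) :
    ConvVec μ (fun p => -f p) (fun n => -f₀ n) :=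
  ConvInProb.neg hf

lemma ConvMat.neg {f : ∀ p : ℕ × Ω, Matrix (Fin p.1) (Fin p.1) ℝ}
    {f₀ : ∀ n, Matrix (Fin n) (Fin n) ℝ} (hf : ConvMat μ f f₀) :
    ConvMat μ (fun p => -f p) (fun n => -f₀ n) :=
  ConvInProb.neg hf

lemma ConvReal.add {f g : ℕ × Ω → ℝ} {f₀ g₀ : ℕ → ℝ} (hf : ConvReal μ f f₀)
    (hg : ConvReal μ g g₀) : ConvReal μ (fun p => f p + g p) (fun n => f₀ n + g₀ n) :=
  ConvInProb.add (E := fun _ => ℝ) hf hg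

lemma convVec_sum_smul {k : ℕ} {y : ∀ p : ℕ × Ω, Fin k → Fin p.1 → ℝ} {y₀ : ∀ n, Fin k → Fin n → ℝ}
    {b : ℕ × Ω → Fin k → ℝ} {b₀ : Fin k → ℝ} (hb : ∀ a, ConvReal μ (fun p => b p a) (fun _ => b₀ a))
    (hy : ∀ a, ConvVec μ (fun p => y p a) (fun n => y₀ n a)) :
    ConvVec μ (fun p => ∑ a, b p a • y p a) (fun n => ∑ a, b₀ a • y₀ n a) :=
  ConvInProb.sum (E := fun n => Fin n → ℝ) (f := fun a p => b p a • y p a)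
    (f₀ := fun a n => b₀ a • y₀ n a) Finset.univ fun a _ => ConvReal.smul (hb a) (hy a)

end RandomArguments

/-! ### The estimators in terms of the errors -/

section Estimators

variable {n k : ℕ} {W M : Matrix (Fin n) (Fin n) ℝ} {X : Matrix (Fin n) (Fin k) ℝ}

lemma regrComb_add (ρ : ℝ) (β β' : Fin k → ℝ) :
    regrComb M X ρ (β + β') = regrComb M X ρ β + regrComb M X ρ β' := by
  simp only [regrComb_eq, Matrix.mulVec_add]

/-- The part of the mean of the transformed observations that is not explained by the transformed
regressors. -/
def residMean (W M : Matrix (Fin n) (Fin n) ℝ) (X : Matrix (Fin n) (Fin k) ℝ) (β₀ : Fin k → ℝ)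
    (lam₀ : ℝ) (ζ : ℝ × ℝ) : Fin n → ℝ :=
  meanVec W M X β₀ lam₀ ζ - regrComb M X ζ.2 (projCoef M X ζ.2 (meanVec W M X β₀ lam₀ ζ))

/-- The random part of the estimator of the regression coefficients. -/
def noiseCoef (W M : Matrix (Fin n) (Fin n) ℝ) (X : Matrix (Fin n) (Fin k) ℝ) (lam₀ ρ₀ : ℝ)
    (ζ : ℝ × ℝ) (v : Fin n → ℝ) : Fin k → ℝ :=
  projCoef M X ζ.2 (noiseMat W M lam₀ ρ₀ ζ *ᵥ v)

variable {β₀ : Fin k → ℝ} {lam₀ ρ₀ : ℝ} {ζ : ℝ × ℝ}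

lemma betaHat_outcome (hn : n ≠ 0) (hG : IsUnit (gram M X ζ.2).det) (v : Fin n → ℝ) :
    betaHat W M X (outcome W M X β₀ lam₀ ρ₀ v) ζ =
      projCoef M X ζ.2 (meanVec W M X β₀ lam₀ ζ) + noiseCoef W M X lam₀ ρ₀ ζ v := by
  rw [betaHat_eq hn hG, exp_mulVec_outcome, projCoef_add]
  rfl

lemma resid_betaHat_outcome (hn : n ≠ 0) (hG : IsUnit (gram M X ζ.2).det) (v : Fin n → ℝ) :
    resid W M X (outcome W M X β₀ lam₀ ρ₀ v)
      (betaHat W M X (outcome W M X β₀ lam₀ ρ₀ v) ζ) ζ =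
      residMean W M X β₀ lam₀ ζ + noiseMat W M lam₀ ρ₀ ζ *ᵥ v -
        regrComb M X ζ.2 (noiseCoef W M X lam₀ ρ₀ ζ v) := by
  rw [betaHat_outcome hn hG, resid_outcome, regrComb_add, residMean]
  abel

/-- At the true parameters the transformed mean is itself a combination of the transformed
regressors, so the projection leaves no remainder. -/
lemma residMean_true (hG : IsUnit (gram M X ρ₀).det) :
    residMean W M X β₀ lam₀ (lam₀, ρ₀) = 0 := by
  rw [residMean, meanVec_true (W := W) (M := M) β₀ lam₀ ρ₀, projCoef_regrComb hG, sub_self]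

variable {Ω : Type*} [MeasurableSpace Ω] {μ : Measure Ω} [IsProbabilityMeasure μ]

/-- The observations are affine in the centered errors, so their mean is the value at zero errors.
-/
lemma integral_outcome {v : Ω → Fin n → ℝ} (hv : IndepCentered μ v) (i : Fin n) :
    ∫ ω, outcome W M X β₀ lam₀ ρ₀ (v ω) i ∂μ = outcome W M X β₀ lam₀ ρ₀ 0 i := by
  have h1 : ∀ u : Fin n → ℝ, outcome W M X β₀ lam₀ ρ₀ u i = outcome W M X β₀ lam₀ ρ₀ 0 i +
      (fun j => (NormedSpace.exp ((-lam₀) • W) * NormedSpace.exp ((-ρ₀) • M)) i j) ⬝ᵥ u := by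
    intro u
    simp only [outcome, Matrix.mulVec_add, Matrix.mulVec_zero, add_zero, Pi.add_apply]
    rw [Matrix.mulVec_mulVec u (NormedSpace.exp ((-lam₀) • W)) (NormedSpace.exp ((-ρ₀) • M))]
    rfl
  rw [integral_congr_ae (Eventually.of_forall fun ω => h1 (v ω)), integral_add (integrable_const _)
    ((hv.memLp_dotProduct _).integrable (by norm_num)), hv.integral_dotProduct]
  simp

lemma betaBar_outcome {v : Ω → Fin n → ℝ} (hv : IndepCentered μ v) (hn : n ≠ 0)
    (hG : IsUnit (gram M X ζ.2).det) :
    betaBar μ W M X (fun ω => outcome W M X β₀ lam₀ ρ₀ (v ω)) ζ =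
      projCoef M X ζ.2 (meanVec W M X β₀ lam₀ ζ) := by
  simp only [betaBar, integral_outcome hv]
  rw [betaHat_eq hn hG, exp_mulVec_outcome, Matrix.mulVec_zero, add_zero]

lemma popConcScore_outcome {v : Ω → Fin n → ℝ} (hv : IndepCentered μ v) (hn : n ≠ 0)
    (hG : IsUnit (gram M X ζ.2).det) :
    popConcScore μ W M X (fun ω => outcome W M X β₀ lam₀ ρ₀ (v ω)) ζ =
      (-(meanVec W M X β₀ lam₀ ζ ⬝ᵥ twistedD W M ζ.2 *ᵥ residMean W M X β₀ lam₀ ζ +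
        ((noiseMat W M lam₀ ρ₀ ζ)ᵀ * twistedD W M ζ.2 * noiseMat W M lam₀ ρ₀ ζ).diag ⬝ᵥ
          fun i => ∫ ω, v ω i ^ 2 ∂μ),
      -(residMean W M X β₀ lam₀ ζ ⬝ᵥ M *ᵥ residMean W M X β₀ lam₀ ζ +
        ((noiseMat W M lam₀ ρ₀ ζ)ᵀ * M * noiseMat W M lam₀ ρ₀ ζ).diag ⬝ᵥ
          fun i => ∫ ω, v ω i ^ 2 ∂μ)) := by
  have hr : ∀ ω, resid W M X (outcome W M X β₀ lam₀ ρ₀ (v ω))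
      (projCoef M X ζ.2 (meanVec W M X β₀ lam₀ ζ)) ζ =
      residMean W M X β₀ lam₀ ζ + noiseMat W M lam₀ ρ₀ ζ *ᵥ v ω := by
    intro ω
    rw [resid_outcome, residMean]
    abel
  simp only [popConcScore, betaBar_outcome hv hn hG, scoreLam_outcome, scoreRho, hr,
    integral_neg, hv.integral_perturbed]

end Estimators

/-! ### Consistency -/

section Consistency

variable {Ω : Type*} [MeasurableSpace Ω] {μ : Measure Ω} [IsProbabilityMeasure μ]
  {k : ℕ} {c : ℝ} {W M : (n : ℕ) → Matrix (Fin n) (Fin n) ℝ}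
  {X : (n : ℕ) → Matrix (Fin n) (Fin k) ℝ} {V : (n : ℕ) → Ω → Fin n → ℝ} {K : ℝ}
  {β₀ : Fin k → ℝ} {lam₀ ρ₀ : ℝ} {ζhat : ℕ → Ω → ℝ × ℝ}

lemma lipVec_residMean (hW : UniformlyBoundedSums W) (hM : UniformlyBoundedSums M)
    (hX : RegularRegressors c M X) :
    LipVec (paramSpace c) (fun n ζ => residMean (W n) (M n) (X n) β₀ lam₀ ζ) :=
  UnifLip.sub (lipVec_meanVec hW hM hX.1 β₀ lam₀) (lipVec_regrComb hM hX.1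
    fun a => lipReal_projCoef hM hX (lipVec_meanVec hW hM hX.1 β₀ lam₀) a)

lemma tendsto_noiseCoef (h : FourthMoments μ V K) (hW : UniformlyBoundedSums W)
    (hM : UniformlyBoundedSums M) (hX : RegularRegressors c M X) (a : Fin k) :
    Tendsto (fun q : (ℕ × Ω) × (ℝ × ℝ) =>
      noiseCoef (W q.1.1) (M q.1.1) (X q.1.1) lam₀ ρ₀ q.2 (V q.1.1 q.1.2) a)
      (probFilter μ ×ˢ 𝓟 (paramSpace c)) (𝓝 0) := by
  have h1 : ∀ b, Tendsto (fun q : (ℕ × Ω) × (ℝ × ℝ) => (gram (M q.1.1) (X q.1.1) q.2.2)⁻¹ a b *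
      ((q.1.1 : ℝ)⁻¹ * (((noiseMat (W q.1.1) (M q.1.1) lam₀ ρ₀ q.2)ᵀ *ᵥ
        regr (M q.1.1) (X q.1.1) q.2.2 b) ⬝ᵥ V q.1.1 q.1.2)))
      (probFilter μ ×ˢ 𝓟 (paramSpace c)) (𝓝 0) := fun b =>
    (lipReal_gram_inv hM hX a b).tendsto_mul_zero
      (h.tendstoUniformly_linear (isCompact_paramSpace c)
        (w := fun n ζ => (noiseMat (W n) (M n) lam₀ ρ₀ ζ)ᵀ *ᵥ regr (M n) (X n) ζ.2 b)
        ((lipMat_noiseMat hW hM lam₀ ρ₀).transpose.mulVec (lipVec_regr hM hX.1 b)))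
  have h2 := tendsto_finsetSum Finset.univ fun b _ => h1 b
  simp only [Finset.sum_const_zero] at h2
  refine h2.congr fun q => Finset.sum_congr rfl fun b _ => ?_
  rw [Matrix.dotProduct_mulVec, ← Matrix.mulVec_transpose]

lemma eventually_regular (hM : UniformlyBoundedSums M) (hX : RegularRegressors c M X) :
    ∀ᶠ n in atTop, n ≠ 0 ∧ ∀ ζ ∈ paramSpace c, IsUnit (gram (M n) (X n) ζ.2).det :=
  (eventually_ne_atTop 0).and (eventually_isUnit_det_gram hM hX)

lemma errVar_eq (n : ℕ) : errVar μ V n = fun i => ∫ ω, V n ω i ^ 2 ∂μ := rfl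

/-- Uniform convergence of the normalized concentrated score. -/
lemma tendsto_concScore_sub (h : FourthMoments μ V K) (hW : UniformlyBoundedSums W)
    (hM : UniformlyBoundedSums M) (hX : RegularRegressors c M X) :
    Tendsto (fun q : (ℕ × Ω) × (ℝ × ℝ) => (q.1.1 : ℝ)⁻¹ •
      (concScore (W q.1.1) (M q.1.1) (X q.1.1)
        (outcome (W q.1.1) (M q.1.1) (X q.1.1) β₀ lam₀ ρ₀ (V q.1.1 q.1.2)) q.2 -
      popConcScore μ (W q.1.1) (M q.1.1) (X q.1.1)
        (fun ω => outcome (W q.1.1) (M q.1.1) (X q.1.1) β₀ lam₀ ρ₀ (V q.1.1 ω)) q.2))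
      (probFilter μ ×ˢ 𝓟 (paramSpace c)) (𝓝 0) := by
  have hN := lipMat_noiseMat (c := c) hW hM lam₀ ρ₀
  have hr := lipVec_residMean (β₀ := β₀) (lam₀ := lam₀) hW hM hX
  have he := tendsto_noiseCoef (lam₀ := lam₀) (ρ₀ := ρ₀) h hW hM hX
  have hx := lipVec_regr (c := c) hM hX.1
  -- In the λ-part the left factor is the whole transformed observation, not a residual: its mean is
  -- `meanVec` and its perturbation `e` is zero.
  have t1 := h.tendstoUniformly_perturbed (isCompact_paramSpace c) hN
    (lipMat_twistedD hW hM) (lipVec_meanVec hW hM hX.1 β₀ lam₀) hr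
    (x := fun a n ζ => regr (M n) (X n) ζ.2 a) hx
    (e := fun _ _ => 0) (fun _ => tendsto_const_nhds) he
  have t2 := h.tendstoUniformly_perturbed (isCompact_paramSpace c) hN
    hM.lipMat hr hr (x := fun a n ζ => regr (M n) (X n) ζ.2 a) hx he he
  have t := (t1.neg).prodMk_nhds (t2.neg)
  rw [neg_zero] at t
  refine t.congr' ?_
  rw [EventuallyEq, eventually_prod_principal_iff]
  filter_upwards [tendsto_fst_probFilter.eventually (eventually_regular hM hX)] with p hp ζ hζ
  rw [popConcScore_outcome (h.centered p.1) hp.1 (hp.2 ζ hζ), concScore, scoreLam_outcome,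
    scoreRho, resid_betaHat_outcome hp.1 (hp.2 ζ hζ)]
  simp only [Prod.mk_sub_mk, Prod.smul_mk, smul_eq_mul, zero_smul, Finset.sum_const_zero,
    sub_zero]
  refine Prod.ext ?_ ?_
  · simp only [regrComb, errVar_eq]
    ring
  · simp only [regrComb, errVar_eq]
    ring

lemma IsMEstimator.eventually {Y : (n : ℕ) → Ω → Fin n → ℝ}
    (hζ : IsMEstimator μ c W M X Y ζhat) :
    ∀ᶠ p : ℕ × Ω in probFilter μ, ζhat p.1 p.2 ∈ paramSpace c ∧
      concScore (W p.1) (M p.1) (X p.1) (Y p.1 p.2) (ζhat p.1 p.2) = 0 := hζ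

lemma tendsto_estimator_graph (hmem : ∀ᶠ p : ℕ × Ω in probFilter μ, ζhat p.1 p.2 ∈ paramSpace c) :
    Tendsto (fun p : ℕ × Ω => (p, ζhat p.1 p.2)) (probFilter μ)
      (probFilter μ ×ˢ 𝓟 (paramSpace c)) :=
  tendsto_id.prodMk (tendsto_principal.2 hmem)

/-- Consistency of the M-estimator of the spatial parameters. -/
lemma tendsto_estimator (h : FourthMoments μ V K) (hW : UniformlyBoundedSums W)
    (hM : UniformlyBoundedSums M) (hX : RegularRegressors c M X)
    (hid : Identified μ c W M X
      (fun n ω => outcome (W n) (M n) (X n) β₀ lam₀ ρ₀ (V n ω)) (lam₀, ρ₀))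
    (hζ : IsMEstimator μ c W M X
      (fun n ω => outcome (W n) (M n) (X n) β₀ lam₀ ρ₀ (V n ω)) ζhat) :
    Tendsto (fun p : ℕ × Ω => ζhat p.1 p.2) (probFilter μ) (𝓝 (lam₀, ρ₀)) := by
  have hmem := hζ.eventually.mono fun _ hp => hp.1
  have hS := (tendsto_concScore_sub (β₀ := β₀) (lam₀ := lam₀) (ρ₀ := ρ₀) h hW hM hX).comp
    (tendsto_estimator_graph hmem)
  rw [Metric.tendsto_nhds]
  intro ϑ hϑ
  obtain ⟨η, hη, hn⟩ := hid ϑ hϑ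
  filter_upwards [hζ.eventually, tendsto_fst_probFilter.eventually hn,
    (Metric.tendsto_nhds.1 hS) η hη] with p hp hpn hpS
  -- At a root the uniform deviation is n⁻¹ times the population score itself. It is below η,
  -- whereas identification makes it at least η at distance ϑ or more.
  by_contra hc
  have h1 := hpn _ hp.1 (not_lt.1 hc)
  simp only [Function.comp_apply] at hpS
  rw [hp.2, zero_sub, smul_neg, dist_zero_right, norm_neg, norm_smul, norm_inv,
    Real.norm_natCast] at hpS
  exact absurd h1 (not_le.2 hpS)

/-! ### Consistency of the plug-in estimator -/

lemma convVec_scoreVec (hW : UniformlyBoundedSums W) (hM : UniformlyBoundedSums M)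
    (hX : RegularRegressors c M X) (hζ₀ : (lam₀, ρ₀) ∈ paramSpace c)
    (hmem : ∀ᶠ p : ℕ × Ω in probFilter μ, ζhat p.1 p.2 ∈ paramSpace c)
    (hlim : Tendsto (fun p : ℕ × Ω => ζhat p.1 p.2) (probFilter μ) (𝓝 (lam₀, ρ₀)))
    {b : ℕ × Ω → Fin k → ℝ} (hb : ∀ a, ConvReal μ (fun p => b p a) (fun _ => β₀ a))
    (a : Fin k ⊕ Fin 2) :
    ConvVec μ (fun p => scoreVec (W p.1) (M p.1) (X p.1) (b p) (ζhat p.1 p.2).2 a)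
      (fun n => scoreVec (W n) (M n) (X n) β₀ ρ₀ a) := by
  have hx : ∀ a, ConvVec μ (fun p => regr (M p.1) (X p.1) (ζhat p.1 p.2).2 a)
      (fun n => regr (M n) (X n) ρ₀ a) := fun a =>
    LipVec.convVec (f := fun n ζ => regr (M n) (X n) ζ.2 a)
      (x := fun p => ζhat p.1 p.2) (x₀ := (lam₀, ρ₀)) (lipVec_regr hM hX.1 a) hζ₀ hmem hlim
  rcases a with a | a
  · exact hx a
  · fin_cases a
    · have hD : ConvMat μ (fun p => twistedD (W p.1) (M p.1) (ζhat p.1 p.2).2)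
          (fun n => twistedD (W n) (M n) ρ₀) :=
        LipMat.convMat (f := fun n ζ => twistedD (W n) (M n) ζ.2)
          (x := fun p => ζhat p.1 p.2) (x₀ := (lam₀, ρ₀)) (lipMat_twistedD hW hM) hζ₀ hmem hlim
      have hs : ConvVec μ (fun p => regrComb (M p.1) (X p.1) (ζhat p.1 p.2).2 (b p))
          (fun n => regrComb (M n) (X n) ρ₀ β₀) :=
        convVec_sum_smul (y := fun p a => regr (M p.1) (X p.1) (ζhat p.1 p.2).2 a)
          (y₀ := fun n a => regr (M n) (X n) ρ₀ a) hb hx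
      exact ConvVec.neg
        (f := fun p => (twistedD (W p.1) (M p.1) (ζhat p.1 p.2).2)ᵀ *ᵥ
          regrComb (M p.1) (X p.1) (ζhat p.1 p.2).2 (b p))
        (f₀ := fun n => (twistedD (W n) (M n) ρ₀)ᵀ *ᵥ regrComb (M n) (X n) ρ₀ β₀)
        (ConvMat.mulVec (ConvMat.transpose hD) hs)
    · exact ConvInProb.zero

lemma convMat_scoreMat (hW : UniformlyBoundedSums W) (hM : UniformlyBoundedSums M)
    (hζ₀ : (lam₀, ρ₀) ∈ paramSpace c)
    (hmem : ∀ᶠ p : ℕ × Ω in probFilter μ, ζhat p.1 p.2 ∈ paramSpace c)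
    (hlim : Tendsto (fun p : ℕ × Ω => ζhat p.1 p.2) (probFilter μ) (𝓝 (lam₀, ρ₀)))
    (a : Fin k ⊕ Fin 2) :
    ConvMat μ (fun p => scoreMat k (W p.1) (M p.1) (ζhat p.1 p.2).2 a)
      (fun n => scoreMat k (W n) (M n) ρ₀ a) := by
  rcases a with a | a
  · exact ConvInProb.zero
  · fin_cases a
    · have hD : ConvMat μ (fun p => twistedD (W p.1) (M p.1) (ζhat p.1 p.2).2)
          (fun n => twistedD (W n) (M n) ρ₀) :=
        LipMat.convMat (f := fun n ζ => twistedD (W n) (M n) ζ.2)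
          (x := fun p => ζhat p.1 p.2) (x₀ := (lam₀, ρ₀)) (lipMat_twistedD hW hM) hζ₀ hmem hlim
      exact ConvMat.neg (f := fun p => twistedD (W p.1) (M p.1) (ζhat p.1 p.2).2)
        (f₀ := fun n => twistedD (W n) (M n) ρ₀) hD
    · obtain ⟨C, hC, hMC⟩ := hM.exists_sumNorm_le
      exact ConvMat.neg (f := fun p => M p.1) (f₀ := M) (ConvInProb.const hC (Eventually.of_forall hMC))

lemma convReal_noiseCoef (h : FourthMoments μ V K) (hW : UniformlyBoundedSums W)
    (hM : UniformlyBoundedSums M) (hX : RegularRegressors c M X)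
    (hmem : ∀ᶠ p : ℕ × Ω in probFilter μ, ζhat p.1 p.2 ∈ paramSpace c) (a : Fin k) :
    ConvReal μ (fun p => noiseCoef (W p.1) (M p.1) (X p.1) lam₀ ρ₀ (ζhat p.1 p.2) (V p.1 p.2) a)
      (fun _ => 0) := by
  have h1 := (tendsto_noiseCoef (lam₀ := lam₀) (ρ₀ := ρ₀) h hW hM hX a).comp
    (tendsto_estimator_graph hmem)
  exact convReal_zero_of_tendsto h1

/-- The projected mean is Lipschitz in ζ and equals β₀ at ζ₀; the noise part vanishes uniformly over
the parameter space. -/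
lemma convReal_betaHat (h : FourthMoments μ V K) (hW : UniformlyBoundedSums W)
    (hM : UniformlyBoundedSums M) (hX : RegularRegressors c M X)
    (hζ₀ : (lam₀, ρ₀) ∈ paramSpace c)
    (hmem : ∀ᶠ p : ℕ × Ω in probFilter μ, ζhat p.1 p.2 ∈ paramSpace c)
    (hlim : Tendsto (fun p : ℕ × Ω => ζhat p.1 p.2) (probFilter μ) (𝓝 (lam₀, ρ₀)))
    (a : Fin k) :
    ConvReal μ (fun p => betaHat (W p.1) (M p.1) (X p.1)
      (outcome (W p.1) (M p.1) (X p.1) β₀ lam₀ ρ₀ (V p.1 p.2)) (ζhat p.1 p.2) a)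
      (fun _ => β₀ a) := by
  have h1 : ConvReal μ (fun p => projCoef (M p.1) (X p.1) (ζhat p.1 p.2).2
      (meanVec (W p.1) (M p.1) (X p.1) β₀ lam₀ (ζhat p.1 p.2)) a)
      (fun n => projCoef (M n) (X n) ρ₀ (meanVec (W n) (M n) (X n) β₀ lam₀ (lam₀, ρ₀)) a) :=
    LipReal.convReal (x := fun p => ζhat p.1 p.2) (x₀ := (lam₀, ρ₀))
      (f := fun n ζ => projCoef (M n) (X n) ζ.2 (meanVec (W n) (M n) (X n) β₀ lam₀ ζ) a)
      (lipReal_projCoef hM hX (lipVec_meanVec hW hM hX.1 β₀ lam₀) a) hζ₀ hmem hlim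
  have h2 := convReal_noiseCoef (lam₀ := lam₀) (ρ₀ := ρ₀) h hW hM hX hmem a
  refine ConvInProb.congr (E := fun _ => ℝ) (h1.add h2) ?_ ?_
  · filter_upwards [hmem, tendsto_fst_probFilter.eventually (eventually_regular hM hX)]
      with p hp hpr
    rw [betaHat_outcome hpr.1 (hpr.2 _ hp)]
    rfl
  · filter_upwards [eventually_regular hM hX] with n hn
    rw [meanVec_true, projCoef_regrComb (hn.2 _ hζ₀), add_zero]

/-- Residual minus error is (N(ζhat) - 1) V, plus the unexplained mean at the estimator, minus the
fitted noise. The matrix and both vectors tend to zero in their norms, so the fourth powers of the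
difference are small on average. -/
lemma tendsto_sum_resid_sq (h : FourthMoments μ V K) (hW : UniformlyBoundedSums W)
    (hM : UniformlyBoundedSums M) (hX : RegularRegressors c M X)
    (hζ₀ : (lam₀, ρ₀) ∈ paramSpace c)
    (hmem : ∀ᶠ p : ℕ × Ω in probFilter μ, ζhat p.1 p.2 ∈ paramSpace c)
    (hlim : Tendsto (fun p : ℕ × Ω => ζhat p.1 p.2) (probFilter μ) (𝓝 (lam₀, ρ₀))) :
    Tendsto (fun p : ℕ × Ω => (p.1 : ℝ)⁻¹ * ∑ i, (resid (W p.1) (M p.1) (X p.1)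
      (outcome (W p.1) (M p.1) (X p.1) β₀ lam₀ ρ₀ (V p.1 p.2))
      (betaHat (W p.1) (M p.1) (X p.1)
        (outcome (W p.1) (M p.1) (X p.1) β₀ lam₀ ρ₀ (V p.1 p.2)) (ζhat p.1 p.2))
      (ζhat p.1 p.2) i ^ 2 - sqErr V p i) ^ 2) (probFilter μ) (𝓝 0) := by
  have hN : ConvMat μ (fun p => noiseMat (W p.1) (M p.1) lam₀ ρ₀ (ζhat p.1 p.2))
      (fun n => noiseMat (W n) (M n) lam₀ ρ₀ (lam₀, ρ₀)) :=
    LipMat.convMat (f := fun n ζ => noiseMat (W n) (M n) lam₀ ρ₀ ζ)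
      (x := fun p => ζhat p.1 p.2) (x₀ := (lam₀, ρ₀)) (lipMat_noiseMat hW hM lam₀ ρ₀) hζ₀ hmem hlim
  have hr : ConvVec μ (fun p => residMean (W p.1) (M p.1) (X p.1) β₀ lam₀ (ζhat p.1 p.2))
      (fun n => residMean (W n) (M n) (X n) β₀ lam₀ (lam₀, ρ₀)) :=
    LipVec.convVec (f := fun n ζ => residMean (W n) (M n) (X n) β₀ lam₀ ζ)
      (x := fun p => ζhat p.1 p.2) (x₀ := (lam₀, ρ₀)) (lipVec_residMean hW hM hX) hζ₀ hmem hlim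
  have hx : ∀ a, ConvVec μ (fun p => regr (M p.1) (X p.1) (ζhat p.1 p.2).2 a)
      (fun n => regr (M n) (X n) ρ₀ a) := fun a =>
    LipVec.convVec (f := fun n ζ => regr (M n) (X n) ζ.2 a)
      (x := fun p => ζhat p.1 p.2) (x₀ := (lam₀, ρ₀)) (lipVec_regr hM hX.1 a) hζ₀ hmem hlim
  have he : ∀ a, ConvReal μ (fun p => noiseCoef (W p.1) (M p.1) (X p.1) lam₀ ρ₀
      (ζhat p.1 p.2) (V p.1 p.2) a) (fun _ => 0) := fun a =>
    convReal_noiseCoef h hW hM hX hmem a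
  -- The limit is zero, written as a combination with zero coefficients to match `convVec_sum_smul`.
  have hR : ConvVec μ (fun p => -regrComb (M p.1) (X p.1) (ζhat p.1 p.2).2
      (noiseCoef (W p.1) (M p.1) (X p.1) lam₀ ρ₀ (ζhat p.1 p.2) (V p.1 p.2)))
      (fun n => -∑ a, (0 : ℝ) • regr (M n) (X n) ρ₀ a) :=
    ConvVec.neg (f := fun p => regrComb (M p.1) (X p.1) (ζhat p.1 p.2).2
        (noiseCoef (W p.1) (M p.1) (X p.1) lam₀ ρ₀ (ζhat p.1 p.2) (V p.1 p.2)))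
      (f₀ := fun n => ∑ a, (0 : ℝ) • regr (M n) (X n) ρ₀ a)
      (convVec_sum_smul (y := fun p a => regr (M p.1) (X p.1) (ζhat p.1 p.2).2 a)
        (y₀ := fun n a => regr (M n) (X n) ρ₀ a) (b₀ := fun _ => 0) he hx)
  have t1 := h.tendsto_sum_pow_four
    (B := fun p => noiseMat (W p.1) (M p.1) lam₀ ρ₀ (ζhat p.1 p.2) -
      noiseMat (W p.1) (M p.1) lam₀ ρ₀ (lam₀, ρ₀))
    (r := fun p => residMean (W p.1) (M p.1) (X p.1) β₀ lam₀ (ζhat p.1 p.2) -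
      residMean (W p.1) (M p.1) (X p.1) β₀ lam₀ (lam₀, ρ₀))
    (r' := fun p => -regrComb (M p.1) (X p.1) (ζhat p.1 p.2).2
      (noiseCoef (W p.1) (M p.1) (X p.1) lam₀ ρ₀ (ζhat p.1 p.2) (V p.1 p.2)) -
      -∑ a, (0 : ℝ) • regr (M p.1) (X p.1) ρ₀ a) hN.1 hr.1 hR.1
  have t2 := h.tendsto_sum_sq_sub_sq
    (r := fun p => (noiseMat (W p.1) (M p.1) lam₀ ρ₀ (ζhat p.1 p.2) -
        noiseMat (W p.1) (M p.1) lam₀ ρ₀ (lam₀, ρ₀)) *ᵥ V p.1 p.2 +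
      (residMean (W p.1) (M p.1) (X p.1) β₀ lam₀ (ζhat p.1 p.2) -
        residMean (W p.1) (M p.1) (X p.1) β₀ lam₀ (lam₀, ρ₀)) +
      (-regrComb (M p.1) (X p.1) (ζhat p.1 p.2).2
        (noiseCoef (W p.1) (M p.1) (X p.1) lam₀ ρ₀ (ζhat p.1 p.2) (V p.1 p.2)) -
        -∑ a, (0 : ℝ) • regr (M p.1) (X p.1) ρ₀ a)) t1
  refine t2.congr' ?_
  filter_upwards [hmem, tendsto_fst_probFilter.eventually (eventually_regular hM hX)]
    with p hp hpr
  rw [resid_betaHat_outcome hpr.1 (hpr.2 _ hp)]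
  congr 1
  refine Finset.sum_congr rfl fun i _ => ?_
  rw [residMean_true (hpr.2 _ hζ₀), noiseMat_true]
  simp only [zero_smul, Finset.sum_const_zero, neg_zero, sub_zero, Matrix.sub_mulVec,
    Matrix.one_mulVec, Pi.add_apply, Pi.sub_apply, Pi.neg_apply, sqErr]
  congr 2
  ring

end Consistency

end MESS

end

/-! ### Consistency of the plug-in variance matrix. -/

theorem theorem3 {Ω : Type*} [MeasurableSpace Ω] (μ : Measure Ω) [IsProbabilityMeasure μ]
    (k : ℕ) (c : ℝ) (hc : 0 < c)
    (W M : (n : ℕ) → Matrix (Fin n) (Fin n) ℝ) (X : (n : ℕ) → Matrix (Fin n) (Fin k) ℝ)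
    (Y U V : (n : ℕ) → Ω → Fin n → ℝ)
    (β₀ : Fin k → ℝ) (lam₀ ρ₀ : ℝ)
    (hWdiag : ∀ n i, W n i i = 0) (hMdiag : ∀ n i, M n i i = 0)
    (hmodelY : ∀ n ω, NormedSpace.exp (lam₀ • W n) *ᵥ Y n ω = X n *ᵥ β₀ + U n ω)
    (hmodelU : ∀ n ω, NormedSpace.exp (ρ₀ • M n) *ᵥ U n ω = V n ω)
    (hV : MESS.HeteroskedasticErrors μ V)
    (hW : MESS.UniformlyBoundedSums W) (hM : MESS.UniformlyBoundedSums M)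
    (hζ₀ : (lam₀, ρ₀) ∈ interior (MESS.paramSpace c))
    (hX : MESS.RegularRegressors c M X)
    (hid : MESS.Identified μ c W M X Y (lam₀, ρ₀))
    (ζhat : ℕ → Ω → ℝ × ℝ)
    (hζhat : MESS.IsMEstimator μ c W M X Y ζhat) :
    ∀ a b : Fin k ⊕ Fin 2,
      TendstoInMeasure μ
        (fun n ω =>
          MESS.omegaPlugIn (W n) (M n) (X n) (Y n ω)
              (MESS.betaHat (W n) (M n) (X n) (Y n ω) (ζhat n ω)) (ζhat n ω) a b
            - MESS.omegaTrue μ (W n) (M n) (X n) (Y n) β₀ (lam₀, ρ₀) a b)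
        atTop (fun _ => 0) := by
  obtain rfl : Y = fun n ω => MESS.outcome (W n) (M n) (X n) β₀ lam₀ ρ₀ (V n ω) :=
    funext fun n => funext fun ω => MESS.eq_outcome (hmodelY n ω) (hmodelU n ω)
  intro a b
  obtain ⟨K, h⟩ := hV.exists_fourthMoments
  have hζ₀' := interior_subset hζ₀
  have hmem := hζhat.eventually.mono fun _ hp => hp.1
  have hlim := MESS.tendsto_estimator h hW hM hX hid hζhat
  have hs := MESS.tendsto_sum_resid_sq (β₀ := β₀) h hW hM hX hζ₀' hmem hlim
  have hvec := MESS.convVec_scoreVec hW hM hX hζ₀' hmem hlim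
    (MESS.convReal_betaHat (β₀ := β₀) h hW hM hX hζ₀' hmem hlim)
  have hmat := MESS.convMat_scoreMat (k := k) hW hM hζ₀' hmem hlim
  -- The two summands of `omegaEntry`: a weighted average of squared residuals, and a quadratic form
  -- in them whose limiting matrix has zero diagonal since `scoreMat` has.
  have t1 := h.tendsto_weighted_average hs (MESS.ConvVec.mul (hvec a) (hvec b))
  have t2 := h.tendsto_quadratic_sq hs ((hmat a).hadamard
    (MESS.ConvInProb.add (hmat b) (hmat b).transpose)) fun n i => by
      rw [Matrix.hadamard_apply, MESS.scoreMat_diag (hMdiag n), zero_mul]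
  have t := t1.add t2
  rw [add_zero] at t
  refine MESS.tendstoInMeasure_of_tendsto_probFilter (t.congr fun p => ?_)
  rw [MESS.omegaPlugIn, MESS.omegaForm_diagonal, MESS.omegaTrue_eq (h.centered p.1) (hMdiag p.1),
    MESS.omegaEntry, MESS.omegaEntry]
  simp only [MESS.errVar_eq]
  ring
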